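/- Let $k$ be an algebraically closed field of characteristic $0$, let $n\ge 0$, and let $Q=\{r,\,p_{ij}\}_{1\le i<j\le n}$ be nonzero elements of $k$ with $r\neq 1$. Put $\kappa^i_j=p_{ij}$ for $i<j$, $\kappa^i_i=r$, and $\kappa^i_j=r/p_{ji}$ for $i>j$. Let $V$ have basis $v_1,\dots,v_n$ and let $R=R_Q$ be the Yang–Baxter operator on $V\otimes V$ with $$R(v_i\otimes v_j)=\sum_{a,b}R_{ij}^{ab}\,v_a\otimes v_b,\qquad R_{ij}^{ji}=\kappa^i_j,\quad R_{ij}^{ij}=r-1\ \ (i>j),\quad R_{ij}^{ab}=0\text{ otherwise.}$$ Let $A=A(R_Q)$ be the FRT bialgebra: it is generated by $T_i^j$ $(1\le i,j\le n)$ with relations $\sum_{c,d}R_{ij}^{cd}T_c^aT_d^b=\sum_{c,d}R_{cd}^{ab}T_i^cT_j^d$, and $\Delta(T_i^j)=\sum_c T_i^c\otimes T_c^j$, $\varepsilon(T_i^j)=\delta_{ij}$. For $S\in\{R,R^{-1}\}$ let $\langle\,\cdot\,|\,\cdot\,\rangle_{S}$ be the bilinear form on $A$ determined by $\langle T_i^a|T_j^b\rangle_{S}=S_{ij}^{ba}$,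 $\langle x|yz\rangle=\sum\langle x_1|y\rangle\langle x_2|z\rangle$, $\langle xy|z\rangle=\sum\langle y|z_1\rangle\langle x|z_2\rangle$ and $\langle x|1\rangle=\langle 1|x\rangle=\varepsilon(x)$. Define maps $A\to A^*$ by $\lambda^{\pm}(a)=\langle a|-\rangle_{R^{\pm1}}$ and $\rho^{\pm}(a)=\langle -|a\rangle_{R^{\pm 1}}$. Let $U_Q=U(R_Q)$ be the subalgebra of the convolution algebra $A^*$ generated by the images of $\lambda^{\pm}$ and $\rho^{\pm}$. Let $K_i,L_i\in A^*$ be the algebra homomorphisms $A\to k$ with $K_i(T_j^l)=\delta_{jl}\kappa^i_j$ and $L_i(T_j^l)=\delta_{jl}(\kappa^j_i)^{-1}$. For $1\le i<n$ let $E^i_{i+1},F^{i+1}_i\in A^*$ be the functionals with $$E^i_{i+1}(xy)=K_{i+1}(x)E^i_{i+1}(y)+E^i_{i+1}(x)K_i(y),\qquad E^i_{i+1}(T_a^b)=\delta_{a,i}\delta_{b,i+1},$$ $$F^{i+1}_i(xy)=L_i(x)F^{i+1}_i(y)+F^{i+1}_i(x)L_{i+1}(y),\qquad F^{i+1}_i(T_a^b)=\delta_{a,i+1}\delta_{b,i}.$$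 Let $B^l=\langle K_i^{\pm1},E^i_{i+1}\rangle$ and $B^r=\langle L_i^{\pm1},F^{i+1}_i\rangle$ be the subalgebras of $A^*$ generated by these elements. Then $U_Q$, $B^l$ and $B^r$ are Hopf subalgebras of the finite dual $A^0$, the antipode of $B^l$ is bijective, and $\rho^+(A)\subseteq B^r$, $\lambda^+(A)\subseteq B^l$. There is an injective Hopf algebra map $\theta:B^r\hookrightarrow (B^l)^{0\,cop}$ with $$\theta(\rho^+(b))(\lambda^+(a))=\langle a|b\rangle_R\qquad(a,b\in A).$$ Identify $B^r$ with $\theta(B^r)$. The double crossproduct $B^r\bowtie B^l$ is a Hopf algebra: it is the coalgebra $B^r\otimes B^l$, with unit $1\bowtie 1$ and product $$(p\bowtie h)(p'\bowtie h')=\sum p\,p'_2\bowtie (S^{-1}p'_1\rightharpoonup h\leftharpoonup p'_3)\,h',\qquad f\rightharpoonup h=\sum\langle f,h_2\rangle h_1,\quad h\leftharpoonup f=\sum\langle f,h_1\rangle h_2,$$ where the $p'_i$ and $S$ refer to the coproduct and the antipode of $(B^l)^0$. Finally, $U_Q$ is a Hopf algebra quotient of $B^r\bowtie B^l$: there is a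 surjective Hopf algebra homomorphism $$\phi:B^r\bowtie B^l\to U_Q,\qquad \phi(u\bowtie w)=uw\quad(u\in B^r,\ w\in B^l).$$ -/

import Mathlib

open scoped TensorProduct

universe u v w

namespace FRTDouble

section FiniteDual

/-- The full linear dual `A^*` of a bialgebra, an algebra under the convolution product
`(f g)(x) = ∑ f(x₁) g(x₂)` with unit the counit of `A`. -/
abbrev ConvDual (k : Type u) (A : Type v) [Field k] [Semiring A] [Bialgebra k A] : Type (max u v) :=
  WithConv (A →ₗ[k] k)

variable {k : Type u} [Field k] {A : Type v} [Semiring A] [Bialgebra k A]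

/-- `f` belongs to the finite dual `A^0`: it vanishes on a two-sided ideal of finite codimension
(the kernel of `π`). -/
def IsFinite (f : ConvDual k A) : Prop :=
  ∃ (m : ℕ) (π : A →ₗ[k] (Fin m → k)),
    (∀ a x, π x = 0 → π (a * x) = 0 ∧ π (x * a) = 0) ∧ ∀ x, π x = 0 → f x = 0

variable {H : Type w} [Semiring H] [Algebra k H]

/-- Evaluation at `x ∈ A` of the elements of an algebra `H` mapped to `A^*` by `j`. -/
noncomputable def evalAt (j : H →ₐ[k] ConvDual k A) (x : A) : H →ₗ[k] k where
  toFun f := j f x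
  map_add' _ _ := by simp
  map_smul' _ _ := by simp

/-- The pairing of `H ⊗ H` with `x ⊗ y`, namely `f ⊗ g ↦ f(x) g(y)`. -/
noncomputable def evalAt₂ (j : H →ₐ[k] ConvDual k A) (x y : A) : H ⊗[k] H →ₗ[k] k :=
  LinearMap.mul' k k ∘ₗ TensorProduct.map (evalAt j x) (evalAt j y)

theorem evalAt_apply (j : H →ₐ[k] ConvDual k A) (x : A) (f : H) :
    evalAt j x f = j f x := rfl

theorem evalAt₂_tmul (j : H →ₐ[k] ConvDual k A) (x y : A) (f g : H) :
    evalAt₂ j x y (f ⊗ₜ g) = evalAt j x f * evalAt j y g := by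
  simp [evalAt₂]

theorem evalAt_ext (j : H →ₐ[k] ConvDual k A) (hj : Function.Injective j) {f g : H}
    (h : ∀ x, evalAt j x f = evalAt j x g) : f = g := by
  apply hj
  ext x
  exact h x

theorem tensor_ext (j : H →ₐ[k] ConvDual k A) (hj : Function.Injective j)
    {W : Type*} [AddCommMonoid W] [Module k W] {s t : H ⊗[k] W}
    (h : ∀ x, TensorProduct.lid k W ((evalAt j x).rTensor W s) =
      TensorProduct.lid k W ((evalAt j x).rTensor W t)) : s = t := by
  classical
  let _ : AddCommGroup W := Module.addCommMonoidToAddCommGroup k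
  let b := Module.Basis.ofVectorSpace k W
  let e := TensorProduct.equivFinsuppOfBasisRight (M := H) b
  apply e.injective
  ext i
  refine evalAt_ext j hj fun x => ?_
  have key : ∀ z : H ⊗[k] W, evalAt j x (e z i) =
      b.repr (TensorProduct.lid k W ((evalAt j x).rTensor W z)) i := by
    intro z
    induction z with
    | zero => simp
    | add y z hy hz => simp only [map_add, Finsupp.add_apply, ← hy, ← hz]
    | tmul f m =>
      simp [e, mul_comm]
  rw [key, key, h]

theorem tensor_ext₂ (j : H →ₐ[k] ConvDual k A) (hj : Function.Injective j) {s t : H ⊗[k] H}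
    (h : ∀ x y, evalAt₂ j x y s = evalAt₂ j x y t) : s = t := by
  have key : ∀ (x y : A) (z : H ⊗[k] H),
      evalAt j y (TensorProduct.lid k H ((evalAt j x).rTensor H z)) = evalAt₂ j x y z := by
    intro x y z
    induction z with
    | zero => simp
    | add y z hy hz => simp only [map_add, hy, hz]
    | tmul f m => simp [evalAt₂_tmul]
  refine tensor_ext j hj fun x => evalAt_ext j hj fun y => ?_
  exact (key x y s).trans ((h x y).trans (key x y t).symm)

theorem convDual_mul_apply (f g : ConvDual k A) {x : A} {ι : Type*} (r : Coalgebra.Repr k x ι) :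
    (f * g) x = ∑ i ∈ r.index, f (r.left i) * g (r.right i) := r.convMul_apply f g

/-- The Hopf algebra structure which a subalgebra `j : H ↪ A^*` contained in the finite dual `A^0`
inherits from `A^0`, i.e. `H` is a Hopf subalgebra of `A^0`: the coproduct takes values in `H ⊗ H`
and is dual to the product of `A`, the counit is the evaluation at `1`, and there is an antipode.
The coproduct and the antipode are uniquely determined by these equations. -/
structure DualHopf (j : H →ₐ[k] ConvDual k A) where
  injective : Function.Injective j
  isFinite : ∀ f, IsFinite (j f)
  comul : H →ₗ[k] H ⊗[k] H
  evalAt₂_comul : ∀ (f : H) (x y : A), evalAt₂ j x y (comul f) = j f (x * y)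
  antipode : H →ₗ[k] H
  antipode_left : ∀ f : H,
    LinearMap.mul' k H (antipode.rTensor H (comul f)) = algebraMap k H (j f 1)
  antipode_right : ∀ f : H,
    LinearMap.mul' k H (antipode.lTensor H (comul f)) = algebraMap k H (j f 1)

namespace DualHopf

variable {j : H →ₐ[k] ConvDual k A} (s : DualHopf j)

/-- The coalgebra structure given by the dual coproduct; coassociativity and counitality follow from
those properties of the product of `A` which they dualize. -/
noncomputable abbrev coalgebra : Coalgebra k H where
  comul := s.comul
  counit := evalAt j 1
  coassoc := by
    ext f
    refine tensor_ext j s.injective fun x => tensor_ext₂ j s.injective fun y z => ?_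
    have k1 : ∀ t : H ⊗[k] H, evalAt₂ j y z (TensorProduct.lid k (H ⊗[k] H)
        ((evalAt j x).rTensor (H ⊗[k] H) (s.comul.lTensor H t))) = evalAt₂ j x (y * z) t := by
      intro t
      induction t with
      | zero => simp
      | add p q hp hq => simp only [map_add, hp, hq]
      | tmul f g => simp [evalAt₂_tmul, s.evalAt₂_comul, evalAt_apply]
    have k2 : ∀ t : H ⊗[k] H, evalAt₂ j y z (TensorProduct.lid k (H ⊗[k] H)
        ((evalAt j x).rTensor (H ⊗[k] H)
          (TensorProduct.assoc k H H H (s.comul.rTensor H t)))) = evalAt₂ j (x * y) z t := by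
      intro t
      induction t with
      | zero => simp
      | add p q hp hq => simp only [map_add, hp, hq]
      | tmul f g =>
        rw [LinearMap.rTensor_tmul, evalAt₂_tmul, evalAt_apply j (x * y), ← s.evalAt₂_comul]
        generalize s.comul f = w
        induction w with
        | zero => simp
        | add p q hp hq => simp only [TensorProduct.add_tmul, map_add, hp, hq, add_mul]
        | tmul a b => simp [evalAt₂_tmul, mul_assoc]
    exact (k2 _).trans (((s.evalAt₂_comul _ _ _).trans (by rw [mul_assoc])).trans
      ((k1 _).trans (s.evalAt₂_comul _ _ _)).symm)
  rTensor_counit_comp_comul := by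
    ext f
    apply (TensorProduct.lid k H).injective
    refine evalAt_ext j s.injective fun x => ?_
    have k1 : ∀ t : H ⊗[k] H, evalAt j x (TensorProduct.lid k H ((evalAt j 1).rTensor H t)) =
        evalAt₂ j 1 x t := by
      intro t
      induction t with
      | zero => simp
      | add p q hp hq => simp only [map_add, hp, hq]
      | tmul f g => simp [evalAt₂_tmul]
    refine (k1 _).trans ?_
    simp [s.evalAt₂_comul, evalAt_apply]
  lTensor_counit_comp_comul := by
    ext f
    apply (TensorProduct.rid k H).injective
    refine evalAt_ext j s.injective fun x => ?_
    have k1 : ∀ t : H ⊗[k] H, evalAt j x (TensorProduct.rid k H ((evalAt j 1).lTensor H t)) =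
        evalAt₂ j x 1 t := by
      intro t
      induction t with
      | zero => simp
      | add p q hp hq => simp only [map_add, hp, hq]
      | tmul f g => simp [evalAt₂_tmul, mul_comm]
    refine (k1 _).trans ?_
    simp [s.evalAt₂_comul, evalAt_apply]

theorem evalAt₂_mul (j : H →ₐ[k] ConvDual k A) (x y : A) (p q : H ⊗[k] H) {ι κ : Type*}
    (r : Coalgebra.Repr k x ι) (r' : Coalgebra.Repr k y κ) : evalAt₂ j x y (p * q) =
      ∑ i ∈ r.index, ∑ l ∈ r'.index,
        evalAt₂ j (r.left i) (r'.left l) p * evalAt₂ j (r.right i) (r'.right l) q := by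
  induction p with
  | zero => simp
  | add p p' h h' => simp only [add_mul, map_add, h, h', Finset.sum_add_distrib]
  | tmul a b =>
    induction q with
    | zero => simp
    | add q q' h h' => simp only [mul_add, map_add, h, h', Finset.sum_add_distrib]
    | tmul c d =>
      rw [Algebra.TensorProduct.tmul_mul_tmul, evalAt₂_tmul, evalAt_apply, evalAt_apply,
        map_mul, map_mul, convDual_mul_apply _ _ r, convDual_mul_apply _ _ r', Finset.sum_mul_sum]
      refine Finset.sum_congr rfl fun i _ => Finset.sum_congr rfl fun l _ => ?_
      simp only [evalAt₂_tmul, evalAt_apply]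
      ring

/-- The bialgebra structure on `H ⊆ A^0`. -/
noncomputable abbrev bialgebra : Bialgebra k H :=
  letI := s.coalgebra
  Bialgebra.mk' k H
    (by
      change j 1 1 = 1
      simp)
    (by
      intro a b
      change j (a * b) 1 = j a 1 * j b 1
      simp [Algebra.TensorProduct.one_def])
    (by
      refine tensor_ext₂ j s.injective fun x y => ?_
      refine (s.evalAt₂_comul _ _ _).trans ?_
      rw [Algebra.TensorProduct.one_def, evalAt₂_tmul]
      simp [evalAt_apply])
    (by
      intro a b
      refine tensor_ext₂ j s.injective fun x y => ?_
      refine (s.evalAt₂_comul _ _ _).trans ?_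
      have r := Coalgebra.Repr.arbitrary k x
      have r' := Coalgebra.Repr.arbitrary k y
      refine Eq.trans ?_ (evalAt₂_mul j x y _ _ r r').symm
      change j (a * b) (x * y) = ∑ i ∈ r.index, ∑ l ∈ r'.index,
        evalAt₂ j (r.left i) (r'.left l) (s.comul a) *
          evalAt₂ j (r.right i) (r'.right l) (s.comul b)
      simp only [s.evalAt₂_comul]
      rw [map_mul j, LinearMap.convMul_apply, Bialgebra.comul_mul, ← r.eq, ← r'.eq,
        Finset.sum_mul_sum]
      simp)

/-- The Hopf algebra structure on `H ⊆ A^0`. -/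
noncomputable abbrev hopfAlgebra : HopfAlgebra k H :=
  letI := s.bialgebra
  { antipode := s.antipode
    mul_antipode_rTensor_comul := LinearMap.ext s.antipode_left
    mul_antipode_lTensor_comul := LinearMap.ext s.antipode_right }

end DualHopf
end FiniteDual
section FRT

variable {k : Type u} [Field k] {I : Type v} [Fintype I]

/-- The defining relations of the FRT bialgebra of `R(v_i ⊗ v_j) = ∑ R_{ij}^{ab} v_a ⊗ v_b`, where
`R i j a b = R_{ij}^{ab}` and `(i, j)` stands for the generator `T_i^j`. They say that `R` commutes
with the coaction `v_i ↦ ∑ T_i^j ⊗ v_j`. -/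
inductive FRTRel (R : I → I → I → I → k) :
    FreeAlgebra k (I × I) → FreeAlgebra k (I × I) → Prop
  | rtt (i j a b : I) : FRTRel R
      (∑ c, ∑ d, R i j c d • (FreeAlgebra.ι k (c, a) * FreeAlgebra.ι k (d, b)))
      (∑ c, ∑ d, R c d a b • (FreeAlgebra.ι k (i, c) * FreeAlgebra.ι k (j, d)))

/-- The Faddeev-Reshetikhin-Takhtajan bialgebra `A(R)`. -/
def FRT (R : I → I → I → I → k) : Type (max u v) := RingQuot (FRTRel R)

namespace FRT

section Basic

variable (R : I → I → I → I → k)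

noncomputable instance : Ring (FRT R) := inferInstanceAs (Ring (RingQuot (FRTRel R)))

noncomputable instance : Algebra k (FRT R) :=
  inferInstanceAs (Algebra k (RingQuot (FRTRel R)))

/-- The generator `T_i^j`. -/
noncomputable def T (i j : I) : FRT R :=
  RingQuot.mkAlgHom k (FRTRel R) (FreeAlgebra.ι k (i, j))

theorem rtt (i j a b : I) :
    ∑ c, ∑ d, R i j c d • (T R c a * T R d b) = ∑ c, ∑ d, R c d a b • (T R i c * T R j d) := by
  have h := RingQuot.mkAlgHom_rel k (FRTRel.rtt (R := R) i j a b)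
  simp only [map_sum, map_smul, map_mul] at h
  exact h

variable {R}

/-- Universal property of `A(R)` as an algebra. -/
noncomputable def lift {B : Type*} [Semiring B] [Algebra k B] (t : I → I → B)
    (h : ∀ i j a b, ∑ c, ∑ d, R i j c d • (t c a * t d b) =
      ∑ c, ∑ d, R c d a b • (t i c * t j d)) : FRT R →ₐ[k] B :=
  RingQuot.liftAlgHom k ⟨FreeAlgebra.lift k fun x => t x.1 x.2, by
    rintro _ _ ⟨i, j, a, b⟩
    simpa only [map_sum, map_smul, map_mul, FreeAlgebra.lift_ι_apply] using h i j a b⟩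

@[simp] theorem lift_T {B : Type*} [Semiring B] [Algebra k B] (t : I → I → B)
    (h : ∀ i j a b, ∑ c, ∑ d, R i j c d • (t c a * t d b) =
      ∑ c, ∑ d, R c d a b • (t i c * t j d)) (i j : I) : lift t h (T R i j) = t i j := by
  refine (RingQuot.liftAlgHom_mkAlgHom_apply k (s := FRTRel R) _ _ _).trans ?_
  exact FreeAlgebra.lift_ι_apply _ _

theorem hom_ext {B : Type*} [Semiring B] [Algebra k B] {f g : FRT R →ₐ[k] B}
    (h : ∀ i j, f (T R i j) = g (T R i j)) : f = g := by
  refine RingQuot.ringQuot_ext' k f g (FreeAlgebra.hom_ext ?_)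
  funext x
  exact h x.1 x.2

theorem inductionOn {C : FRT R → Prop} (halg : ∀ r : k, C (algebraMap k _ r))
    (hT : ∀ i j, C (T R i j)) (hmul : ∀ x y, C x → C y → C (x * y))
    (hadd : ∀ x y, C x → C y → C (x + y)) (x : FRT R) : C x := by
  obtain ⟨y, rfl⟩ := RingQuot.mkAlgHom_surjective k (FRTRel R) x
  induction y using FreeAlgebra.induction with
  | grade0 r => exact (AlgHom.commutes (RingQuot.mkAlgHom k (FRTRel R)) r).symm ▸ halg r
  | grade1 p => exact hT p.1 p.2
  | mul a b ha hb => rw [map_mul]; exact hmul _ _ ha hb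
  | add a b ha hb => rw [map_add]; exact hadd _ _ ha hb

variable (R)

/-- The coproduct `T_i^j ↦ ∑ T_i^c ⊗ T_c^j`. -/
noncomputable def comulHom : FRT R →ₐ[k] FRT R ⊗[k] FRT R :=
  lift (fun i j => ∑ c, T R i c ⊗ₜ[k] T R c j) (by
    intro i j a b
    have h1 : ∀ c d a b, (∑ e, T R c e ⊗ₜ[k] T R e a) * (∑ f, T R d f ⊗ₜ[k] T R f b) =
        ∑ e, ∑ f, (T R c e * T R d f) ⊗ₜ[k] (T R e a * T R f b) := by
      intro c d a b
      simp [Finset.sum_mul_sum]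
    simp only [h1]
    have s4 : ∀ F : I → I → I → I → FRT R ⊗[k] FRT R,
        ∑ c, ∑ d, ∑ e, ∑ f, F c d e f = ∑ e, ∑ f, ∑ c, ∑ d, F c d e f := by
      intro F
      rw [Finset.sum_congr rfl fun c _ => Finset.sum_comm, Finset.sum_comm]
      refine Finset.sum_congr rfl fun e _ => ?_
      rw [Finset.sum_congr rfl fun c _ => Finset.sum_comm, Finset.sum_comm]
    calc _ = ∑ e, ∑ f, (∑ c, ∑ d, R i j c d • (T R c e * T R d f)) ⊗ₜ[k] (T R e a * T R f b) := by
          simp only [Finset.smul_sum, TensorProduct.sum_tmul, TensorProduct.smul_tmul']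
          rw [s4]
      _ = ∑ e, ∑ f, (T R i e * T R j f) ⊗ₜ[k] (∑ c, ∑ d, R e f c d • (T R c a * T R d b)) := by
          simp only [rtt R i j, TensorProduct.sum_tmul, TensorProduct.tmul_sum, ← TensorProduct.smul_tmul',
            TensorProduct.tmul_smul]
          rw [s4]
      _ = _ := by
          simp only [rtt, Finset.smul_sum, TensorProduct.tmul_sum, TensorProduct.tmul_smul]
          rw [s4])

@[simp] theorem comulHom_T (i j : I) : comulHom R (T R i j) = ∑ c, T R i c ⊗ₜ[k] T R c j :=
  lift_T _ _ i j

variable [DecidableEq I]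

/-- The counit `T_i^j ↦ δ_{ij}`. -/
noncomputable def counitHom : FRT R →ₐ[k] k :=
  lift (fun i j => if i = j then 1 else 0) (by
    intro i j a b
    simp)

@[simp] theorem counitHom_T (i j : I) : counitHom R (T R i j) = if i = j then 1 else 0 :=
  lift_T _ _ i j

noncomputable instance : Bialgebra k (FRT R) :=
  Bialgebra.ofAlgHom (comulHom R) (counitHom R)
    (hom_ext fun i j => by
      simp [TensorProduct.sum_tmul, TensorProduct.tmul_sum]
      rw [Finset.sum_comm])
    (hom_ext fun i j => by
      simp only [AlgHom.comp_apply, comulHom_T, map_sum, Algebra.TensorProduct.map_tmul,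
        counitHom_T]
      rw [Finset.sum_eq_single i (by intro c _ hc; simp [hc.symm]) (by simp)]
      simp)
    (hom_ext fun i j => by
      simp only [AlgHom.comp_apply, comulHom_T, map_sum, Algebra.TensorProduct.map_tmul,
        counitHom_T]
      rw [Finset.sum_eq_single j (by intro c _ hc; simp [hc]) (by simp)]
      simp)

theorem comul_T (i j : I) :
    Coalgebra.comul (R := k) (T R i j) = ∑ c, T R i c ⊗ₜ[k] T R c j := comulHom_T R i j

theorem counit_T (i j : I) :
    Coalgebra.counit (R := k) (T R i j) = if i = j then 1 else 0 := counitHom_T R i j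

end Basic

/-- The braid relations between `R` and `S` under which the matrix `S` defines a pairing on `A(R)`:
with `R₁ = R ⊗ 1`, `R₂ = 1 ⊗ R`, they are `S₂ S₁ R₂ = R₁ S₂ S₁` and `S₁ S₂ R₁ = R₂ S₁ S₂`. For
`S = R` both are the braid form of the Yang-Baxter equation, and then they also hold for `S = R⁻¹`. -/
structure IsCompatible (R S : I → I → I → I → k) : Prop where
  left : ∀ i j a b p q, ∑ c, ∑ d, R i j c d * ∑ m, S p c a m * S m d b q =
    ∑ c, ∑ d, R c d a b * ∑ m, S p i c m * S m j d q
  right : ∀ i j a b p q, ∑ c, ∑ d, R i j c d * ∑ m, S d p m b * S c m q a =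
    ∑ c, ∑ d, R c d a b * ∑ m, S j p m d * S i m q c

variable [DecidableEq I] {R S : I → I → I → I → k}

/-- The representation of `A(R)` with matrix entries `x ↦ ⟨T_i^j | x⟩`, so that
`⟨T_i^j | T_a^b⟩ = S_{ia}^{bj}`. -/
noncomputable def rep (h : IsCompatible R S) : FRT R →ₐ[k] Matrix I I k :=
  lift (fun a b => Matrix.of fun i j => S i a b j) (by
    intro i j a b
    ext p q
    simpa [Matrix.sum_apply, Matrix.mul_apply] using h.left i j a b p q)

theorem rep_T (h : IsCompatible R S) (a b i j : I) : rep h (T R a b) i j = S i a b j := by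
  simp [rep]

/-- The functional `⟨T_i^j | -⟩`. -/
noncomputable def entry (h : IsCompatible R S) (i j : I) : ConvDual k (FRT R) :=
  WithConv.toConv ((Matrix.entryLinearMap k k i j) ∘ₗ (rep h).toLinearMap)

theorem entry_apply (h : IsCompatible R S) (i j : I) (x : FRT R) :
    entry h i j x = rep h x i j := rfl

theorem entry_mul (h : IsCompatible R S) (i j : I) (x y : FRT R) :
    entry h i j (x * y) = ∑ c, entry h i c x * entry h c j y := by
  simp [entry_apply, Matrix.mul_apply]

theorem entry_relation (h : IsCompatible R S) (i j a b : I) :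
    ∑ c, ∑ d, R i j c d • (entry h d b * entry h c a) =
      ∑ c, ∑ d, R c d a b • (entry h j d * entry h i c) := by
  let N₀ : FRT R ⊗[k] FRT R → Matrix (I × I) (I × I) k := fun t => Matrix.of fun p q =>
    LinearMap.mul' k k
      (TensorProduct.map (entry h p.2 q.2).ofConv (entry h p.1 q.1).ofConv t)
  have N₀_mul : ∀ s t, N₀ (s * t) = N₀ s * N₀ t := by
    intro s t
    induction s with
    | zero => ext p q; simp [N₀, Matrix.mul_apply]
    | add s s' h1 h2 =>
      have : N₀ (s + s') = N₀ s + N₀ s' := by ext p q; simp [N₀]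
      rw [this, add_mul, add_mul, ← h1, ← h2]
      ext p q; simp [N₀]
    | tmul x y =>
      induction t with
      | zero => ext p q; simp [N₀, Matrix.mul_apply]
      | add s s' h1 h2 =>
        have : N₀ (s + s') = N₀ s + N₀ s' := by ext p q; simp [N₀]
        rw [this, mul_add, mul_add, ← h1, ← h2]
        ext p q; simp [N₀]
      | tmul z w =>
        ext p q
        simp only [N₀, Algebra.TensorProduct.tmul_mul_tmul, Matrix.of_apply, Matrix.mul_apply,
          TensorProduct.map_tmul, LinearMap.mul'_apply, entry_mul]
        rw [Fintype.sum_prod_type, Finset.sum_mul_sum, Finset.sum_comm]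
        refine Finset.sum_congr rfl fun c _ => Finset.sum_congr rfl fun d _ => ?_
        ring
  let Rm : Matrix (I × I) (I × I) k := Matrix.of fun p q => R p.1 p.2 q.1 q.2
  have comm : ∀ x : FRT R, Rm * N₀ (Coalgebra.comul x) = N₀ (Coalgebra.comul x) * Rm := by
    intro x
    induction x using FRT.inductionOn with
    | halg r =>
      have : N₀ (Coalgebra.comul (algebraMap k (FRT R) r)) = r • 1 := by
        ext p q
        rw [Bialgebra.comul_algebraMap, Algebra.TensorProduct.algebraMap_apply]
        simp only [N₀, Matrix.of_apply, TensorProduct.map_tmul, LinearMap.mul'_apply, entry_apply,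
          AlgHom.commutes, map_one, Matrix.algebraMap_matrix_apply, Matrix.one_apply,
          Matrix.smul_apply, Prod.ext_iff, smul_eq_mul]
        by_cases h1 : p.1 = q.1 <;> by_cases h2 : p.2 = q.2 <;> simp [h1, h2]
      rw [this]; simp
    | hT e f =>
      ext ⟨i, j⟩ ⟨a, b⟩
      have := h.right i j a b e f
      simp only [Rm, N₀, comul_T, Matrix.mul_apply, Fintype.sum_prod_type, Matrix.of_apply, map_sum,
        TensorProduct.map_tmul, LinearMap.mul'_apply, entry_apply, rep_T, mul_comm _ (R _ _ _ _)]
      exact this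
    | hmul x y hx hy => rw [Bialgebra.comul_mul, N₀_mul, ← mul_assoc, hx, mul_assoc, hy, mul_assoc]
    | hadd x y hx hy =>
      have : ∀ s s', N₀ (s + s') = N₀ s + N₀ s' := by intro s s'; ext p q; simp [N₀]
      rw [map_add, this, mul_add, add_mul, hx, hy]
  ext x
  have := congrFun (congrFun (comm x) (i, j)) (a, b)
  simp only [Rm, N₀, Matrix.mul_apply, Fintype.sum_prod_type, Matrix.of_apply,
    mul_comm _ (R _ _ _ _)] at this
  simpa using this

/-- The map `a ↦ ⟨a | -⟩`, an algebra anti-homomorphism from `A(R)` to its dual. -/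
noncomputable def lamHom (h : IsCompatible R S) : FRT R →ₐ[k] (ConvDual k (FRT R))ᵐᵒᵖ :=
  lift (fun i j => MulOpposite.op (entry h i j)) (by
    intro i j a b
    apply MulOpposite.unop_injective
    simpa using entry_relation h i j a b)

/-- The bilinear form `⟨- | -⟩_S` on `A(R)`. It is determined by
`⟨T_i^a | T_j^b⟩ = S_{ij}^{ba}`, `⟨a | x y⟩ = ∑ ⟨a₁ | x⟩ ⟨a₂ | y⟩` and
`⟨a b | x⟩ = ∑ ⟨b | x₁⟩ ⟨a | x₂⟩`. -/
noncomputable def pairing (h : IsCompatible R S) : FRT R →ₗ[k] FRT R →ₗ[k] k :=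
  (WithConv.linearEquiv k (FRT R →ₗ[k] k)).toLinearMap ∘ₗ
    (MulOpposite.opLinearEquiv k).symm.toLinearMap ∘ₗ (lamHom h).toLinearMap

theorem pairing_T_T (h : IsCompatible R S) (i j a b : I) :
    pairing h (T R i a) (T R j b) = S i j b a := by
  simp [pairing, lamHom, entry_apply, rep_T]

theorem pairing_T (h : IsCompatible R S) (i j : I) (x : FRT R) :
    pairing h (T R i j) x = rep h x i j := by
  simp [pairing, lamHom, entry_apply]

theorem pairing_T_mul (h : IsCompatible R S) (i j : I) (x y : FRT R) :
    pairing h (T R i j) (x * y) =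
      ∑ c, pairing h (T R i c) x * pairing h (T R c j) y := by
  simp [pairing_T, Matrix.mul_apply]

theorem entry_eq_zero (h : IsCompatible R S) (P : I → I → Prop) (hrefl : ∀ i, P i i)
    (htrans : ∀ i c j, P i c → P c j → P i j)
    (hS : ∀ i j a b, ¬ P i j → S i a b j = 0) (i j : I) (x : FRT R) (hij : ¬ P i j) :
    pairing h (T R i j) x = 0 := by
  induction x using FRT.inductionOn generalizing i j with
  | halg r =>
    have : i ≠ j := by rintro rfl; exact hij (hrefl i)
    simp [pairing_T, Matrix.algebraMap_matrix_apply, this]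
  | hT a b => rw [pairing_T_T]; exact hS i j a b hij
  | hmul x y hx hy =>
    rw [pairing_T_mul]
    refine Finset.sum_eq_zero fun c _ => ?_
    by_cases h1 : P i c
    · rw [hy c j (fun h2 => hij (htrans i c j h1 h2)), mul_zero]
    · rw [hx i c h1, zero_mul]
  | hadd x y hx hy => rw [map_add, hx i j hij, hy i j hij, add_zero]

theorem entry_diag_unique (h : IsCompatible R S) (P : I → I → Prop) (hrefl : ∀ i, P i i)
    (htrans : ∀ i c j, P i c → P c j → P i j) (hanti : ∀ i c, P i c → P c i → i = c)
    (hS : ∀ i j a b, ¬ P i j → S i a b j = 0) (i : I) (f : FRT R →ₐ[k] k)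
    (hf : ∀ a b, f (T R a b) = S i a b i) :
    WithConv.toConv (pairing h (T R i i)) = WithConv.toConv f.toLinearMap := by
  congr 1
  ext x
  induction x using FRT.inductionOn with
  | halg r => simp [pairing_T, Matrix.algebraMap_matrix_apply]
  | hT a b => rw [pairing_T_T]; exact (hf a b).symm
  | hmul x y hx hy =>
    rw [pairing_T_mul, Finset.sum_eq_single i, hx, hy]
    · exact (map_mul f x y).symm
    · intro c _ hc
      by_cases h1 : P i c
      · rw [entry_eq_zero h P hrefl htrans hS c i y (fun h2 => hc (hanti i c h1 h2).symm),
          mul_zero]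
      · rw [entry_eq_zero h P hrefl htrans hS i c x h1, zero_mul]
    · simp
  | hadd x y hx hy => rw [map_add, map_add, hx, hy]

end FRT
end FRT
section Aux

variable {k : Type*} [Field k] {I : Type*} [LinearOrder I]

/-- Kronecker delta. -/
def dl (i j : I) : k := if i = j then 1 else 0
/-- Matrices of the form `v_i ⊗ v_j ↦ α_{ij} v_j ⊗ v_i + β_{ij} v_i ⊗ v_j`. -/
def flipForm (α β : I → I → k) (i j a b : I) : k :=
  α i j * (dl j a * dl i b) + β i j * (dl i a * dl j b)

theorem tri (α : I → I → k) (r : k) (ha : ∀ i j, j < i → α i j  = r / α j i) (i j : I) :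
    (i < j ∧ ¬ j < i ∧ α j i = r / α i j) ∨ i = j ∨ (j < i ∧ ¬ i < j ∧ α i j = r / α j i) := by
  rcases lt_trichotomy i j with h | h | h
  · exact .inl ⟨h, h.not_gt, ha _ _ h⟩
  · exact .inr (.inl h)
  · exact .inr (.inr ⟨h, h.not_gt, ha _ _ h⟩)

variable [Fintype I]

theorem sum_dl (i : I) (G : I → k) : ∑ m, dl i m * G m = G i := by simp [dl]

theorem flipForm_sum (α β : I → I → k) (i j : I) (G : I → I → k) :
   ∑ c, ∑ d, flipForm α β i j c d * G c d = α i j * G j i + β i j * G i j := by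
  simp [flipForm, add_mul, Finset.sum_add_distrib, mul_assoc, ← Finset.mul_sum, sum_dl]

theorem flipForm_sum₁ (α β : I → I → k) (p c a : I) (G : I → k) :
   ∑ m, flipForm α β p c a m * G m = α p c * dl c a * G p + β p c * dl p a * G c := by
  simp only [flipForm, add_mul, Finset.sum_add_distrib]
  congr 1
  · rw [← sum_dl p G, Finset.mul_sum]; refine Finset.sum_congr rfl fun m _ => by ring
  · rw [← sum_dl c G, Finset.mul_sum]; refine Finset.sum_congr rfl fun m _ => by ring
theorem flipForm_sum₂ (α β : I → I → k) (p c a : I) (G : I → k) :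
   ∑ m, flipForm α β p c m a * G m = α p c * dl p a * G c + β p c * dl c a * G p := by
  simp only [flipForm, add_mul, Finset.sum_add_distrib]
  congr 1
  · rw [← sum_dl c G, Finset.mul_sum]; refine Finset.sum_congr rfl fun m _ => by ring
  · rw [← sum_dl p G, Finset.mul_sum]; refine Finset.sum_congr rfl fun m _ => by ring

theorem flipForm_aux₁ (α β α' β' : I → I → k) (i j a b p q : I) :
   ∑ c, ∑ d, flipForm α β c d a b * ∑ m, flipForm α' β' p i c m * flipForm α' β' m j d q =
    α' p i * (α' p j * dl p q * flipForm α β i j a b + β' p j * dl j q * flipForm α β i p a b) +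
    β' p i * (α' i j * dl i q * flipForm α β p j a b + β' i j * dl j q * flipForm α β p i a b) := by
  calc _ = ∑ c, ∑ m, flipForm α' β' p i c m * ∑ d, flipForm α' β' m j d q * flipForm α β c d a b := by
        refine Finset.sum_congr rfl fun c _ => ?_
        simp only [Finset.mul_sum]
        rw [Finset.sum_comm]
        refine Finset.sum_congr rfl fun m _ => Finset.sum_congr rfl fun d _ => by ring
    _ = _ := by rw [flipForm_sum]; simp only [flipForm_sum₂]

theorem flipForm_aux₂ (α β α' β' : I → I → k) (i j a b p q : I) :
   ∑ c, ∑ d, flipForm α β c d a b * ∑ m, flipForm α' β' j p m d * flipForm α' β' i m q c =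
    α' j p * (α' i p * dl p q * flipForm α β i j a b + β' i p * dl i q * flipForm α β p j a b) +
    β' j p * (α' i j * dl j q * flipForm α β i p a b + β' i j * dl i q * flipForm α β j p a b) := by
  calc _ = ∑ m, ∑ d, flipForm α' β' j p m d * ∑ c, flipForm α' β' i m q c * flipForm α β c d a b := by
        simp only [Finset.mul_sum]
        rw [Finset.sum_comm]
        rw [Finset.sum_congr rfl fun d _ => Finset.sum_comm]
        rw [Finset.sum_comm]
        refine Finset.sum_congr rfl fun m _ => Finset.sum_congr rfl fun d _ => Finset.sum_congr rfl fun c _ => by ring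
    _ = _ := by rw [flipForm_sum]; simp only [flipForm_sum₁]

theorem flipForm_left (α β α' β' : I → I → k) (r : k) (hr : r ≠ 0)
    (h1 : ∀ i, α i i = r) (hb : ∀ i j, β i j = if j < i then r - 1 else 0)
    (h0 : ∀ i j, α i j ≠ 0) (ha : ∀ i j, j < i → α i j = r / α j i)
    (h : ((∀ i j, α' i j = α i j) ∧ ∀ i j, β' i j = β i j) ∨
      ((∀ i j, α' i j = (α j i)⁻¹) ∧ ∀ i j, β' i j = if i < j then r⁻¹ - 1 else 0))
    (i j a b p q : I) :
   ∑ c, ∑ d, flipForm α β i j c d * ∑ m, flipForm α' β' p c a m * flipForm α' β' m d b q =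
   ∑ c, ∑ d, flipForm α β c d a b * ∑ m, flipForm α' β' p i c m * flipForm α' β' m j d q := by
  rw [flipForm_sum, flipForm_aux₁]
  simp only [flipForm_sum₁]
  have t1 := tri α r ha i j
  have t2 := tri α r ha i p
  have t3 := tri α r ha j p
  have z1 := h0 i j
  have z2 := h0 i p
  have z3 := h0 j p
  have z4 := h0 j i
  have z5 := h0 p i
  have z6 := h0 p j
  rcases h with ⟨ha', hb'⟩ | ⟨ha', hb'⟩
  all_goals
    simp only [flipForm, ha', hb', hb]
    clear hb ha' hb' ha h0
    rcases t1 with ⟨g1, n1, k1⟩ | rfl | ⟨g1, n1, k1⟩ <;>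
    rcases t2 with ⟨g2, n2, k2⟩ | rfl | ⟨g2, n2, k2⟩ <;>
    rcases t3 with ⟨g3, n3, k3⟩ | g3 | ⟨g3, n3, k3⟩ <;>
    first
    | (exfalso; order)
    | (try subst g3
       simp only [*, lt_irrefl, if_true, if_false]
       field_simp
       try ring)

theorem flipForm_right (α β α' β' : I → I → k) (r : k) (hr : r ≠ 0)
    (h1 : ∀ i, α i i = r) (hb : ∀ i j, β i j = if j < i then r - 1 else 0)
    (h0 : ∀ i j, α i j ≠ 0) (ha : ∀ i j, j < i → α i j = r / α j i)
    (h : ((∀ i j, α' i j = α i j) ∧ ∀ i j, β' i j = β i j) ∨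
      ((∀ i j, α' i j = (α j i)⁻¹) ∧ ∀ i j, β' i j = if i < j then r⁻¹ - 1 else 0))
    (i j a b p q : I) :
   ∑ c, ∑ d, flipForm α β i j c d * ∑ m, flipForm α' β' d p m b * flipForm α' β' c m q a =
   ∑ c, ∑ d, flipForm α β c d a b * ∑ m, flipForm α' β' j p m d * flipForm α' β' i m q c := by
  rw [flipForm_sum, flipForm_aux₂]
  simp only [flipForm_sum₂]
  have t1 := tri α r ha i j
  have t2 := tri α r ha i p
  have t3 := tri α r ha j p
  have z1 := h0 i j
  have z2 := h0 i p
  have z3 := h0 j p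
  have z4 := h0 j i
  have z5 := h0 p i
  have z6 := h0 p j
  rcases h with ⟨ha', hb'⟩ | ⟨ha', hb'⟩
  all_goals
    simp only [flipForm, ha', hb', hb]
    clear hb ha' hb' ha h0
    rcases t1 with ⟨g1, n1, k1⟩ | rfl | ⟨g1, n1, k1⟩ <;>
    rcases t2 with ⟨g2, n2, k2⟩ | rfl | ⟨g2, n2, k2⟩ <;>
    rcases t3 with ⟨g3, n3, k3⟩ | g3 | ⟨g3, n3, k3⟩ <;>
    first
    | (exfalso; order)
    | (try subst g3
       simp only [*, lt_irrefl, if_true, if_false]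
       field_simp
       try ring)

end Aux

section Multiparameter

/-- The parameters `Q = {r ≠ 1, p_{ij} : i < j}`, nonzero elements of `k`; only the values `p i j` with
`i < j` are used. The indices `1, …, n` are represented by `Fin n`. -/
structure Parameters (k : Type u) [Field k] (n : ℕ) where
  r : k
  p : Fin n → Fin n → k
  r_ne_zero : r ≠ 0
  r_ne_one : r ≠ 1
  p_ne_zero : ∀ i j, i < j → p i j ≠ 0

namespace Parameters

variable {k : Type u} [Field k] {n : ℕ} (Q : Parameters k n)

/-- `kappa i j` is `κ^i_j`: `p_{ij}` if `i < j`, `r` if `i = j`, and `q_{ji} = r / p_{ji}` if `i > j`. -/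
def kappa (i j : Fin n) : k :=
  if i < j then Q.p i j else if i = j then Q.r else Q.r / Q.p j i

theorem kappa_self (i : Fin n) : Q.kappa i i = Q.r := by simp [kappa]

theorem kappa_ne_zero (i j : Fin n) : Q.kappa i j ≠ 0 := by
  unfold kappa
  split_ifs with h1 h2
  · exact Q.p_ne_zero i j h1
  · exact Q.r_ne_zero
  · exact div_ne_zero Q.r_ne_zero (Q.p_ne_zero j i (by order))

theorem kappa_of_gt (i j : Fin n) (h : j < i) : Q.kappa i j = Q.r / Q.kappa j i := by
  simp [kappa, h, h.not_gt, h.ne']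

/-- The Yang-Baxter operator `R_Q(v_i ⊗ v_j) = ∑ R_{ij}^{ab} v_a ⊗ v_b`. -/
def R (i j a b : Fin n) : k :=
  if i = b ∧ j = a then Q.kappa i j else if i = a ∧ j = b ∧ j < i then Q.r - 1 else 0

/-- The inverse of `R_Q`. -/
def Rinv (i j a b : Fin n) : k :=
  if i = b ∧ j = a then (Q.kappa j i)⁻¹ else if i = a ∧ j = b ∧ i < j then Q.r⁻¹ - 1 else 0

theorem R_eq : Q.R = flipForm Q.kappa (fun i j => if j < i then Q.r - 1 else 0) := by
  funext i j a b
  unfold R flipForm dl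
  by_cases h0 : i = j
  · subst h0
    by_cases h1 : i = b <;> by_cases h2 : i = a <;> simp [h1, h2]
  · by_cases h1 : i = b
    · subst h1
      by_cases h2 : j = a
      · subst h2
        simp [h0]
      · simp [h2, Ne.symm h0]
    · by_cases h2 : j = a
      · subst h2
        simp [h0, h1]
      · by_cases h3 : i = a
        · subst h3
          by_cases h4 : j = b
          · subst h4
            simp [h0]
          · simp [h1, h2, h4]
        · simp [h1, h2, h3]

theorem Rinv_eq : Q.Rinv =
    flipForm (fun i j => (Q.kappa j i)⁻¹) (fun i j => if i < j then Q.r⁻¹ - 1 else 0) := by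
  funext i j a b
  unfold Rinv flipForm dl
  by_cases h0 : i = j
  · subst h0
    by_cases h1 : i = b <;> by_cases h2 : i = a <;> simp [h1, h2]
  · by_cases h1 : i = b
    · subst h1
      by_cases h2 : j = a
      · subst h2
        simp [h0]
      · simp [h2, Ne.symm h0]
    · by_cases h2 : j = a
      · subst h2
        simp [h0, h1]
      · by_cases h3 : i = a
        · subst h3
          by_cases h4 : j = b
          · subst h4
            simp [h0]
          · simp [h1, h2, h4]
        · simp [h1, h2, h3]

theorem R_mul_Rinv (i j a b : Fin n) :
    ∑ c, ∑ d, Q.R i j c d * Q.Rinv c d a b = if i = a ∧ j = b then 1 else 0 := by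
  rw [R_eq, Rinv_eq, flipForm_sum]
  have hr := Q.r_ne_zero
  have z1 := Q.kappa_ne_zero i j
  have z2 := Q.kappa_ne_zero j i
  have h1 := Q.kappa_self
  have e : (if i = a ∧ j = b then 1 else 0 : k) = dl i a * dl j b := by
    by_cases h2 : i = a <;> by_cases h3 : j = b <;> simp [dl, h2, h3]
  rw [e]
  simp only [flipForm]
  rcases tri Q.kappa Q.r Q.kappa_of_gt i j with ⟨g1, n1, k1⟩ | rfl | ⟨g1, n1, k1⟩ <;>
  · simp only [*, lt_irrefl, if_true, if_false]
    field_simp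
    try ring

/-- `R_Q` satisfies the Yang-Baxter equation. -/
theorem isCompatible_R : FRT.IsCompatible Q.R Q.R := by
  rw [R_eq]
  have H := flipForm_left Q.kappa (fun i j => if j < i then Q.r - 1 else 0) Q.kappa
    (fun i j => if j < i then Q.r - 1 else 0) Q.r Q.r_ne_zero Q.kappa_self (fun _ _ => rfl)
    Q.kappa_ne_zero Q.kappa_of_gt (.inl ⟨fun _ _ => rfl, fun _ _ => rfl⟩)
  have H' := flipForm_right Q.kappa (fun i j => if j < i then Q.r - 1 else 0) Q.kappa
    (fun i j => if j < i then Q.r - 1 else 0) Q.r Q.r_ne_zero Q.kappa_self (fun _ _ => rfl)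
    Q.kappa_ne_zero Q.kappa_of_gt (.inl ⟨fun _ _ => rfl, fun _ _ => rfl⟩)
  exact ⟨H, H'⟩

theorem isCompatible_Rinv : FRT.IsCompatible Q.R Q.Rinv := by
  rw [R_eq, Rinv_eq]
  have H := flipForm_left Q.kappa (fun i j => if j < i then Q.r - 1 else 0)
    (fun i j => (Q.kappa j i)⁻¹) (fun i j => if i < j then Q.r⁻¹ - 1 else 0)
    Q.r Q.r_ne_zero Q.kappa_self (fun _ _ => rfl)
    Q.kappa_ne_zero Q.kappa_of_gt (.inr ⟨fun _ _ => rfl, fun _ _ => rfl⟩)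
  have H' := flipForm_right Q.kappa (fun i j => if j < i then Q.r - 1 else 0)
    (fun i j => (Q.kappa j i)⁻¹) (fun i j => if i < j then Q.r⁻¹ - 1 else 0)
    Q.r Q.r_ne_zero Q.kappa_self (fun _ _ => rfl)
    Q.kappa_ne_zero Q.kappa_of_gt (.inr ⟨fun _ _ => rfl, fun _ _ => rfl⟩)
  exact ⟨H, H'⟩

/-- The bialgebra `A(R_Q)`. -/
abbrev A : Type u := FRT Q.R

/-- The generator `T_i^j` of `A(R_Q)`. -/
noncomputable abbrev T (i j : Fin n) : Q.A := FRT.T Q.R i j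

/-- The braiding `⟨- | -⟩_R` on `A(R_Q)`. -/
noncomputable def form : Q.A →ₗ[k] Q.A →ₗ[k] k := FRT.pairing Q.isCompatible_R

/-- The braiding `⟨- | -⟩_{R⁻¹}` on `A(R_Q)`. -/
noncomputable def formInv : Q.A →ₗ[k] Q.A →ₗ[k] k := FRT.pairing Q.isCompatible_Rinv

/-- `λ⁺(a) = ⟨a | -⟩_R`. -/
noncomputable def lamPlus (a : Q.A) : ConvDual k Q.A := WithConv.toConv (Q.form a)

/-- `ρ⁺(a) = ⟨- | a⟩_R`. -/
noncomputable def rhoPlus (a : Q.A) : ConvDual k Q.A := WithConv.toConv (Q.form.flip a)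

/-- `λ⁻(a) = ⟨a | -⟩_{R⁻¹}`. -/
noncomputable def lamMinus (a : Q.A) : ConvDual k Q.A := WithConv.toConv (Q.formInv a)

/-- `ρ⁻(a) = ⟨- | a⟩_{R⁻¹}`. -/
noncomputable def rhoMinus (a : Q.A) : ConvDual k Q.A := WithConv.toConv (Q.formInv.flip a)

/-- The FRT construction `U_Q = U(R_Q)`: the subalgebra of the dual of `A(R_Q)` generated by the
images of `λ⁺`, `ρ⁺`, `λ⁻`, `ρ⁻`. -/
noncomputable def U : Subalgebra k (ConvDual k Q.A) :=
  Algebra.adjoin k (Set.range Q.lamPlus ∪ Set.range Q.rhoPlus ∪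
    (Set.range Q.lamMinus ∪ Set.range Q.rhoMinus))

/-- The algebra homomorphism `A(R_Q) → k` with `T_i^j ↦ δ_{ij} t_i`. -/
noncomputable def diagHom (t : Fin n → k) : Q.A →ₐ[k] k :=
  FRT.lift (fun i j => if i = j then t i else 0) (by
    intro i j a b
    have e1 : ∑ c, ∑ d, Q.R i j c d • ((if c = a then t c else 0) * (if d = b then t d else 0)) =
        Q.R i j a b * (t a * t b) := by
      simp
    have e2 : ∑ c, ∑ d, Q.R c d a b • ((if i = c then t i else 0) * (if j = d then t j else 0)) =
        Q.R i j a b * (t i * t j) := by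
      simp
    rw [e1, e2]
    unfold R
    split_ifs with h1 h2
    · rw [h1.1, h1.2, mul_comm (t a)]
    · rw [h2.1, h2.2.1]
    · simp)

/-- The algebra homomorphism with `T_i^j ↦ δ_{ij} t_i`, as a functional. -/
noncomputable def diag (t : Fin n → k) : ConvDual k Q.A :=
  WithConv.toConv (Q.diagHom t).toLinearMap

/-- The group-like element `K_i`, with `K_i(T_j^l) = δ_{jl} κ^i_j`. -/
noncomputable def K (i : Fin n) : ConvDual k Q.A := Q.diag fun j => Q.kappa i j

/-- The inverse of `K_i`. -/
noncomputable def Kinv (i : Fin n) : ConvDual k Q.A := Q.diag fun j => (Q.kappa i j)⁻¹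

/-- The group-like element `L_i`, with `L_i(T_j^l) = δ_{jl} (κ^j_i)⁻¹`. -/
noncomputable def L (i : Fin n) : ConvDual k Q.A := Q.diag fun j => (Q.kappa j i)⁻¹

/-- The inverse of `L_i`. -/
noncomputable def Linv (i : Fin n) : ConvDual k Q.A := Q.diag fun j => Q.kappa j i

/-- The skew-primitive element `E^i_j`, `j = i + 1`, given by `λ⁺(T_j^i) = (r - 1) E^i_j`. Its values on
the generators and its coproduct are in `E_T` and `E_mul`, which determine it. -/
noncomputable def E (i j : Fin n) : ConvDual k Q.A := (Q.r - 1)⁻¹ • Q.lamPlus (Q.T j i)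

/-- The skew-primitive element `F^j_i`, `j = i + 1`, given by `λ⁻(T_i^j) = (r⁻¹ - 1) F^j_i`. Its values on
the generators and its coproduct are in `F_T` and `F_mul`, which determine it. -/
noncomputable def F (i j : Fin n) : ConvDual k Q.A := (Q.r⁻¹ - 1)⁻¹ • Q.lamMinus (Q.T i j)

/-- `B^l`, the subalgebra generated by all `K_i`, `K_i⁻¹` and all `E^i_{i+1}`. -/
noncomputable def Bl : Subalgebra k (ConvDual k Q.A) :=
  Algebra.adjoin k (Set.range Q.K ∪ Set.range Q.Kinv ∪
    {f | ∃ i j : Fin n, (i : ℕ) + 1 = j ∧ f = Q.E i j})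

/-- `B^r`, the subalgebra generated by all `L_i`, `L_i⁻¹` and all `F^{i+1}_i`. -/
noncomputable def Br : Subalgebra k (ConvDual k Q.A) :=
  Algebra.adjoin k (Set.range Q.L ∪ Set.range Q.Linv ∪
    {f | ∃ i j : Fin n, (i : ℕ) + 1 = j ∧ f = Q.F i j})

theorem diag_T (t : Fin n → k) (i j : Fin n) : Q.diag t (Q.T i j) = if i = j then t i else 0 :=
  FRT.lift_T _ _ i j

theorem diag_mul (t : Fin n → k) (x y : Q.A) : Q.diag t (x * y) = Q.diag t x * Q.diag t y :=
  map_mul (Q.diagHom t) x y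

theorem diag_mul_diag (t t' : Fin n → k) : Q.diag t * Q.diag t' = Q.diag (t * t') := by
  have e : (Algebra.TensorProduct.lift (Q.diagHom t) (Q.diagHom t')
      fun _ _ => Commute.all _ _).comp (Bialgebra.comulAlgHom k Q.A) = Q.diagHom (t * t') := by
    refine FRT.hom_ext fun i j => ?_
    have := FRT.comul_T Q.R i j
    simp only [AlgHom.comp_apply, Bialgebra.comulAlgHom_apply, this, map_sum,
      Algebra.TensorProduct.lift_tmul]
    simp only [diagHom, FRT.lift_T]
    by_cases h : i = j <;> simp [h]
  ext x
  refine Eq.trans ?_ (congrArg (fun f : Q.A →ₐ[k] k => f x) e)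
  rw [LinearMap.convMul_apply]
  simp only [AlgHom.comp_apply, Bialgebra.comulAlgHom_apply]
  generalize (Coalgebra.comul x : Q.A ⊗[k] Q.A) = w
  induction w with
  | zero => simp
  | add p q hp hq => simp only [map_add, hp, hq]
  | tmul a b => simp [diag]

theorem diag_one : Q.diag 1 = 1 := by
  have e : Q.diagHom 1 = Bialgebra.counitAlgHom k Q.A := by
    refine FRT.hom_ext fun i j => ?_
    have := FRT.counit_T Q.R i j
    simp [diagHom, this]
  ext x
  exact congrArg (fun f : Q.A →ₐ[k] k => f x) e

theorem K_mul_Kinv (i : Fin n) : Q.K i * Q.Kinv i = 1 := by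
  rw [K, Kinv, diag_mul_diag, ← diag_one]
  congr 1
  funext j
  exact mul_inv_cancel₀ (Q.kappa_ne_zero _ _)

theorem L_mul_Linv (i : Fin n) : Q.L i * Q.Linv i = 1 := by
  rw [L, Linv, diag_mul_diag, ← diag_one]
  congr 1
  funext j
  exact inv_mul_cancel₀ (Q.kappa_ne_zero _ _)

theorem form_T_T (i j a b : Fin n) : Q.form (Q.T i a) (Q.T j b) = Q.R i j b a :=
  FRT.pairing_T_T _ _ _ _ _

theorem formInv_T_T (i j a b : Fin n) : Q.formInv (Q.T i a) (Q.T j b) = Q.Rinv i j b a :=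
  FRT.pairing_T_T _ _ _ _ _

/-- `E^i_{i+1}(T_a^b) = δ_{a,i} δ_{b,i+1}`. -/
theorem E_T (i j a b : Fin n) (h : (i : ℕ) + 1 = j) :
    Q.E i j (Q.T a b) = if a = i ∧ b = j then 1 else 0 := by
  have hr : Q.r - 1 ≠ 0 := sub_ne_zero.2 Q.r_ne_one
  have e : Q.E i j (Q.T a b) = (Q.r - 1)⁻¹ * Q.R j a b i := by
    rw [← form_T_T]; rfl
  have hij : i < j := by rw [Fin.lt_def]; omega
  rw [e]
  unfold R
  rw [if_neg (fun h => hij.ne h.1.symm)]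
  by_cases h1 : a = i
  · by_cases h2 : b = j
    · simp [h1, h2, hij, hr]
    · simp [h2, Ne.symm h2]
  · simp [h1]

/-- `F^{i+1}_i(T_a^b) = δ_{a,i+1} δ_{b,i}`. -/
theorem F_T (i j a b : Fin n) (h : (i : ℕ) + 1 = j) :
    Q.F i j (Q.T a b) = if a = j ∧ b = i then 1 else 0 := by
  have hr : Q.r⁻¹ - 1 ≠ 0 := sub_ne_zero.2 fun h => Q.r_ne_one (inv_eq_one.1 h)
  have e : Q.F i j (Q.T a b) = (Q.r⁻¹ - 1)⁻¹ * Q.Rinv i a b j := by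
    rw [← formInv_T_T]; rfl
  have hij : i < j := by rw [Fin.lt_def]; omega
  rw [e]
  unfold Rinv
  rw [if_neg (fun h => hij.ne h.1)]
  by_cases h1 : a = j
  · by_cases h2 : b = i
    · simp [h1, h2, hij, hr]
    · simp [h2, Ne.symm h2]
  · simp [h1]

theorem lamPlus_T_diag (j : Fin n) : Q.lamPlus (Q.T j j) = Q.K j := by
  refine FRT.entry_diag_unique Q.isCompatible_R (· ≥ ·) (fun i => le_refl i)
    (fun i c j h1 h2 => h2.trans h1) (fun i c h1 h2 => le_antisymm h2 h1) ?_ _ (Q.diagHom _) ?_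
  · intro i j a b h
    unfold R
    rw [if_neg (by rintro ⟨rfl, -⟩; exact h le_rfl),
      if_neg (by rintro ⟨rfl, rfl, h'⟩; exact h h'.le)]
  · intro a b
    rw [diagHom, FRT.lift_T]
    unfold R
    by_cases h : a = b
    · simp [h]
    · simp [h]
      rintro rfl rfl
      simp

theorem lamMinus_T_diag (j : Fin n) : Q.lamMinus (Q.T j j) = Q.L j := by
  refine FRT.entry_diag_unique Q.isCompatible_Rinv (· ≤ ·) (fun i => le_refl i)
    (fun i c j h1 h2 => h1.trans h2) (fun i c h1 h2 => le_antisymm h1 h2) ?_ _ (Q.diagHom _) ?_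
  · intro i j a b h
    unfold Rinv
    rw [if_neg (by rintro ⟨rfl, -⟩; exact h le_rfl),
      if_neg (by rintro ⟨rfl, rfl, h'⟩; exact h h'.le)]
  · intro a b
    rw [diagHom, FRT.lift_T]
    unfold Rinv
    by_cases h : a = b
    · simp [h]
    · simp [h]
      rintro rfl rfl
      simp

/-- `Δ(E^i_{i+1}) = K_{i+1} ⊗ E^i_{i+1} + E^i_{i+1} ⊗ K_i`. -/
theorem E_mul (i j : Fin n) (h : (i : ℕ) + 1 = j) (x y : Q.A) :
    Q.E i j (x * y) = Q.K j x * Q.E i j y + Q.E i j x * Q.K i y := by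
  have hij : i ≠ j := by rintro rfl; omega
  have z := FRT.entry_eq_zero Q.isCompatible_R (· ≥ ·) (fun i => le_refl i)
    (fun i c j h1 h2 => h2.trans h1) (by
      intro i j a b h
      unfold R
      rw [if_neg (by rintro ⟨rfl, -⟩; exact h le_rfl),
        if_neg (by rintro ⟨rfl, rfl, h'⟩; exact h h'.le)])
  have e : Q.lamPlus (Q.T j i) (x * y) =
      Q.lamPlus (Q.T j j) x * Q.lamPlus (Q.T j i) y +
        Q.lamPlus (Q.T j i) x * Q.lamPlus (Q.T i i) y := by
    refine (FRT.pairing_T_mul Q.isCompatible_R j i x y).trans ?_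
    rw [← Finset.sum_subset (Finset.subset_univ {j, i}), Finset.sum_pair hij.symm]
    · rfl
    · intro c _ hc
      simp only [Finset.mem_insert, Finset.mem_singleton, not_or] at hc
      by_cases h1 : c ≤ j
      · rw [z c i y (fun h2 : i ≤ c => by
          have := Fin.le_def.1 h1
          have := Fin.le_def.1 h2
          rcases hc with ⟨hc1, hc2⟩
          rw [Fin.ext_iff] at hc1 hc2
          omega), mul_zero]
      · rw [z j c x h1, zero_mul]
  rw [lamPlus_T_diag, lamPlus_T_diag] at e
  simp only [E, WithConv.ofConv_smul, LinearMap.smul_apply, smul_eq_mul, e]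
  ring

/-- `Δ(F^{i+1}_i) = L_i ⊗ F^{i+1}_i + F^{i+1}_i ⊗ L_{i+1}`. -/
theorem F_mul (i j : Fin n) (h : (i : ℕ) + 1 = j) (x y : Q.A) :
    Q.F i j (x * y) = Q.L i x * Q.F i j y + Q.F i j x * Q.L j y := by
  have hij : i ≠ j := by rintro rfl; omega
  have z := FRT.entry_eq_zero Q.isCompatible_Rinv (· ≤ ·) (fun i => le_refl i)
    (fun i c j h1 h2 => h1.trans h2) (by
      intro i j a b h
      unfold Rinv
      rw [if_neg (by rintro ⟨rfl, -⟩; exact h le_rfl),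
        if_neg (by rintro ⟨rfl, rfl, h'⟩; exact h h'.le)])
  have e : Q.lamMinus (Q.T i j) (x * y) =
      Q.lamMinus (Q.T i i) x * Q.lamMinus (Q.T i j) y +
        Q.lamMinus (Q.T i j) x * Q.lamMinus (Q.T j j) y := by
    refine (FRT.pairing_T_mul Q.isCompatible_Rinv i j x y).trans ?_
    rw [← Finset.sum_subset (Finset.subset_univ {i, j}), Finset.sum_pair hij]
    · rfl
    · intro c _ hc
      simp only [Finset.mem_insert, Finset.mem_singleton, not_or] at hc
      by_cases h1 : i ≤ c
      · rw [z c j y (fun h2 : c ≤ j => by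
          have := Fin.le_def.1 h1
          have := Fin.le_def.1 h2
          rcases hc with ⟨hc1, hc2⟩
          rw [Fin.ext_iff] at hc1 hc2
          omega), mul_zero]
      · rw [z i c x h1, zero_mul]
  rw [lamMinus_T_diag, lamMinus_T_diag] at e
  simp only [F, WithConv.ofConv_smul, LinearMap.smul_apply, smul_eq_mul, e]
  ring

end Parameters
end Multiparameter

section Double

variable {k : Type u} [Field k]

/-- An injective Hopf algebra map `B ↪ (H^0)^cop`. The product of `H^0` is the convolution product, its
coproduct is dual to the product of `H`, so that a coalgebra map to `(H^0)^cop` satisfies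
`⟨b, x y⟩ = ∑ ⟨b₂, x⟩ ⟨b₁, y⟩`, and the antipode of `(H^0)^cop` is inverse to the transpose of the
antipode of `H`. -/
structure DualEmbedding (k : Type u) (B H : Type u) [Field k] [Semiring B] [HopfAlgebra k B] [Semiring H]
    [HopfAlgebra k H] where
  toHom : B →ₐ[k] ConvDual k H
  injective : Function.Injective toHom
  isFinite : ∀ b, IsFinite (toHom b)
  map_comul : ∀ b x y, toHom b (x * y) = evalAt₂ toHom y x (Coalgebra.comul b)
  map_counit : ∀ b, toHom b 1 = Coalgebra.counit (R := k) b
  map_antipode : ∀ b x,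
    toHom (HopfAlgebra.antipode k b) (HopfAlgebra.antipode k x) = toHom b x

variable {B H : Type u} [Semiring B] [HopfAlgebra k B] [Semiring H] [HopfAlgebra k H]

/-- `f ⇀ h = ∑ ⟨f, h₂⟩ h₁`. -/
noncomputable def hitLeft (f : ConvDual k H) : H →ₗ[k] H :=
  (TensorProduct.rid k H).toLinearMap ∘ₗ f.ofConv.lTensor H ∘ₗ Coalgebra.comul

/-- `h ↼ f = ∑ ⟨f, h₁⟩ h₂`. -/
noncomputable def hitRight (f : ConvDual k H) : H →ₗ[k] H :=
  (TensorProduct.lid k H).toLinearMap ∘ₗ f.ofConv.rTensor H ∘ₗ Coalgebra.comul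

/-- `S⁻¹ f`, for the antipode `S` of `H^0`, the transpose of the (bijective) antipode of `H`. -/
noncomputable def antipodeInv (hS : Function.Bijective (HopfAlgebra.antipode k (A := H)))
    (f : ConvDual k H) : ConvDual k H :=
  WithConv.toConv (f.ofConv ∘ₗ (LinearEquiv.ofBijective _ hS).symm.toLinearMap)

/-- `P` is the double crossproduct `B ⋈ H` of `H` and its finite dual's Hopf subalgebra
`B ⊆ (H^0)^cop`: as a coalgebra it is `B ⊗ H`, its unit is `1 ⋈ 1` and its product is
`(p ⋈ h)(p' ⋈ h') = ∑ p p'₂ ⋈ (S⁻¹ p'₁ ⇀ h ↼ p'₃) h'`. Here `p'₁ ⊗ p'₂ ⊗ p'₃` is the iterated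
coproduct in `H^0`; in `B ⊆ (H^0)^cop` the iterated coproduct of `p'` is `p'₃ ⊗ p'₂ ⊗ p'₁`. -/
structure DoubleCross (hS : Function.Bijective (HopfAlgebra.antipode k (A := H)))
    (θ : DualEmbedding k B H) (P : Type u) [Ring P] [HopfAlgebra k P] where
  bowtie : B ⊗[k] H ≃ₗc[k] P
  one : bowtie (1 ⊗ₜ 1) = 1
  mul : ∀ (p p' : B) (h h' : H) (m : ℕ) (p₁ p₂ p₃ : Fin m → B),
    (Coalgebra.comul (R := k) (A := B)).lTensor B (Coalgebra.comul p') =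
      ∑ i, p₃ i ⊗ₜ[k] (p₂ i ⊗ₜ[k] p₁ i) →
    bowtie (p ⊗ₜ h) * bowtie (p' ⊗ₜ h') =
      ∑ i, bowtie ((p * p₂ i) ⊗ₜ
        (hitLeft (antipodeInv hS (θ.toHom (p₁ i))) (hitRight (θ.toHom (p₃ i)) h) * h'))

end Double

end FRTDouble

/-! The algebras B^l, B^r and U_Q are generated inside A^* by invertible characters of A (the K_i,
L_i and their inverses) and by skew derivations (the E and F). Characters and skew derivations are
coefficients of finite-dimensional representations of A, and such coefficients form an algebra, so
everything lies in the finite dual. The rules for evaluating the generators on products provide a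
dual coproduct, and each algebra becomes a bialgebra generated by group-like and skew-primitive
elements. On such a bialgebra a linear map is convolution invertible as soon as its values on
group-likes are (`IsPointed.isUnit_toConv`): after correction on the group-likes the error is
locally nilpotent, and a geometric series inverts it. For the identity map this gives the antipode;
for the canonical map to the opposite algebra it gives bijectivity of the antipode.

The matrices λ⁺(T) and λ⁻(T) are triangular, with diagonals K and L and with multiples of E and F
next to the diagonal. The relations of the FRT bialgebra express the remaining entries as twisted
commutators (`lam_T_relation`), and ρ^±(T) is inverse to λ^∓(T), so it lies in the same algebra by
back substitution. Hence B^l and B^r together generate U_Q (`U_eq`).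

The map λ⁺ : A → B^l is an anti-multiplicative coalgebra map whose image, with the K_i⁻¹ adjoined,
generates B^l. A finite-dimensional algebra contains the inverses of its units, so a coefficient
functional on B^l is determined by its restriction to λ⁺(A) (`eq_zero_of_lamPlus`). Evaluation at x
restricts to ρ⁺(x), and evaluation of S(w) at T_a^b restricts to λ⁻(T_a^b); so every element of B^r
extends uniquely to a coefficient functional on B^l, and this extension is θ. Its compatibility with
products and coproducts is checked on λ⁺(A) and extended by uniqueness.

The double crossproduct is the tensor product Hopf algebra B^r ⊗ B^l twisted by the two-cocycle (u ⊗
w, u' ⊗ w') ↦ ε(u)⟨u', w⟩ε(w'). Associativity is the cocycle identity, and the antipode exists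
because the identity map factors under convolution through the embeddings of B^r and B^l.

Finally u ⋈ w ↦ u w is multiplicative once ∑⟨u₁, w₁⟩ u₂ w₂ = ∑ w₁ u₁ ⟨u₂, w₂⟩ holds in U_Q.
Evaluated at x ∈ A with w = λ⁺(a), this is u applied to the braiding identity ∑ a₁ x₁ ⟨a₂|x₂⟩ = ∑
⟨a₁|x₁⟩ x₂ a₂ (`FRT.braidLeft_comul`), a consequence of the defining relations of A. Both sides are
coefficient functionals in w, so it holds for all w. -/

namespace FRTDouble

/-! ### Functoriality of convolution algebras -/

section Convolution

variable {k : Type*} [Field k] {C D : Type*} [AddCommMonoid C] [Module k C] [Coalgebra k C]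
  [AddCommMonoid D] [Module k D] [Coalgebra k D] {A B : Type*} [Ring A] [Algebra k A]
  [Ring B] [Algebra k B]

open WithConv

/-- Composition with an algebra homomorphism, as a homomorphism of convolution algebras. -/
noncomputable def postcomp (C : Type*) [AddCommMonoid C] [Module k C] [Coalgebra k C]
    (h : A →ₐ[k] B) : WithConv (C →ₗ[k] A) →ₐ[k] WithConv (C →ₗ[k] B) :=
  AlgHom.ofLinearMap
    { toFun := fun f => toConv (h.toLinearMap ∘ₗ f.ofConv)
      map_add' := fun f g => by ext; simp
      map_smul' := fun c f => by ext; simp }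
    (by ext; simp)
    (fun f g => by
      apply ofConv_injective
      exact LinearMap.algHom_comp_convMul_distrib h f g)

/-- Composition with a coalgebra homomorphism, as a homomorphism of convolution algebras. -/
noncomputable def precomp (A : Type*) [Ring A] [Algebra k A] (h : D →ₗc[k] C) :
    WithConv (C →ₗ[k] A) →ₐ[k] WithConv (D →ₗ[k] A) :=
  AlgHom.ofLinearMap
    { toFun := fun f => toConv (f.ofConv ∘ₗ h.toLinearMap)
      map_add' := fun f g => by ext; simp
      map_smul' := fun c f => by ext; simp }
    (by ext; simp)
    (fun f g => by
      apply ofConv_injective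
      exact LinearMap.convMul_comp_coalgHom_distrib f g h)

@[simp] theorem postcomp_apply (h : A →ₐ[k] B) (f : WithConv (C →ₗ[k] A)) (x : C) :
    postcomp C h f x = h (f x) := rfl

@[simp] theorem precomp_apply (h : D →ₗc[k] C) (f : WithConv (C →ₗ[k] A)) (x : D) :
    precomp A h f x = f (h x) := rfl

theorem precomp_precomp {D' : Type*} [AddCommMonoid D'] [Module k D'] [Coalgebra k D']
    (h : D' →ₗc[k] D) (g : D →ₗc[k] C) (f : WithConv (C →ₗ[k] A)) :
    precomp A h (precomp A g f) = precomp A (g.comp h) f := rfl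

/-- The inclusion of the dual of `C` in the convolution algebra of maps to an algebra. -/
noncomputable abbrev scalar (k C A : Type*) [Field k] [AddCommMonoid C] [Module k C] [Coalgebra k C] [Ring A]
    [Algebra k A] : WithConv (C →ₗ[k] k) →ₐ[k] WithConv (C →ₗ[k] A) :=
  postcomp C (Algebra.ofId k A)

end Convolution

/-! ### Convolution inverses on bialgebras generated by group-like and skew-primitive elements -/

section Pointed

variable {k : Type*} [Field k] {C : Type*} [Ring C] [Bialgebra k C] {D : Type*} [Ring D]
  [Algebra k D]

open WithConv Coalgebra

/-- `C` is generated as an algebra by the group-like elements `G` and the elements `E`, which are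
skew-primitive with respect to elements of `G`. -/
structure IsPointed (k : Type*) [Field k] {C : Type*} [Ring C] [Bialgebra k C] (G E : Set C) :
    Prop where
  groupLike : ∀ g ∈ G, IsGroupLikeElem k g
  skew : ∀ e ∈ E, ∃ a ∈ G, ∃ b ∈ G, comul (R := k) e = a ⊗ₜ[k] e + e ⊗ₜ[k] b
  adjoin_eq_top : Algebra.adjoin k (G ∪ E) = ⊤

/-- Products of elements of `G` and `n` elements of `E`. -/
inductive Word (G E : Set C) : ℕ → C → Prop
  | one : Word G E 0 1
  | grp {n : ℕ} {g c : C} (hg : g ∈ G) (hc : Word G E n c) : Word G E n (g * c)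
  | skew {n : ℕ} {e c : C} (he : e ∈ E) (hc : Word G E n c) : Word G E (n + 1) (e * c)

/-- `f` vanishes on all words with fewer than `n` skew-primitive factors. -/
def Kills (G E : Set C) (n : ℕ) (f : C →ₗ[k] D) : Prop := ∀ m < n, ∀ c, Word G E m c → f c = 0

variable {G E : Set C}

/-- Since Δ(xc) = (x ⊗ x)Δ(c), left translation by a group-like element passes into both factors. -/
theorem convMul_grp_mul (f g : WithConv (C →ₗ[k] D)) {x : C} (hx : IsGroupLikeElem k x) (c : C) :
    (f * g) (x * c) = (toConv (f.ofConv ∘ₗ LinearMap.mulLeft k x) *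
      toConv (g.ofConv ∘ₗ LinearMap.mulLeft k x) : WithConv (C →ₗ[k] D)) c := by
  rw [LinearMap.convMul_apply, LinearMap.convMul_apply, Bialgebra.comul_mul, hx.comul_eq_tmul_self]
  generalize (comul c : C ⊗[k] C) = t
  induction t with
  | zero => simp
  | add s t hs ht => simp only [mul_add, map_add, hs, ht]
  | tmul a b => simp

/-- The two summands come from a ⊗ e and e ⊗ b in Δ(ec) = (a ⊗ e + e ⊗ b)Δ(c). -/
theorem convMul_skew_mul (f g : WithConv (C →ₗ[k] D)) {a b e : C}
    (he : comul (R := k) e = a ⊗ₜ[k] e + e ⊗ₜ[k] b) (c : C) :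
    (f * g) (e * c) = (toConv (f.ofConv ∘ₗ LinearMap.mulLeft k a) *
        toConv (g.ofConv ∘ₗ LinearMap.mulLeft k e) : WithConv (C →ₗ[k] D)) c +
      (toConv (f.ofConv ∘ₗ LinearMap.mulLeft k e) *
        toConv (g.ofConv ∘ₗ LinearMap.mulLeft k b) : WithConv (C →ₗ[k] D)) c := by
  rw [LinearMap.convMul_apply, LinearMap.convMul_apply, LinearMap.convMul_apply,
    Bialgebra.comul_mul, he]
  generalize (comul c : C ⊗[k] C) = t
  induction t with
  | zero => simp
  | add s t hs ht => simp only [mul_add, map_add, hs, ht]; abel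
  | tmul p q => simp [add_mul]

theorem Kills.comp_grp {n : ℕ} {f : C →ₗ[k] D} (hf : Kills G E n f) {g : C} (hg : g ∈ G) :
    Kills G E n (f ∘ₗ LinearMap.mulLeft k g) := fun m hm _ hc => hf m hm _ (.grp hg hc)

theorem Kills.comp_skew {n : ℕ} {f : C →ₗ[k] D} (hf : Kills G E (n + 1) f) {e : C} (he : e ∈ E) :
    Kills G E n (f ∘ₗ LinearMap.mulLeft k e) :=
  fun m hm _ hc => hf (m + 1) (by omega) _ (.skew he hc)

/-- In the coproduct of a word with m skew-primitive factors, the right legs are words with at most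
m of them, and f kills all of these. -/
theorem IsPointed.convMul_eq_zero_of_kills (h : IsPointed k G E) {m : ℕ} {c : C}
    (hc : Word G E m c) (A f : WithConv (C →ₗ[k] D)) (hf : Kills G E (m + 1) f.ofConv) :
    (A * f) c = 0 := by
  induction hc generalizing A f with
  | one =>
    have := hf 0 (by omega) 1 .one
    simp [Algebra.TensorProduct.one_def, this]
  | grp hg _ ih =>
    rw [convMul_grp_mul _ _ (h.groupLike _ hg)]
    exact ih _ _ (hf.comp_grp hg)
  | skew he _ ih =>
    obtain ⟨a, ha, b, hb, hab⟩ := h.skew _ he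
    rw [convMul_skew_mul _ _ hab]
    convert add_zero (0 : D) using 2
    · exact ih _ _ (hf.comp_skew he)
    · exact ih _ _ fun m hm => (hf.comp_grp hb) m (by omega)

/-- The coproduct distributes the m skew-primitive factors over the two legs. Either the left leg
receives none and A kills it, or the right leg has fewer than m and f kills it. -/
theorem IsPointed.convMul_eq_zero (h : IsPointed k G E) {m : ℕ} {c : C} (hc : Word G E m c)
    (A f : WithConv (C →ₗ[k] D)) (hA : Kills G E 1 A.ofConv) (hf : Kills G E m f.ofConv) :
    (A * f) c = 0 := by
  induction hc generalizing A f with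
  | one =>
    have := hA 0 (by omega) 1 .one
    simp [Algebra.TensorProduct.one_def, this]
  | grp hg _ ih =>
    rw [convMul_grp_mul _ _ (h.groupLike _ hg)]
    exact ih _ _ (hA.comp_grp hg) (hf.comp_grp hg)
  | skew he hc ih =>
    obtain ⟨a, ha, b, hb, hab⟩ := h.skew _ he
    rw [convMul_skew_mul _ _ hab]
    convert add_zero (0 : D) using 2
    · exact ih _ _ (hA.comp_grp ha) (hf.comp_skew he)
    · exact h.convMul_eq_zero_of_kills hc _ _ (hf.comp_grp hb)

/-- The span of the words contains 1 and is stable under left multiplication by the generators,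
hence by the whole algebra. -/
theorem IsPointed.span_word (h : IsPointed k G E) :
    Submodule.span k {c | ∃ m, Word G E m c} = ⊤ := by
  let S := Submodule.span k {c | ∃ m, Word G E m c}
  have key : ∀ x ∈ Algebra.adjoin k (G ∪ E), ∀ c ∈ S, x * c ∈ S := by
    intro x hx
    induction hx using Algebra.adjoin_induction with
    | mem x hx =>
      intro c hc
      refine (Submodule.span_le (p := S.comap (LinearMap.mulLeft k x))).2 ?_ hc
      rintro c ⟨m, hm⟩
      rcases hx with hx | hx
      · exact Submodule.subset_span ⟨m, .grp hx hm⟩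
      · exact Submodule.subset_span ⟨m + 1, .skew hx hm⟩
    | algebraMap r => intro c hc; rw [← Algebra.smul_def]; exact S.smul_mem _ hc
    | add x y _ _ hx hy => intro c hc; rw [add_mul]; exact S.add_mem (hx c hc) (hy c hc)
    | mul x y _ _ hx hy => intro c hc; rw [mul_assoc]; exact hx _ (hy c hc)
  rw [eq_top_iff]
  rintro x -
  have := key x (h.adjoin_eq_top ▸ Algebra.mem_top) 1 (Submodule.subset_span ⟨0, .one⟩)
  rwa [mul_one] at this

/-- Each factor N absorbs at least one skew-primitive factor, so the n-th power kills all words with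
fewer than n of them; words span. -/
theorem IsPointed.pow_eventually_zero (h : IsPointed k G E) (N : WithConv (C →ₗ[k] D))
    (hN : Kills G E 1 N.ofConv) (c : C) : ∃ n, ∀ m ≥ n, (N ^ m) c = 0 := by
  have hp : ∀ n, Kills G E n (N ^ n).ofConv := by
    intro n
    induction n with
    | zero => intro m hm; omega
    | succ n ih =>
      intro m hm c hc
      rw [pow_succ']
      exact h.convMul_eq_zero hc _ _ hN fun m' hm' => ih m' (by omega)
  have hc : c ∈ Submodule.span k {c | ∃ m, Word G E m c} := h.span_word ▸ Submodule.mem_top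
  induction hc using Submodule.span_induction with
  | mem c hc =>
    obtain ⟨n, hn⟩ := hc
    exact ⟨n + 1, fun m hm => hp m n (by omega) c hn⟩
  | zero => exact ⟨0, fun m _ => map_zero _⟩
  | add x y _ _ hx hy =>
    obtain ⟨n, hn⟩ := hx
    obtain ⟨n', hn'⟩ := hy
    exact ⟨max n n', fun m hm => by
      rw [map_add, hn m (by omega), hn' m (by omega), add_zero]⟩
  | smul r x _ hx =>
    obtain ⟨n, hn⟩ := hx
    exact ⟨n, fun m hm => by rw [map_smul, hn m hm, smul_zero]⟩

/-- The inverse is the geometric series in N, which is a finite sum on every single element. -/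
theorem isUnit_one_sub_of_pow_eventually_zero {C : Type*} [AddCommMonoid C] [Module k C]
    [Coalgebra k C] (N : WithConv (C →ₗ[k] D)) (hN : ∀ c, ∃ n, ∀ m ≥ n, (N ^ m) c = 0) :
    IsUnit (1 - N) := by
  have fin : ∀ c, (Function.support fun i => (N ^ i) c).Finite := by
    intro c
    obtain ⟨n, hn⟩ := hN c
    refine (Set.finite_lt_nat n).subset fun i hi => ?_
    by_contra hlt
    exact hi (hn i (not_lt.1 hlt))
  let M : WithConv (C →ₗ[k] D) := toConv
    { toFun := fun c => ∑ᶠ i, (N ^ i) c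
      map_add' := fun x y => by
        simp only [map_add]
        exact finsum_add_distrib (fin x) (fin y)
      map_smul' := fun r x => by
        simp only [map_smul, RingHom.id_apply]
        exact (smul_finsum' r (fin x)).symm }
  have hM : ∀ c n, (∀ m ≥ n, (N ^ m) c = 0) → M c = (∑ i ∈ Finset.range n, N ^ i) c := by
    intro c n hn
    have : M c = ∑ᶠ i, (N ^ i) c := rfl
    rw [this, finsum_eq_sum_of_support_subset (s := Finset.range n)]
    · simp
    · intro i hi
      by_contra hlt
      exact hi (hn i (by simpa using hlt))
  -- Only finitely many elements occur in a coproduct, so one truncation of the series serves for c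
  -- and for all legs of Δ(c); the identity then is that of a finite geometric sum.
  have common : ∀ s : Finset C, ∃ n, ∀ c ∈ s, ∀ m ≥ n, (N ^ m) c = 0 := by
    classical
    intro s
    induction s using Finset.induction_on with
    | empty => exact ⟨0, by simp⟩
    | insert c s _ ih =>
      obtain ⟨n, hn⟩ := ih
      obtain ⟨n', hn'⟩ := hN c
      refine ⟨max n n', fun d hd m hm => ?_⟩
      rcases Finset.mem_insert.1 hd with rfl | hd
      · exact hn' m (by omega)
      · exact hn d hd m (by omega)
  classical
  rw [isUnit_iff_exists]
  refine ⟨M, ?_, ?_⟩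
  · ext c
    obtain ⟨n, hn⟩ := common (insert c ((ℛ k c).index.image (ℛ k c).right))
    have e : ((1 - N) * M) c = ((1 - N) * ∑ i ∈ Finset.range n, N ^ i) c := by
      rw [(ℛ k c).convMul_apply, (ℛ k c).convMul_apply]
      refine Finset.sum_congr rfl fun i hi => ?_
      rw [hM _ n (hn _ (Finset.mem_insert_of_mem (Finset.mem_image_of_mem _ hi)))]
    have e2 := hn c (Finset.mem_insert_self _ _) n le_rfl
    refine e.trans ?_
    rw [mul_neg_geom_sum]
    simp [e2]
  · ext c
    obtain ⟨n, hn⟩ := common (insert c ((ℛ k c).index.image (ℛ k c).left))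
    have e : (M * (1 - N)) c = ((∑ i ∈ Finset.range n, N ^ i) * (1 - N)) c := by
      rw [(ℛ k c).convMul_apply, (ℛ k c).convMul_apply]
      refine Finset.sum_congr rfl fun i hi => ?_
      rw [hM _ n (hn _ (Finset.mem_insert_of_mem (Finset.mem_image_of_mem _ hi)))]
    have e2 := hn c (Finset.mem_insert_self _ _) n le_rfl
    refine e.trans ?_
    rw [geom_sum_mul_neg]
    simp [e2]

theorem IsPointed.isUnit_one_sub (h : IsPointed k G E) (N : WithConv (C →ₗ[k] D))
    (hN : Kills G E 1 N.ofConv) : IsUnit (1 - N) :=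
  isUnit_one_sub_of_pow_eventually_zero N (h.pow_eventually_zero N hN)

theorem IsPointed.isGroupLike_of_word (h : IsPointed k G E) {c : C} (hc : Word G E 0 c) :
    IsGroupLikeElem k c ∧ c ∈ Submonoid.closure G := by
  generalize hn : 0 = n at hc
  induction hc with
  | one => exact ⟨.one, one_mem _⟩
  | grp hg _ ih =>
    exact ⟨(h.groupLike _ hg).mul (ih hn).1, mul_mem (Submonoid.subset_closure hg) (ih hn).2⟩
  | skew => omega

/-- A linear map on a pointed bialgebra is invertible under convolution as soon as its values on
group-like elements are invertible. -/
theorem IsPointed.isUnit_toConv (h : IsPointed k G E) (f : C →ₗ[k] D)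
    (hf : ∀ g ∈ Submonoid.closure G, IsUnit (f g)) : IsUnit (toConv f) := by
  classical
  -- Group-like elements are linearly independent, so there is a linear γ with prescribed values on
  -- them; its values on the rest of the basis play no role.
  have li := linearIndepOn_isGroupLikeElem (R := k) (A := C)
  let γ : C →ₗ[k] D := (Module.Basis.extend li).constr k fun g => Ring.inverse (f g)
  have hγ : ∀ g, IsGroupLikeElem k g → γ g = Ring.inverse (f g) := by
    intro g hg
    have := (Module.Basis.extend li).constr_basis k (fun g => Ring.inverse (f g))
      ⟨g, li.subset_extend (Set.subset_univ _) hg⟩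
    simpa [Module.Basis.extend_apply_self] using this
  -- The difference 1 - fγ vanishes on words without skew-primitive factors, so the geometric series
  -- applies; likewise for γf.
  have u1 : IsUnit (toConv f * toConv γ) := by
    have := h.isUnit_one_sub (1 - toConv f * toConv γ) (by
      intro m hm c hc
      obtain rfl : m = 0 := by omega
      obtain ⟨hg, hc⟩ := h.isGroupLike_of_word hc
      simp [hg.comul_eq_tmul_self, hg.counit_eq_one, hγ c hg, Ring.mul_inverse_cancel _ (hf c hc)])
    rwa [sub_sub_cancel] at this
  have u2 : IsUnit (toConv γ * toConv f) := by
    have := h.isUnit_one_sub (1 - toConv γ * toConv f) (by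
      intro m hm c hc
      obtain rfl : m = 0 := by omega
      obtain ⟨hg, hc⟩ := h.isGroupLike_of_word hc
      simp [hg.comul_eq_tmul_self, hg.counit_eq_one, hγ c hg, Ring.inverse_mul_cancel _ (hf c hc)])
    rwa [sub_sub_cancel] at this
  obtain ⟨a, ha⟩ := u1.exists_right_inv
  obtain ⟨b, hb⟩ := u2.exists_left_inv
  rw [mul_assoc] at ha
  rw [← mul_assoc] at hb
  rw [left_inv_eq_right_inv hb ha] at hb
  exact isUnit_iff_exists.2 ⟨_, ha, hb⟩

end Pointed
end FRTDouble

namespace FRTDouble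

/-! ### Convolution on tensor products of coalgebras -/

section Projections

variable {k : Type*} [Field k] {C D : Type*} [AddCommMonoid C] [Module k C] [Coalgebra k C]
  [AddCommMonoid D] [Module k D] [Coalgebra k D] {A : Type*} [Ring A] [Algebra k A]

open WithConv Coalgebra

variable (k C D) in
/-- The projection `id ⊗ ε` of a tensor product of coalgebras. -/
noncomputable def fstHom : C ⊗[k] D →ₗc[k] C :=
  (Coalgebra.TensorProduct.rid k k C : C ⊗[k] k →ₗc[k] C).comp
    (Coalgebra.TensorProduct.map (CoalgHom.id k C) (counitCoalgHom k D))

variable (k C D) in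
/-- The projection `ε ⊗ id` of a tensor product of coalgebras. -/
noncomputable def sndHom : C ⊗[k] D →ₗc[k] D :=
  (Coalgebra.TensorProduct.lid k D : k ⊗[k] D →ₗc[k] D).comp
    (Coalgebra.TensorProduct.map (counitCoalgHom k C) (CoalgHom.id k D))

@[simp] theorem fstHom_tmul (x : C) (y : D) :
    fstHom k C D (x ⊗ₜ y) = counit (R := k) y • x := rfl

@[simp] theorem sndHom_tmul (x : C) (y : D) :
    sndHom k C D (x ⊗ₜ y) = counit (R := k) x • y := rfl

/-- Representations of the coproducts of `x` and `y` yield one of `x ⊗ y`. -/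
noncomputable def reprTmul {x : C} {y : D} {ι κ : Type*} (r : Repr k x ι) (s : Repr k y κ) :
    Repr k (x ⊗ₜ[k] y) (ι × κ) where
  index := r.index ×ˢ s.index
  left i := r.left i.1 ⊗ₜ s.left i.2
  right i := r.right i.1 ⊗ₜ s.right i.2
  eq := by
    rw [TensorProduct.comul_tmul, ← r.eq, ← s.eq]
    simp only [TensorProduct.sum_tmul, TensorProduct.tmul_sum, Finset.sum_product, map_sum,
      TensorProduct.AlgebraTensorModule.tensorTensorTensorComm_tmul]
    exact Finset.sum_comm

theorem sum_counit_right_smul {x : C} {ι : Type*} (r : Repr k x ι) :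
    ∑ i ∈ r.index, counit (R := k) (r.right i) • r.left i = x := by
  have := congrArg (TensorProduct.rid k C) (sum_tmul_counit_eq r)
  simpa only [map_sum, TensorProduct.rid_tmul, one_smul] using this

/-- The projection contributes the counit of the second leg of y, which collapses the coproduct of
y; only that of x survives. -/
theorem convMul_fst (f : WithConv (C ⊗[k] D →ₗ[k] A)) (g : WithConv (C →ₗ[k] A)) (x : C) (y : D)
    {ι : Type*} (r : Repr k x ι) : (f * precomp A (fstHom k C D) g) (x ⊗ₜ y) =
      ∑ i ∈ r.index, f (r.left i ⊗ₜ y) * g (r.right i) := by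
  rw [(reprTmul r (ℛ k y)).convMul_apply]
  simp only [reprTmul,
    Finset.sum_product, precomp_apply, fstHom_tmul, map_smul, mul_smul_comm, ← smul_mul_assoc,
    ← Finset.sum_mul]
  refine Finset.sum_congr rfl fun i _ => ?_
  conv_rhs => rw [← sum_counit_right_smul (ℛ k y)]
  simp only [TensorProduct.tmul_sum, TensorProduct.tmul_smul, map_sum, map_smul]

theorem fst_convMul (f : WithConv (C ⊗[k] D →ₗ[k] A)) (g : WithConv (C →ₗ[k] A)) (x : C) (y : D)
    {ι : Type*} (r : Repr k x ι) : (precomp A (fstHom k C D) g * f) (x ⊗ₜ y) =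
      ∑ i ∈ r.index, g (r.left i) * f (r.right i ⊗ₜ y) := by
  rw [(reprTmul r (ℛ k y)).convMul_apply]
  simp only [reprTmul,
    Finset.sum_product, precomp_apply, fstHom_tmul, map_smul, smul_mul_assoc, ← mul_smul_comm,
    ← Finset.mul_sum]
  refine Finset.sum_congr rfl fun i _ => ?_
  conv_rhs => rw [← sum_counit_smul (ℛ k y)]
  simp only [TensorProduct.tmul_sum, TensorProduct.tmul_smul, map_sum, map_smul]

theorem convMul_snd (f : WithConv (C ⊗[k] D →ₗ[k] A)) (g : WithConv (D →ₗ[k] A)) (x : C) (y : D)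
    {ι : Type*} (r : Repr k y ι) : (f * precomp A (sndHom k C D) g) (x ⊗ₜ y) =
      ∑ i ∈ r.index, f (x ⊗ₜ r.left i) * g (r.right i) := by
  rw [(reprTmul (ℛ k x) r).convMul_apply]
  simp only [reprTmul,
    precomp_apply, sndHom_tmul, map_smul, mul_smul_comm, ← smul_mul_assoc]
  rw [Finset.sum_product_right]
  simp only [← Finset.sum_mul, TensorProduct.smul_tmul', ← map_smul, ← map_sum,
    ← TensorProduct.sum_tmul]
  refine Finset.sum_congr rfl fun i _ => ?_
  congr 3
  exact sum_counit_right_smul (ℛ k x)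

theorem snd_convMul (f : WithConv (C ⊗[k] D →ₗ[k] A)) (g : WithConv (D →ₗ[k] A)) (x : C) (y : D)
    {ι : Type*} (r : Repr k y ι) : (precomp A (sndHom k C D) g * f) (x ⊗ₜ y) =
      ∑ i ∈ r.index, g (r.left i) * f (x ⊗ₜ r.right i) := by
  rw [(reprTmul (ℛ k x) r).convMul_apply]
  simp only [reprTmul,
    precomp_apply, sndHom_tmul, map_smul, smul_mul_assoc, ← mul_smul_comm]
  rw [Finset.sum_product_right]
  simp only [← Finset.mul_sum, TensorProduct.smul_tmul', ← map_smul, ← map_sum,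
    ← TensorProduct.sum_tmul]
  refine Finset.sum_congr rfl fun i _ => ?_
  congr 3
  exact sum_counit_smul (ℛ k x)

/-- Expresses a product of values in independent variables as a convolution product, so that
Sweedler computations in several variables become calculations in one algebra. -/
theorem fst_convMul_snd (f : WithConv (C →ₗ[k] A)) (g : WithConv (D →ₗ[k] A)) (x : C) (y : D) :
    (precomp A (fstHom k C D) f * precomp A (sndHom k C D) g) (x ⊗ₜ y) = f x * g y := by
  rw [convMul_snd _ _ _ _ (ℛ k y)]
  simp only [precomp_apply, fstHom_tmul, map_smul, smul_mul_assoc, ← mul_smul_comm,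
    ← Finset.mul_sum]
  simp only [← map_smul, ← map_sum, sum_counit_smul]

theorem snd_convMul_fst (f : WithConv (C →ₗ[k] A)) (g : WithConv (D →ₗ[k] A)) (x : C) (y : D) :
    (precomp A (sndHom k C D) g * precomp A (fstHom k C D) f) (x ⊗ₜ y) = g y * f x := by
  rw [convMul_fst _ _ _ _ (ℛ k x)]
  simp only [precomp_apply, sndHom_tmul, map_smul, smul_mul_assoc, ← mul_smul_comm,
    ← Finset.mul_sum]
  simp only [← map_smul, ← map_sum, sum_counit_smul]

end Projections

/-! ### Bijectivity and naturality of the antipode -/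

section Antipode

variable {k : Type*} [Field k] {H : Type*} [Ring H]

open WithConv Coalgebra HopfAlgebra

/-- The antipode of a Hopf algebra is bijective as soon as the co-opposite bialgebra has an antipode,
i.e. the canonical map to the opposite algebra is invertible under convolution. -/
theorem antipode_bijective_of_isUnit [HopfAlgebra k H]
    (h : IsUnit (toConv (MulOpposite.opLinearEquiv k (M := H)).toLinearMap)) :
    Function.Bijective (antipode k (A := H)) := by
  set o : WithConv (H →ₗ[k] Hᵐᵒᵖ) := toConv (MulOpposite.opLinearEquiv k (M := H)).toLinearMap
  obtain ⟨T, hT, hT'⟩ := isUnit_iff_exists.1 h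
  let π₁ := precomp Hᵐᵒᵖ (fstHom k H H)
  let π₂ := precomp Hᵐᵒᵖ (sndHom k H H)
  have e1 : precomp Hᵐᵒᵖ (Bialgebra.mulCoalgHom k H) o = π₂ o * π₁ o := by
    apply WithConv.ext
    refine TensorProduct.ext' fun x y => ?_
    rw [snd_convMul_fst]
    simp [o]
  -- Both sides are convolution inverses of `o` pulled back along the multiplication. As `o`
  -- reverses products, this makes T a homomorphism to `Hᵐᵒᵖ`.
  have e2 : precomp Hᵐᵒᵖ (Bialgebra.mulCoalgHom k H) T = π₁ T * π₂ T := by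
    refine left_inv_eq_right_inv (a := precomp Hᵐᵒᵖ (Bialgebra.mulCoalgHom k H) o) ?_ ?_
    · rw [← map_mul, hT', map_one]
    · rw [e1, mul_assoc, ← mul_assoc (π₁ o), ← map_mul π₁, hT, map_one, one_mul, ← map_mul, hT,
        map_one]
  have T_mul : ∀ x y, T (x * y) = T x * T y := fun x y => by
    have := congrArg (fun f => f.ofConv (x ⊗ₜ y)) e2
    simp only [π₁, π₂, fst_convMul_snd] at this
    simpa using this
  have T_one : T 1 = 1 := by
    have := congrArg (fun f => f.ofConv 1) hT
    simpa [Algebra.TensorProduct.one_def, o] using this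
  let Th : H →ₐ[k] Hᵐᵒᵖ := AlgHom.ofLinearMap T.ofConv T_one T_mul
  let Sh : Hᵐᵒᵖ →ₐ[k] H := AlgHom.ofLinearMap
    (antipode k ∘ₗ (MulOpposite.opLinearEquiv k (M := H)).symm.toLinearMap) (by simp)
    (fun x y => by simp [antipode_mul_antidistrib])
  have i1 := LinearMap.antipode_mul_id (R := k) (C := H)
  have i2 := LinearMap.id_mul_antipode (R := k) (C := H)
  -- The composite of T followed by the antipode S and the identity are both convolution inverses of
  -- S.
  have c1 : postcomp H Sh T = toConv LinearMap.id := by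
    refine (left_inv_eq_right_inv (a := toConv (antipode k (A := H))) i2 ?_).symm
    have : toConv (antipode k (A := H)) = postcomp H Sh o := rfl
    rw [this, ← map_mul, hT, map_one]
  -- The composite of S followed by T and the map `o` are both convolution inverses of T.
  have c2 : postcomp H Th (toConv (antipode k)) = o := by
    refine (left_inv_eq_right_inv (a := T) hT ?_).symm
    have : T = postcomp H Th (toConv LinearMap.id) := rfl
    conv_lhs => rw [this]
    rw [← map_mul, i2, map_one]
  constructor
  · intro x y hxy
    have h1 : T (antipode k x) = MulOpposite.op x := congrArg (fun f => f.ofConv x) c2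
    have h2 : T (antipode k y) = MulOpposite.op y := congrArg (fun f => f.ofConv y) c2
    rw [hxy, h2] at h1
    exact (MulOpposite.op_injective h1).symm
  · intro x
    exact ⟨_, congrArg (fun f => f.ofConv x) c1⟩

/-- A bialgebra homomorphism between Hopf algebras commutes with the antipodes. -/
theorem map_antipode_of_bialgHom {H' : Type*} [Ring H'] [HopfAlgebra k H] [HopfAlgebra k H']
    (φ : H →ₐc[k] H') (x : H) : φ (antipode k x) = antipode k (φ x) := by
  let φ' : H →ₐ[k] H' := φ
  have : postcomp H φ' (toConv (antipode k)) =
      precomp H' (φ : H →ₗc[k] H') (toConv (antipode k)) := by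
    refine left_inv_eq_right_inv (a := precomp H' (φ : H →ₗc[k] H') (toConv LinearMap.id)) ?_ ?_
    · have : precomp H' (φ : H →ₗc[k] H') (toConv LinearMap.id) =
        postcomp H φ' (toConv LinearMap.id) := rfl
      rw [this, ← map_mul, LinearMap.antipode_mul_id, map_one]
    · rw [← map_mul, LinearMap.id_mul_antipode, map_one]
  exact congrArg (fun f => f.ofConv x) this

end Antipode

end FRTDouble

namespace FRTDouble

/-! ### Coefficients of finite-dimensional representations -/

section CoefficientFunctionals

variable {k : Type u} [Field k] {A : Type v} [Ring A] [Bialgebra k A]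

open WithConv Coalgebra

/-- `f` is a coefficient of a homomorphism from `A` to a finite dimensional algebra. -/
def IsCoefficient (f : ConvDual k A) : Prop :=
  ∃ (D : Type u) (_ : Ring D) (_ : Algebra k D) (_ : Module.Finite k D) (ρ : A →ₐ[k] D)
    (φ : D →ₗ[k] k), ∀ x, f x = φ (ρ x)

theorem IsCoefficient.isFinite {f : ConvDual k A} (hf : IsCoefficient f) : IsFinite f := by
  obtain ⟨D, _, _, _, ρ, φ, h⟩ := hf
  let e := (Module.finBasis k D).equivFun
  have he : ∀ x, (e.toLinearMap ∘ₗ ρ.toLinearMap) x = 0 ↔ ρ x = 0 := fun x => by simp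
  refine ⟨_, e.toLinearMap ∘ₗ ρ.toLinearMap, fun a x hx => ?_, fun x hx => ?_⟩
  · rw [he] at hx ⊢
    rw [he, map_mul, map_mul, hx, mul_zero, zero_mul]
    exact ⟨rfl, rfl⟩
  · rw [he] at hx
    rw [h, hx, map_zero]

theorem isCoefficient_of_algHom (f : ConvDual k A) (h1 : f 1 = 1)
    (h : ∀ x y, f (x * y) = f x * f y) : IsCoefficient f :=
  ⟨k, inferInstance, inferInstance, inferInstance, AlgHom.ofLinearMap f.ofConv h1 h,
    LinearMap.id, fun _ => rfl⟩

/-- A skew derivation is the upper right entry of a two-dimensional triangular representation with a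
and b on the diagonal. -/
theorem isCoefficient_of_skew (f a b : ConvDual k A) (ha1 : a 1 = 1)
    (ha : ∀ x y, a (x * y) = a x * a y) (hb1 : b 1 = 1) (hb : ∀ x y, b (x * y) = b x * b y)
    (h : ∀ x y, f (x * y) = a x * f y + f x * b y) : IsCoefficient f := by
  have h1 : f 1 = 0 := by
    have := h 1 1
    rw [mul_one, ha1, hb1] at this
    linear_combination -this
  let ρ : A →ₐ[k] Matrix (Fin 2) (Fin 2) k := AlgHom.ofLinearMap
    { toFun := fun x => !![a x, f x; 0, b x]
      map_add' := fun x y => by ext i j; fin_cases i <;> fin_cases j <;> simp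
      map_smul' := fun c x => by ext i j; fin_cases i <;> fin_cases j <;> simp }
    (by ext i j; fin_cases i <;> fin_cases j <;> simp [ha1, hb1, h1])
    (fun x y => by
      ext i j; fin_cases i <;> fin_cases j <;> simp [ha, hb, h])
  exact ⟨_, inferInstance, inferInstance, inferInstance, ρ, Matrix.entryLinearMap k k 0 1,
    fun x => by simp [ρ]⟩

variable (k A) in
/-- The algebra of coefficients of finite dimensional representations of `A`. -/
noncomputable def coefficients : Subalgebra k (ConvDual k A) where
  carrier := {f | IsCoefficient f}
  algebraMap_mem' r := ⟨k, inferInstance, inferInstance, inferInstance,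
    Bialgebra.counitAlgHom k A, r • LinearMap.id, fun x => by
      simp [Algebra.algebraMap_eq_smul_one]⟩
  add_mem' := by
    rintro f g ⟨D, _, _, _, ρ, φ, h⟩ ⟨D', _, _, _, ρ', φ', h'⟩
    exact ⟨D × D', inferInstance, inferInstance, inferInstance, ρ.prod ρ', φ.coprod φ',
      fun x => by simp [h, h']⟩
  mul_mem' := by
    rintro f g ⟨D, _, _, _, ρ, φ, h⟩ ⟨D', _, _, _, ρ', φ', h'⟩
    refine ⟨D ⊗[k] D', inferInstance, inferInstance, inferInstance,
      (Algebra.TensorProduct.map ρ ρ').comp (Bialgebra.comulAlgHom k A),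
      LinearMap.mul' k k ∘ₗ TensorProduct.map φ φ', fun x => ?_⟩
    rw [(ℛ k x).convMul_apply]
    simp only [AlgHom.comp_apply, Bialgebra.comulAlgHom_apply]
    rw [← (ℛ k x).eq]
    simp [h, h']

theorem mem_coefficients {f : ConvDual k A} : f ∈ coefficients k A ↔ IsCoefficient f := Iff.rfl

end CoefficientFunctionals

/-! ### Hopf subalgebras of the finite dual generated by characters and skew derivations -/

section DualBialgebra

variable {k : Type u} [Field k] {A : Type v} [Ring A] [Bialgebra k A] {H : Type w} [Ring H]
  [Algebra k H]

/-- The data of `DualHopf` without the antipode and the finiteness. -/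
structure DualBialgebra (j : H →ₐ[k] ConvDual k A) where
  injective : Function.Injective j
  comul : H →ₗ[k] H ⊗[k] H
  evalAt₂_comul : ∀ (f : H) (x y : A), evalAt₂ j x y (comul f) = j f (x * y)

namespace DualBialgebra

variable {j : H →ₐ[k] ConvDual k A} (s : DualBialgebra j)

/-- Pairs of evaluations separate the elements of H ⊗ H, so a coproduct chosen pointwise is unique
and therefore linear. -/
theorem nonempty_of_exists (hj : Function.Injective j)
    (h : ∀ f : H, ∃ t : H ⊗[k] H, ∀ x y, evalAt₂ j x y t = j f (x * y)) :
    Nonempty (DualBialgebra j) := by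
  choose t ht using h
  exact ⟨⟨hj,
    { toFun := t
      map_add' := fun f g => tensor_ext₂ j hj fun x y => by simp [ht]
      map_smul' := fun c f => tensor_ext₂ j hj fun x y => by simp [ht] }, ht⟩⟩

theorem evalAt_lid_rTensor (j : H →ₐ[k] ConvDual k A) (x y : A) (t : H ⊗[k] H) :
    evalAt j y (TensorProduct.lid k H ((evalAt j x).rTensor H t)) = evalAt₂ j x y t := by
  induction t with
  | zero => simp
  | add p q hp hq => simp only [map_add, hp, hq]
  | tmul f g => simp [evalAt₂_tmul]

theorem evalAt_rid_lTensor (j : H →ₐ[k] ConvDual k A) (x y : A) (t : H ⊗[k] H) :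
    evalAt j x (TensorProduct.rid k H ((evalAt j y).lTensor H t)) = evalAt₂ j x y t := by
  induction t with
  | zero => simp
  | add p q hp hq => simp only [map_add, hp, hq]
  | tmul f g => simp [evalAt₂_tmul, mul_comm]

/-- Tested at x, y, z, the two iterated coproducts turn into the two bracketings of the product xyz
in A. -/
theorem coassoc_aux (x y z : A) (t : H ⊗[k] H) :
    evalAt₂ j y z (TensorProduct.lid k (H ⊗[k] H) ((evalAt j x).rTensor (H ⊗[k] H)
      (s.comul.lTensor H t))) = evalAt₂ j x (y * z) t ∧
    evalAt₂ j y z (TensorProduct.lid k (H ⊗[k] H) ((evalAt j x).rTensor (H ⊗[k] H)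
      (TensorProduct.assoc k H H H (s.comul.rTensor H t)))) = evalAt₂ j (x * y) z t := by
  induction t with
  | zero => simp
  | add p q hp hq => simp only [map_add, hp.1, hp.2, hq.1, hq.2, and_self]
  | tmul f g =>
    refine ⟨by simp [evalAt₂_tmul, s.evalAt₂_comul, evalAt_apply], ?_⟩
    rw [LinearMap.rTensor_tmul, evalAt₂_tmul, evalAt_apply j (x * y), ← s.evalAt₂_comul]
    generalize s.comul f = w
    induction w with
    | zero => simp
    | add p q hp hq => simp only [TensorProduct.add_tmul, map_add, hp, hq, add_mul]
    | tmul a b => simp [evalAt₂_tmul, mul_assoc]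

/-- The coalgebra structure given by the dual coproduct. -/
noncomputable abbrev coalgebra : Coalgebra k H where
  comul := s.comul
  counit := evalAt j 1
  coassoc := by
    ext f
    refine tensor_ext j s.injective fun x => tensor_ext₂ j s.injective fun y z => ?_
    refine ((s.coassoc_aux x y z _).2.trans ?_).trans (s.coassoc_aux x y z _).1.symm
    rw [s.evalAt₂_comul, s.evalAt₂_comul, mul_assoc]
  rTensor_counit_comp_comul := by
    ext f
    apply (TensorProduct.lid k H).injective
    refine evalAt_ext j s.injective fun x => ?_
    refine (evalAt_lid_rTensor j 1 x _).trans ?_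
    simp [s.evalAt₂_comul, evalAt_apply]
  lTensor_counit_comp_comul := by
    ext f
    apply (TensorProduct.rid k H).injective
    refine evalAt_ext j s.injective fun x => ?_
    refine (evalAt_rid_lTensor j x 1 _).trans ?_
    simp [s.evalAt₂_comul, evalAt_apply]

/-- The compatibility of product and coproduct is self-dual: the one for H is that for A read
through the pairing. -/
theorem evalAt₂_comul_mul (a b : H) (x y : A) :
    evalAt₂ j x y (s.comul a * s.comul b) = j (a * b) (x * y) := by
  have r := Coalgebra.Repr.arbitrary k x
  have r' := Coalgebra.Repr.arbitrary k y
  rw [DualHopf.evalAt₂_mul j x y _ _ r r']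
  simp only [s.evalAt₂_comul]
  rw [map_mul j, LinearMap.convMul_apply, Bialgebra.comul_mul, ← r.eq, ← r'.eq,
    Finset.sum_mul_sum]
  simp

/-- The bialgebra structure on `H`. -/
noncomputable abbrev bialgebra : Bialgebra k H :=
  letI := s.coalgebra
  Bialgebra.mk' k H
    (by
      change j 1 1 = 1
      simp)
    (by
      intro a b
      change j (a * b) 1 = j a 1 * j b 1
      simp [Algebra.TensorProduct.one_def])
    (by
      refine tensor_ext₂ j s.injective fun x y => ?_
      refine (s.evalAt₂_comul _ _ _).trans ?_
      rw [Algebra.TensorProduct.one_def, evalAt₂_tmul]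
      simp [evalAt_apply])
    (by
      intro a b
      refine tensor_ext₂ j s.injective fun x y => ?_
      exact (s.evalAt₂_comul _ _ _).trans (s.evalAt₂_comul_mul a b x y).symm)

/-- The antipode is by definition the convolution inverse of the identity; invertibility of the map
to the opposite algebra makes it bijective. -/
theorem exists_dualHopf (hf : ∀ f, IsFinite (j f))
    (hid : letI := s.bialgebra; IsUnit (WithConv.toConv (LinearMap.id (R := k) (M := H))))
    (hop : letI := s.bialgebra
      IsUnit (WithConv.toConv (MulOpposite.opLinearEquiv k (M := H)).toLinearMap)) :
    ∃ t : DualHopf j, letI := t.hopfAlgebra;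
      Function.Bijective (HopfAlgebra.antipode k (A := H)) := by
  let := s.bialgebra
  obtain ⟨S, hS, hS'⟩ := isUnit_iff_exists.1 hid
  let t : DualHopf j :=
    { injective := s.injective
      isFinite := hf
      comul := s.comul
      evalAt₂_comul := s.evalAt₂_comul
      antipode := S.ofConv
      antipode_left := fun f => congrArg (fun g => g.ofConv f) hS'
      antipode_right := fun f => congrArg (fun g => g.ofConv f) hS }
  refine ⟨t, ?_⟩
  let := t.hopfAlgebra
  exact antipode_bijective_of_isUnit hop

end DualBialgebra

/-- `G` consists of characters of `A`, invertible in `G`, and `E` of skew derivations with respect to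
characters in `G`. -/
structure IsPointedDual (G E : Set (ConvDual k A)) : Prop where
  map_one : ∀ g ∈ G, g 1 = 1
  map_mul : ∀ g ∈ G, ∀ x y, g (x * y) = g x * g y
  inv : ∀ g ∈ G, ∃ g' ∈ G, g * g' = 1 ∧ g' * g = 1
  skew : ∀ e ∈ E, ∃ a ∈ G, ∃ b ∈ G, ∀ x y, e (x * y) = a x * e y + e x * b y

variable {G E : Set (ConvDual k A)}

theorem IsPointedDual.adjoin_le_coefficients (h : IsPointedDual G E) :
    Algebra.adjoin k (G ∪ E) ≤ coefficients k A := by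
  rw [Algebra.adjoin_le_iff]
  rintro f (hf | hf)
  · exact isCoefficient_of_algHom f (h.map_one f hf) (h.map_mul f hf)
  · obtain ⟨a, ha, b, hb, hab⟩ := h.skew f hf
    exact isCoefficient_of_skew f a b (h.map_one a ha) (h.map_mul a ha) (h.map_one b hb)
      (h.map_mul b hb) hab

/-- Characters get f ⊗ f, skew derivations a ⊗ f + f ⊗ b, and a product of functionals gets the
product of the tensors, because A is a bialgebra. -/
theorem IsPointedDual.exists_comul (h : IsPointedDual G E)
    (f : Algebra.adjoin k (G ∪ E)) : ∃ t : Algebra.adjoin k (G ∪ E) ⊗[k] Algebra.adjoin k (G ∪ E),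
      ∀ x y, evalAt₂ (Algebra.adjoin k (G ∪ E)).val x y t = (f : ConvDual k A) (x * y) := by
  have mem : ∀ {f}, f ∈ G ∪ E → f ∈ Algebra.adjoin k (G ∪ E) := fun hf =>
    Algebra.subset_adjoin hf
  obtain ⟨f, hf⟩ := f
  induction hf using Algebra.adjoin_induction with
  | mem f hf =>
    rcases hf with hf | hf
    · refine ⟨⟨f, mem (.inl hf)⟩ ⊗ₜ ⟨f, mem (.inl hf)⟩, fun x y => ?_⟩
      simp [evalAt₂_tmul, evalAt_apply, h.map_mul f hf]
    · obtain ⟨a, ha, b, hb, hab⟩ := h.skew f hf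
      refine ⟨⟨a, mem (.inl ha)⟩ ⊗ₜ ⟨f, mem (.inr hf)⟩ +
        ⟨f, mem (.inr hf)⟩ ⊗ₜ ⟨b, mem (.inl hb)⟩, fun x y => ?_⟩
      simp [evalAt₂_tmul, evalAt_apply, hab]
  | algebraMap r =>
    refine ⟨algebraMap k _ r ⊗ₜ 1, fun x y => ?_⟩
    rw [evalAt₂_tmul, evalAt_apply, evalAt_apply, AlgHom.commutes, _root_.map_one]
    simp [mul_assoc]
  | add f g _ _ hf hg =>
    obtain ⟨t, ht⟩ := hf
    obtain ⟨t', ht'⟩ := hg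
    exact ⟨t + t', fun x y => by simp_all⟩
  | mul f g _ _ hf hg =>
    obtain ⟨t, ht⟩ := hf
    obtain ⟨t', ht'⟩ := hg
    refine ⟨t * t', fun x y => ?_⟩
    have r := Coalgebra.Repr.arbitrary k x
    have r' := Coalgebra.Repr.arbitrary k y
    rw [DualHopf.evalAt₂_mul _ x y _ _ r r']
    simp only [ht, ht']
    rw [LinearMap.convMul_apply, Bialgebra.comul_mul, ← r.eq, ← r'.eq, Finset.sum_mul_sum]
    simp

/-- A subalgebra of `A^*` generated by invertible characters and skew derivations is a Hopf subalgebra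
of the finite dual, and its antipode is bijective. -/
theorem IsPointedDual.exists_dualHopf (h : IsPointedDual G E) :
    ∃ t : DualHopf (Algebra.adjoin k (G ∪ E)).val, letI := t.hopfAlgebra;
      Function.Bijective (HopfAlgebra.antipode k (A := Algebra.adjoin k (G ∪ E))) := by
  set H := Algebra.adjoin k (G ∪ E) with hH
  obtain ⟨s⟩ := DualBialgebra.nonempty_of_exists (H := H) (j := H.val) Subtype.val_injective
    h.exists_comul
  let := s.bialgebra
  let G' : Set H := Subtype.val ⁻¹' G
  let E' : Set H := Subtype.val ⁻¹' E
  -- For the dual coproduct, characters of A are group-like and skew derivations are skew-primitive.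
  have hp : IsPointed k G' E' :=
    { groupLike := fun g hg =>
        { counit_eq_one := h.map_one _ hg
          comul_eq_tmul_self := by
            refine tensor_ext₂ H.val s.injective fun x y => ?_
            refine (s.evalAt₂_comul _ _ _).trans ?_
            simpa [evalAt₂_tmul, evalAt_apply] using h.map_mul _ hg x y }
      skew := fun e he => by
        obtain ⟨a, ha, b, hb, hab⟩ := h.skew _ he
        refine ⟨⟨a, Algebra.subset_adjoin (.inl ha)⟩, ha, ⟨b, Algebra.subset_adjoin (.inl hb)⟩,
          hb, ?_⟩
        refine tensor_ext₂ H.val s.injective fun x y => ?_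
        refine (s.evalAt₂_comul _ _ _).trans ?_
        simpa [evalAt₂_tmul, evalAt_apply] using hab x y
      adjoin_eq_top := Algebra.adjoin_adjoin_coe_preimage }
  have hu : ∀ g ∈ Submonoid.closure G', IsUnit g := by
    intro g hg
    induction hg using Submonoid.closure_induction with
    | mem g hg =>
      obtain ⟨g', hg', h1, h2⟩ := h.inv _ hg
      exact isUnit_iff_exists.2 ⟨⟨g', Algebra.subset_adjoin (.inl hg')⟩, Subtype.ext h1,
        Subtype.ext h2⟩
    | one => exact isUnit_one
    | mul x y _ _ hx hy => exact hx.mul hy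
  refine s.exists_dualHopf (fun f => (h.adjoin_le_coefficients f.2).isFinite) ?_ ?_
  · exact hp.isUnit_toConv _ hu
  -- The same criterion with values in the opposite algebra: units stay units there.
  · exact hp.isUnit_toConv (D := Hᵐᵒᵖ) (MulOpposite.opLinearEquiv k).toLinearMap
      fun g hg => (hu g hg).op

end DualBialgebra

end FRTDouble

namespace FRTDouble

/-! ### Scalar factors in convolution products -/

section ScalarConvolution

variable {k : Type*} [Field k] {C D V : Type*} [AddCommMonoid C] [Module k C] [Coalgebra k C]
  [AddCommMonoid D] [Module k D] [Coalgebra k D] {A B : Type*} [Ring A] [Algebra k A]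
  [Ring B] [Algebra k B]

open WithConv Coalgebra

theorem scalar_convMul_apply (s : WithConv (C →ₗ[k] k)) (f : WithConv (C →ₗ[k] A)) (x : C)
    {ι : Type*} (r : Repr k x ι) :
    (scalar k C A s * f) x = ∑ i ∈ r.index, s (r.left i) • f (r.right i) := by
  rw [r.convMul_apply]
  exact Finset.sum_congr rfl fun i _ => (Algebra.smul_def _ _).symm

theorem convMul_scalar_apply (s : WithConv (C →ₗ[k] k)) (f : WithConv (C →ₗ[k] A)) (x : C)
    {ι : Type*} (r : Repr k x ι) :
    (f * scalar k C A s) x = ∑ i ∈ r.index, s (r.right i) • f (r.left i) := by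
  rw [r.convMul_apply]
  refine Finset.sum_congr rfl fun i _ => ?_
  rw [Algebra.smul_def, Algebra.commutes]
  rfl

/-- The scalar depends on the first tensor factor only, so it comes out of L as a function pulled
back along `fstHom`. With the three companions below, this extracts cocycle factors from nested
twisted products. -/
theorem comp_map_scalar_convMul_left (L : A ⊗[k] D →ₗ[k] B) (s : WithConv (C →ₗ[k] k))
    (f : WithConv (C →ₗ[k] A)) :
    toConv (L ∘ₗ TensorProduct.map (scalar k C A s * f).ofConv LinearMap.id) =
      scalar k _ B (precomp k (fstHom k C D) s) *
        toConv (L ∘ₗ TensorProduct.map f.ofConv LinearMap.id) := by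
  apply WithConv.ext
  refine TensorProduct.ext' fun x y => ?_
  refine Eq.trans ?_ (fst_convMul _ (scalar k C B s) x y (ℛ k x)).symm
  simp only [LinearMap.comp_apply, TensorProduct.map_tmul, LinearMap.id_apply]
  rw [scalar_convMul_apply s f x (ℛ k x)]
  simp only [TensorProduct.sum_tmul, map_sum, ← TensorProduct.smul_tmul', map_smul]
  exact Finset.sum_congr rfl fun i _ => Algebra.smul_def _ _

theorem comp_map_convMul_scalar_left (L : A ⊗[k] D →ₗ[k] B) (s : WithConv (C →ₗ[k] k))
    (f : WithConv (C →ₗ[k] A)) :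
    toConv (L ∘ₗ TensorProduct.map (f * scalar k C A s).ofConv LinearMap.id) =
      toConv (L ∘ₗ TensorProduct.map f.ofConv LinearMap.id) *
        scalar k _ B (precomp k (fstHom k C D) s) := by
  apply WithConv.ext
  refine TensorProduct.ext' fun x y => ?_
  refine Eq.trans ?_ (convMul_fst _ (scalar k C B s) x y (ℛ k x)).symm
  simp only [LinearMap.comp_apply, TensorProduct.map_tmul, LinearMap.id_apply]
  rw [convMul_scalar_apply s f x (ℛ k x)]
  simp only [TensorProduct.sum_tmul, map_sum, ← TensorProduct.smul_tmul', map_smul]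
  refine Finset.sum_congr rfl fun i _ => ?_
  rw [Algebra.smul_def, Algebra.commutes]
  rfl

theorem comp_map_scalar_convMul_right (L : D ⊗[k] A →ₗ[k] B) (s : WithConv (C →ₗ[k] k))
    (f : WithConv (C →ₗ[k] A)) :
    toConv (L ∘ₗ TensorProduct.map LinearMap.id (scalar k C A s * f).ofConv) =
      scalar k _ B (precomp k (sndHom k D C) s) *
        toConv (L ∘ₗ TensorProduct.map LinearMap.id f.ofConv) := by
  apply WithConv.ext
  refine TensorProduct.ext' fun x y => ?_
  refine Eq.trans ?_ (snd_convMul _ (scalar k C B s) x y (ℛ k y)).symm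
  simp only [LinearMap.comp_apply, TensorProduct.map_tmul, LinearMap.id_apply]
  rw [scalar_convMul_apply s f y (ℛ k y)]
  simp only [TensorProduct.tmul_sum, map_sum, TensorProduct.tmul_smul, map_smul]
  exact Finset.sum_congr rfl fun i _ => Algebra.smul_def _ _

theorem comp_map_convMul_scalar_right (L : D ⊗[k] A →ₗ[k] B) (s : WithConv (C →ₗ[k] k))
    (f : WithConv (C →ₗ[k] A)) :
    toConv (L ∘ₗ TensorProduct.map LinearMap.id (f * scalar k C A s).ofConv) =
      toConv (L ∘ₗ TensorProduct.map LinearMap.id f.ofConv) *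
        scalar k _ B (precomp k (sndHom k D C) s) := by
  apply WithConv.ext
  refine TensorProduct.ext' fun x y => ?_
  refine Eq.trans ?_ (convMul_snd _ (scalar k C B s) x y (ℛ k y)).symm
  simp only [LinearMap.comp_apply, TensorProduct.map_tmul, LinearMap.id_apply]
  rw [convMul_scalar_apply s f y (ℛ k y)]
  simp only [TensorProduct.tmul_sum, map_sum, TensorProduct.tmul_smul, map_smul]
  refine Finset.sum_congr rfl fun i _ => ?_
  rw [Algebra.smul_def, Algebra.commutes]
  rfl

end ScalarConvolution

/-! ### Twisting the product of a bialgebra by a two-cocycle -/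

section Twist

open WithConv Coalgebra

/-- The associator of a coalgebra as a coalgebra map. -/
noncomputable def assocHom (k C : Type*) [Field k] [AddCommMonoid C] [Module k C] [Coalgebra k C] :
    (C ⊗[k] C) ⊗[k] C →ₗc[k] C ⊗[k] (C ⊗[k] C) :=
  (Coalgebra.TensorProduct.assoc k k C C C : (C ⊗[k] C) ⊗[k] C →ₗc[k] C ⊗[k] (C ⊗[k] C))

@[simp] theorem assocHom_tmul {k C : Type*} [Field k] [AddCommMonoid C] [Module k C] [Coalgebra k C]
    (x y z : C) : assocHom k C ((x ⊗ₜ y) ⊗ₜ z) = x ⊗ₜ (y ⊗ₜ z) := rfl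

/-- A normalized convolution-invertible two-cocycle on a bialgebra. -/
structure Cocycle (k : Type*) [Field k] (C : Type*) [Ring C] [Bialgebra k C] where
  form : WithConv (C ⊗[k] C →ₗ[k] k)
  inv : WithConv (C ⊗[k] C →ₗ[k] k)
  form_mul_inv : form * inv = 1
  inv_mul_form : inv * form = 1
  form_one_left : ∀ x, form (1 ⊗ₜ x) = counit (R := k) x
  form_one_right : ∀ x, form (x ⊗ₜ 1) = counit (R := k) x
  cocycle : precomp k (fstHom k (C ⊗[k] C) C) form *
      precomp k (Coalgebra.TensorProduct.map (Bialgebra.mulCoalgHom k C) (CoalgHom.id k C)) form =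
    precomp k (assocHom k C)
      (precomp k (sndHom k C (C ⊗[k] C)) form * precomp k (Coalgebra.TensorProduct.map
        (CoalgHom.id k C) (Bialgebra.mulCoalgHom k C)) form)

namespace Cocycle

variable {k : Type*} [Field k] {C : Type*} [Ring C] [Bialgebra k C] (c : Cocycle k C)

/-- The twisted product `(x, y) ↦ ∑ γ(x₁, y₁) x₂ y₂ γ⁻¹(x₃, y₃)`. -/
noncomputable def mulConv : WithConv (C ⊗[k] C →ₗ[k] C) :=
  scalar k _ C c.form * toConv (LinearMap.mul' k C) * scalar k _ C c.inv

theorem postcomp_scalar {D A B : Type*} [AddCommMonoid D] [Module k D] [Coalgebra k D] [Ring A]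
    [Algebra k A] [Ring B] [Algebra k B] (h : A →ₐ[k] B) (s : WithConv (D →ₗ[k] k)) :
    postcomp D h (scalar k D A s) = scalar k D B s := by
  ext x
  exact h.commutes _

/-- The twisted product as a coalgebra map. -/
noncomputable def mulHom : C ⊗[k] C →ₗc[k] C where
  toLinearMap := c.mulConv.ofConv
  counit_comp := by
    have e : postcomp (C ⊗[k] C) (Bialgebra.counitAlgHom k C) (toConv (LinearMap.mul' k C)) = 1 := by
      apply WithConv.ext
      refine TensorProduct.ext' fun x y => ?_
      simp [mul_comm]
    have : postcomp (C ⊗[k] C) (Bialgebra.counitAlgHom k C) c.mulConv = 1 := by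
      rw [mulConv, map_mul, map_mul, postcomp_scalar, postcomp_scalar, e, mul_one, ← map_mul,
        c.form_mul_inv, map_one]
    exact congrArg WithConv.ofConv this
  map_comp_comul := by
    -- Through the embeddings of C in the two factors of C ⊗ C, compatibility with coproducts
    -- becomes an identity between convolution products.
    let i₁ := postcomp (C ⊗[k] C) (Algebra.TensorProduct.includeLeft : C →ₐ[k] C ⊗[k] C)
    let i₂ := postcomp (C ⊗[k] C) (Algebra.TensorProduct.includeRight : C →ₐ[k] C ⊗[k] C)
    have e0 : ∀ f : WithConv (C ⊗[k] C →ₗ[k] C),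
        TensorProduct.map f.ofConv f.ofConv ∘ₗ comul = (i₁ f * i₂ f).ofConv := by
      intro f
      ext1
      ext x y
      simp only [TensorProduct.AlgebraTensorModule.curry_apply, LinearMap.restrictScalars_self,
        TensorProduct.curry_apply, LinearMap.comp_apply, LinearMap.convMul_apply]
      generalize (comul (x ⊗ₜ[k] y) : (C ⊗[k] C) ⊗[k] (C ⊗[k] C)) = t
      induction t with
      | zero => simp
      | add s t hs ht => simp only [map_add, hs, ht]
      | tmul a b =>
        simp [i₁, i₂, postcomp]
    have e1 : i₁ (toConv (LinearMap.mul' k C)) * i₂ (toConv (LinearMap.mul' k C)) =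
        postcomp (C ⊗[k] C) (Bialgebra.comulAlgHom k C) (toConv (LinearMap.mul' k C)) := by
      refine WithConv.ext ((e0 (toConv (LinearMap.mul' k C))).symm.trans ?_)
      exact (Bialgebra.mulCoalgHom k C).map_comp_comul
    have e2 : i₁ c.mulConv * i₂ c.mulConv =
        postcomp (C ⊗[k] C) (Bialgebra.comulAlgHom k C) c.mulConv := by
      simp only [mulConv, map_mul, ← e1, i₁, i₂, postcomp_scalar]
      -- The γ⁻¹ that ends the first twisted product cancels the γ that begins the second.
      have := congrArg (scalar k (C ⊗[k] C) (C ⊗[k] C)) c.inv_mul_form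
      rw [map_mul, map_one] at this
      simp only [mul_assoc]
      rw [← mul_assoc (scalar k (C ⊗[k] C) (C ⊗[k] C) c.inv), this, one_mul]
    rw [e0, e2]
    rfl

theorem mulHom_apply (x : C ⊗[k] C) : c.mulHom x = c.mulConv x := rfl

theorem precomp_map_mulHom_left_apply (B : Type*) [Ring B] [Algebra k B]
    (f : WithConv (C ⊗[k] C →ₗ[k] B)) :
    precomp B (Coalgebra.TensorProduct.map c.mulHom (CoalgHom.id k C)) f =
      scalar k _ B (precomp k (fstHom k (C ⊗[k] C) C) c.form) * toConv (f.ofConv ∘ₗ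
        TensorProduct.map (LinearMap.mul' k C) LinearMap.id) *
      scalar k _ B (precomp k (fstHom k (C ⊗[k] C) C) c.inv) := by
  refine (comp_map_convMul_scalar_left f.ofConv c.inv
    (scalar k _ C c.form * toConv (LinearMap.mul' k C))).trans ?_
  rw [comp_map_scalar_convMul_left]

/-- Write x • y for the twisted product. In (x • y) • z the factor γ(x • y, z) is itself γ(xy, z)
conjugated by γ(x, y), and the adjacent inverse pairs cancel. What remains is the ordinary product
(xy)z conjugated by the left side of the cocycle identity. -/
theorem precomp_map_mulHom_left :
    precomp C (Coalgebra.TensorProduct.map c.mulHom (CoalgHom.id k C)) c.mulConv =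
      scalar k _ C (precomp k (fstHom k (C ⊗[k] C) C) c.form * precomp k
        (Coalgebra.TensorProduct.map (Bialgebra.mulCoalgHom k C) (CoalgHom.id k C)) c.form) *
      toConv (LinearMap.mul' k C ∘ₗ TensorProduct.map (LinearMap.mul' k C) LinearMap.id) *
      scalar k _ C (precomp k (Coalgebra.TensorProduct.map (Bialgebra.mulCoalgHom k C)
        (CoalgHom.id k C)) c.inv * precomp k (fstHom k (C ⊗[k] C) C) c.inv) := by
  have hG : precomp k (fstHom k (C ⊗[k] C) C) c.inv * precomp k (fstHom k (C ⊗[k] C) C) c.form =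
    1 := by rw [← map_mul, c.inv_mul_form, map_one]
  have e : ∀ s : WithConv (C ⊗[k] C →ₗ[k] k),
      precomp C (Coalgebra.TensorProduct.map c.mulHom (CoalgHom.id k C)) (scalar k _ C s) =
      scalar k _ C (precomp k (fstHom k (C ⊗[k] C) C) c.form * precomp k
        (Coalgebra.TensorProduct.map (Bialgebra.mulCoalgHom k C) (CoalgHom.id k C)) s *
        precomp k (fstHom k (C ⊗[k] C) C) c.inv) := fun s =>
    congrArg (scalar k _ C) (c.precomp_map_mulHom_left_apply k s)
  have hG' := congrArg (scalar k _ C) hG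
  rw [map_mul, map_one] at hG'
  conv_lhs => rw [mulConv, map_mul, map_mul, e, e, c.precomp_map_mulHom_left_apply C]
  simp only [map_mul, mul_assoc]
  rw [← mul_assoc (scalar k _ C (precomp k (fstHom k (C ⊗[k] C) C) c.inv))
    (scalar k _ C (precomp k (fstHom k (C ⊗[k] C) C) c.form)), hG', one_mul,
    ← mul_assoc (scalar k _ C (precomp k (fstHom k (C ⊗[k] C) C) c.inv))
    (scalar k _ C (precomp k (fstHom k (C ⊗[k] C) C) c.form)), hG', one_mul]

theorem precomp_map_mulHom_right_apply (B : Type*) [Ring B] [Algebra k B]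
    (f : WithConv (C ⊗[k] C →ₗ[k] B)) :
    precomp B (Coalgebra.TensorProduct.map (CoalgHom.id k C) c.mulHom) f =
      scalar k _ B (precomp k (sndHom k C (C ⊗[k] C)) c.form) * toConv (f.ofConv ∘ₗ
        TensorProduct.map LinearMap.id (LinearMap.mul' k C)) *
      scalar k _ B (precomp k (sndHom k C (C ⊗[k] C)) c.inv) := by
  refine (comp_map_convMul_scalar_right f.ofConv c.inv
    (scalar k _ C c.form * toConv (LinearMap.mul' k C))).trans ?_
  rw [comp_map_scalar_convMul_right]

/-- The mirror image: x • (y • z) is x(yz) conjugated by the right side of the cocycle identity. -/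
theorem precomp_map_mulHom_right :
    precomp C (Coalgebra.TensorProduct.map (CoalgHom.id k C) c.mulHom) c.mulConv =
      scalar k _ C (precomp k (sndHom k C (C ⊗[k] C)) c.form * precomp k
        (Coalgebra.TensorProduct.map (CoalgHom.id k C) (Bialgebra.mulCoalgHom k C)) c.form) *
      toConv (LinearMap.mul' k C ∘ₗ TensorProduct.map LinearMap.id (LinearMap.mul' k C)) *
      scalar k _ C (precomp k (Coalgebra.TensorProduct.map (CoalgHom.id k C)
        (Bialgebra.mulCoalgHom k C)) c.inv * precomp k (sndHom k C (C ⊗[k] C)) c.inv) := by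
  have hG : precomp k (sndHom k C (C ⊗[k] C)) c.inv * precomp k (sndHom k C (C ⊗[k] C)) c.form =
    1 := by rw [← map_mul, c.inv_mul_form, map_one]
  have e : ∀ s : WithConv (C ⊗[k] C →ₗ[k] k),
      precomp C (Coalgebra.TensorProduct.map (CoalgHom.id k C) c.mulHom) (scalar k _ C s) =
      scalar k _ C (precomp k (sndHom k C (C ⊗[k] C)) c.form * precomp k
        (Coalgebra.TensorProduct.map (CoalgHom.id k C) (Bialgebra.mulCoalgHom k C)) s *
        precomp k (sndHom k C (C ⊗[k] C)) c.inv) := fun s =>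
    congrArg (scalar k _ C) (c.precomp_map_mulHom_right_apply k s)
  have hG' := congrArg (scalar k _ C) hG
  rw [map_mul, map_one] at hG'
  conv_lhs => rw [mulConv, map_mul, map_mul, e, e, c.precomp_map_mulHom_right_apply C]
  simp only [map_mul, mul_assoc]
  rw [← mul_assoc (scalar k _ C (precomp k (sndHom k C (C ⊗[k] C)) c.inv))
    (scalar k _ C (precomp k (sndHom k C (C ⊗[k] C)) c.form)), hG', one_mul,
    ← mul_assoc (scalar k _ C (precomp k (sndHom k C (C ⊗[k] C)) c.inv))
    (scalar k _ C (precomp k (sndHom k C (C ⊗[k] C)) c.form)), hG', one_mul]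

/-- The two sides are the convolution inverses of the two sides of the cocycle identity. -/
theorem cocycle_inv : precomp k
      (Coalgebra.TensorProduct.map (Bialgebra.mulCoalgHom k C) (CoalgHom.id k C)) c.inv *
      precomp k (fstHom k (C ⊗[k] C) C) c.inv =
    precomp k (assocHom k C)
      (precomp k (Coalgebra.TensorProduct.map (CoalgHom.id k C) (Bialgebra.mulCoalgHom k C)) c.inv *
        precomp k (sndHom k C (C ⊗[k] C)) c.inv) := by
  have h : ∀ {D D' : Type _} [AddCommMonoid D] [Module k D] [Coalgebra k D] [AddCommMonoid D']
      [Module k D'] [Coalgebra k D'] (f f' : D →ₗc[k] C ⊗[k] C) (a b : WithConv (C ⊗[k] C →ₗ[k] k)),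
      a * b = 1 → (precomp k f a * precomp k f' a) * (precomp k f' b * precomp k f b) = 1 := by
    intro D D' _ _ _ _ _ _ f f' a b hab
    rw [mul_assoc, ← mul_assoc (precomp k f' a), ← map_mul, hab, map_one, one_mul, ← map_mul, hab,
      map_one]
  refine left_inv_eq_right_inv (a := precomp k (fstHom k (C ⊗[k] C) C) c.form * precomp k
    (Coalgebra.TensorProduct.map (Bialgebra.mulCoalgHom k C) (CoalgHom.id k C)) c.form) ?_ ?_
  · exact h (D' := C) _ _ _ _ c.inv_mul_form
  · rw [c.cocycle, ← map_mul, h (D' := C) _ _ _ _ c.form_mul_inv, map_one]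

/-- Both bracketings are the ordinary triple product conjugated by the same function, by the cocycle
identity and its inverse form. -/
theorem mulHom_assoc : c.mulHom.comp (Coalgebra.TensorProduct.map c.mulHom (CoalgHom.id k C)) =
    (c.mulHom.comp (Coalgebra.TensorProduct.map (CoalgHom.id k C) c.mulHom)).comp
      (assocHom k C) := by
  have e : ∀ s : WithConv (C ⊗[k] (C ⊗[k] C) →ₗ[k] k),
      precomp C (assocHom k C) (scalar k _ C s) =
        scalar k _ C (precomp k (assocHom k C) s) := fun _ => rfl
  have : precomp C (Coalgebra.TensorProduct.map c.mulHom (CoalgHom.id k C)) c.mulConv =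
      precomp C (assocHom k C)
        (precomp C (Coalgebra.TensorProduct.map (CoalgHom.id k C) c.mulHom) c.mulConv) := by
    rw [precomp_map_mulHom_left, precomp_map_mulHom_right, map_mul (precomp C (assocHom k C)),
      map_mul (precomp C (assocHom k C)), e, e, ← c.cocycle, ← c.cocycle_inv]
    congr 2
    apply WithConv.ext
    refine TensorProduct.ext_threefold fun x y z => ?_
    exact mul_assoc x y z
  ext1 x
  exact congrArg (fun f => f.ofConv x) this

/-- `x ↦ 1 ⊗ x` as a coalgebra map. -/
noncomputable def oneTmul (k C D : Type*) [Field k] [Ring C] [Bialgebra k C] [AddCommMonoid D]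
    [Module k D] [Coalgebra k D] : D →ₗc[k] C ⊗[k] D where
  toLinearMap := TensorProduct.mk k C D 1
  counit_comp := by ext; simp
  map_comp_comul := by
    ext x
    simp only [LinearMap.comp_apply, TensorProduct.mk_apply, TensorProduct.comul_tmul,
      Bialgebra.comul_one, Algebra.TensorProduct.one_def]
    generalize (comul x : D ⊗[k] D) = t
    induction t with
    | zero => simp
    | add s t hs ht => simp only [map_add, TensorProduct.tmul_add, hs, ht]
    | tmul a b => simp

/-- `x ↦ x ⊗ 1` as a coalgebra map. -/
noncomputable def tmulOne (k C D : Type*) [Field k] [AddCommMonoid C] [Module k C] [Coalgebra k C]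
    [Ring D] [Bialgebra k D] : C →ₗc[k] C ⊗[k] D where
  toLinearMap := (TensorProduct.mk k C D).flip 1
  counit_comp := by ext; simp
  map_comp_comul := by
    ext x
    simp only [LinearMap.comp_apply, TensorProduct.mk_apply, TensorProduct.comul_tmul,
      Bialgebra.comul_one, Algebra.TensorProduct.one_def, LinearMap.flip_apply]
    generalize (comul x : C ⊗[k] C) = t
    induction t with
    | zero => simp
    | add s t hs ht => simp only [map_add, TensorProduct.add_tmul, hs, ht]
    | tmul a b => simp

@[simp] theorem oneTmul_apply {k C D : Type*} [Field k] [Ring C] [Bialgebra k C] [AddCommMonoid D]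
    [Module k D] [Coalgebra k D] (x : D) : oneTmul k C D x = 1 ⊗ₜ x := rfl

@[simp] theorem tmulOne_apply {k C D : Type*} [Field k] [AddCommMonoid C] [Module k C] [Coalgebra k C]
    [Ring D] [Bialgebra k D] (x : C) : tmulOne k C D x = x ⊗ₜ 1 := rfl

/-- Wherever the cocycle becomes trivial, so does its inverse, and the twisted product is the
ordinary one. -/
theorem precomp_mulConv {D : Type*} [AddCommMonoid D] [Module k D] [Coalgebra k D]
    (h : D →ₗc[k] C ⊗[k] C) (hh : precomp k h c.form = 1) :
    precomp C h c.mulConv = precomp C h (toConv (LinearMap.mul' k C)) := by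
  have hi : precomp k h c.inv = 1 := by
    rw [← one_mul (precomp k h c.inv)]
    conv_lhs => rw [← hh]
    rw [← map_mul, c.form_mul_inv, map_one]
  have e : ∀ s : WithConv (C ⊗[k] C →ₗ[k] k), precomp C h (scalar k _ C s) =
    scalar k _ C (precomp k h s) := fun _ => rfl
  rw [mulConv, map_mul, map_mul, e, e, hh, hi, map_one, one_mul, mul_one]

theorem mulHom_one_left (x : C) : c.mulHom (1 ⊗ₜ x) = x := by
  have := c.precomp_mulConv (oneTmul k C C) (by ext x; exact c.form_one_left x)
  exact (congrArg (fun f => f.ofConv x) this).trans (one_mul x)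

theorem mulHom_one_right (x : C) : c.mulHom (x ⊗ₜ 1) = x := by
  have := c.precomp_mulConv (tmulOne k C C) (by ext x; exact c.form_one_right x)
  exact (congrArg (fun f => f.ofConv x) this).trans (mul_one x)

end Cocycle

/-- The twist of a bialgebra by a two-cocycle. -/
def Twist {k : Type*} [Field k] {C : Type*} [Ring C] [Bialgebra k C] (_ : Cocycle k C) : Type _ := C

namespace Twist

variable {k : Type*} [Field k] {C : Type*} [Ring C] [Bialgebra k C] {c : Cocycle k C}

noncomputable instance : AddCommGroup (Twist c) := inferInstanceAs (AddCommGroup C)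

noncomputable instance : Module k (Twist c) := inferInstanceAs (Module k C)

variable (c) in
/-- The identity map to the twist. -/
noncomputable def of : C ≃ₗ[k] Twist c := LinearEquiv.refl k C

noncomputable instance : Ring (Twist c) :=
  { (inferInstance : AddCommGroup (Twist c)) with
    mul := fun x y => of c (c.mulHom ((of c).symm x ⊗ₜ (of c).symm y))
    one := of c 1
    left_distrib := fun x y z => (congrArg (of c) (by
      rw [map_add, TensorProduct.tmul_add, map_add])).trans (map_add _ _ _)
    right_distrib := fun x y z => (congrArg (of c) (by
      rw [map_add, TensorProduct.add_tmul, map_add])).trans (map_add _ _ _)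
    zero_mul := fun x => (congrArg (of c) (by
      rw [map_zero, TensorProduct.zero_tmul, map_zero])).trans (map_zero _)
    mul_zero := fun x => (congrArg (of c) (by
      rw [map_zero, TensorProduct.tmul_zero, map_zero])).trans (map_zero _)
    mul_assoc := fun x y z => congrArg (fun f => of c (f (((of c).symm x ⊗ₜ (of c).symm y) ⊗ₜ
      (of c).symm z))) c.mulHom_assoc
    one_mul := fun x => c.mulHom_one_left x
    mul_one := fun x => c.mulHom_one_right x }

theorem of_mul_of (x y : C) : of c x * of c y = of c (c.mulHom (x ⊗ₜ y)) := rfl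

theorem of_one : of c 1 = 1 := rfl

noncomputable instance : Algebra k (Twist c) :=
  Algebra.ofModule
    (fun r x y => (congrArg (of c) (by
      rw [map_smul, ← TensorProduct.smul_tmul', map_smul])).trans (map_smul _ _ _))
    (fun r x y => (congrArg (of c) (by
      rw [map_smul, TensorProduct.tmul_smul, map_smul])).trans (map_smul _ _ _))

noncomputable instance : Coalgebra k (Twist c) := inferInstanceAs (Coalgebra k C)

variable (c) in
/-- The identity map to the twist is an isomorphism of coalgebras. -/
noncomputable def ofCoalg : C ≃ₗc[k] Twist c :=
  { of c with
    counit_comp := rfl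
    map_comp_comul := by
      have : TensorProduct.map (of c).toLinearMap (of c).toLinearMap = LinearMap.id :=
        TensorProduct.map_id
      exact congrArg (fun f => f ∘ₗ comul) this }

end Twist

end Twist

end FRTDouble

namespace FRTDouble

/-! ### The twist is a bialgebra -/

section Twist

open WithConv Coalgebra

namespace Twist

variable {k : Type*} [Field k] {C : Type*} [Ring C] [Bialgebra k C] {c : Cocycle k C}

theorem comul_of (x : C) : comul (R := k) (of c x) =
    TensorProduct.map (of c).toLinearMap (of c).toLinearMap (comul x) :=
  (CoalgHomClass.map_comp_comul_apply (ofCoalg c) x).symm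

/-- The coproduct is unchanged, and the twisted product is a coalgebra map. -/
theorem comul_mulHom (x y : C) : comul (R := k) (of c x * of c y) =
    comul (R := k) (of c x) * comul (R := k) (of c y) := by
  have h := CoalgHomClass.map_comp_comul_apply c.mulHom (x ⊗ₜ[k] y)
  rw [of_mul_of, comul_of, comul_of, comul_of, ← h, TensorProduct.comul_tmul]
  generalize (comul x : C ⊗[k] C) = s
  generalize (comul y : C ⊗[k] C) = t
  induction s with
  | zero => simp
  | add s s' hs hs' => simp only [TensorProduct.add_tmul, map_add, add_mul, hs, hs']
  | tmul a b =>
    induction t with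
    | zero => simp
    | add s s' hs hs' => simp only [TensorProduct.tmul_add, map_add, mul_add, hs, hs']
    | tmul a' b' => simp [of_mul_of]

noncomputable instance : Bialgebra k (Twist c) :=
  Bialgebra.mk' k (Twist c)
    (Bialgebra.counit_one (R := k) (A := C))
    (fun {x y} => by
      refine (LinearMap.congr_fun c.mulHom.counit_comp
        ((of c).symm x ⊗ₜ[k] (of c).symm y)).trans ?_
      exact mul_comm _ _)
    (by
      rw [← of_one, comul_of, Bialgebra.comul_one]
      rfl)
    (fun {x y} => comul_mulHom ((of c).symm x) ((of c).symm y))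

end Twist

end Twist

/-! ### Currying and commuting scalar factors -/

section Slices

open WithConv Coalgebra

variable {k : Type*} [Field k] {C D : Type*} [AddCommMonoid C] [Module k C] [Coalgebra k C]
  [AddCommMonoid D] [Module k D] [Coalgebra k D] {A : Type*} [Ring A] [Algebra k A]

/-- Currying of maps on `C ⊗ D`, with the variable in `D` first. -/
noncomputable def sliceRight (f : WithConv (C ⊗[k] D →ₗ[k] A)) :
    WithConv (D →ₗ[k] WithConv (C →ₗ[k] A)) :=
  toConv
    { toFun := fun y => toConv (f.ofConv ∘ₗ (TensorProduct.mk k C D).flip y)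
      map_add' := fun y z => by ext; simp
      map_smul' := fun r y => by ext; simp }

/-- Currying of maps on `C ⊗ D`, with the variable in `C` first. -/
noncomputable def sliceLeft (f : WithConv (C ⊗[k] D →ₗ[k] A)) :
    WithConv (C →ₗ[k] WithConv (D →ₗ[k] A)) :=
  toConv
    { toFun := fun x => toConv (f.ofConv ∘ₗ TensorProduct.mk k C D x)
      map_add' := fun y z => by ext; simp
      map_smul' := fun r y => by ext; simp }

@[simp] theorem sliceRight_apply (f : WithConv (C ⊗[k] D →ₗ[k] A)) (x : C) (y : D) :
    sliceRight f y x = f (x ⊗ₜ y) := rfl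

@[simp] theorem sliceLeft_apply (f : WithConv (C ⊗[k] D →ₗ[k] A)) (x : C) (y : D) :
    sliceLeft f x y = f (x ⊗ₜ y) := rfl

/-- Convolution on C ⊗ D is convolution on D with values in the convolution algebra of C. -/
theorem sliceRight_mul (f g : WithConv (C ⊗[k] D →ₗ[k] A)) :
    sliceRight (f * g) = sliceRight f * sliceRight g := by
  ext y x
  rw [(ℛ k y).convMul_apply, sliceRight_apply, (reprTmul (ℛ k x) (ℛ k y)).convMul_apply]
  simp only [ofConv_sum, LinearMap.sum_apply, (ℛ k x).convMul_apply, sliceRight_apply]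
  simp only [reprTmul, Finset.sum_product_right]

theorem sliceLeft_mul (f g : WithConv (C ⊗[k] D →ₗ[k] A)) :
    sliceLeft (f * g) = sliceLeft f * sliceLeft g := by
  ext x y
  rw [(ℛ k x).convMul_apply, sliceLeft_apply, (reprTmul (ℛ k x) (ℛ k y)).convMul_apply]
  simp only [ofConv_sum, LinearMap.sum_apply, (ℛ k y).convMul_apply, sliceLeft_apply]
  simp only [reprTmul, Finset.sum_product]

/-- Functions of different tensor factors use different coproducts, so they commute when the values
of one of them are central. -/
theorem scalar_snd_comm_fst (s : WithConv (D →ₗ[k] k)) (f : WithConv (C →ₗ[k] A)) :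
    scalar k _ A (precomp k (sndHom k C D) s) * precomp A (fstHom k C D) f =
      precomp A (fstHom k C D) f * scalar k _ A (precomp k (sndHom k C D) s) := by
  apply WithConv.ext
  refine TensorProduct.ext' fun x y => ?_
  refine (snd_convMul_fst f (scalar k D A s) x y).trans
    (Eq.trans ?_ (fst_convMul_snd f (scalar k D A s) x y).symm)
  exact Algebra.commutes _ _

theorem scalar_fst_comm_snd (s : WithConv (C →ₗ[k] k)) (f : WithConv (D →ₗ[k] A)) :
    scalar k _ A (precomp k (fstHom k C D) s) * precomp A (sndHom k C D) f =
      precomp A (sndHom k C D) f * scalar k _ A (precomp k (fstHom k C D) s) := by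
  apply WithConv.ext
  refine TensorProduct.ext' fun x y => ?_
  refine (fst_convMul_snd (scalar k C A s) f x y).trans
    (Eq.trans ?_ (snd_convMul_fst (scalar k C A s) f x y).symm)
  exact Algebra.commutes _ _

end Slices

/-! ### The Hopf pairing attached to an embedding in the dual -/

section Pairing

open WithConv Coalgebra HopfAlgebra

variable {k : Type u} [Field k] {B H : Type u} [Ring B] [HopfAlgebra k B] [Ring H]
  [HopfAlgebra k H] (θ : DualEmbedding k B H)

namespace DualEmbedding

/-- The pairing `h ⊗ b ↦ ⟨b, h⟩`. -/
noncomputable def pair : WithConv (H ⊗[k] B →ₗ[k] k) :=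
  toConv (TensorProduct.lift (LinearMap.flip
    ((WithConv.linearEquiv k (H →ₗ[k] k)).toLinearMap ∘ₗ θ.toHom.toLinearMap)))

/-- The convolution inverse `h ⊗ b ↦ ⟨S b, h⟩` of the pairing. -/
noncomputable def pairInv : WithConv (H ⊗[k] B →ₗ[k] k) :=
  toConv (θ.pair.ofConv ∘ₗ (antipode k).lTensor H)

@[simp] theorem pair_tmul (h : H) (b : B) : θ.pair (h ⊗ₜ b) = θ.toHom b h := rfl

theorem sliceRight_pairInv :
    sliceRight θ.pairInv = postcomp B θ.toHom (toConv (antipode k)) := rfl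

theorem sliceRight_injective {C D A : Type*} [AddCommMonoid C] [Module k C] [Coalgebra k C]
    [AddCommMonoid D] [Module k D] [Coalgebra k D] [Ring A] [Algebra k A] :
    Function.Injective (sliceRight (k := k) (C := C) (D := D) (A := A)) := by
  intro f g h
  apply WithConv.ext
  refine TensorProduct.ext' fun x y => ?_
  rw [← sliceRight_apply, h, sliceRight_apply]

theorem sliceRight_one {C D A : Type*} [AddCommMonoid C] [Module k C] [Coalgebra k C]
    [AddCommMonoid D] [Module k D] [Coalgebra k D] [Ring A] [Algebra k A] :
    sliceRight (1 : WithConv (C ⊗[k] D →ₗ[k] A)) = 1 := by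
  ext y x
  simp [Algebra.smul_def]

/-- Curried, the pairing is θ composed with the identity and its inverse is θ composed with the
antipode; θ carries the antipode axiom over. -/
theorem pair_mul_pairInv : θ.pair * θ.pairInv = 1 := by
  apply sliceRight_injective
  have : sliceRight θ.pair = postcomp B θ.toHom (toConv LinearMap.id) := rfl
  rw [sliceRight_mul, sliceRight_pairInv, this, ← map_mul, LinearMap.id_mul_antipode, map_one,
    sliceRight_one]

theorem pairInv_mul_pair : θ.pairInv * θ.pair = 1 := by
  apply sliceRight_injective
  have : sliceRight θ.pair = postcomp B θ.toHom (toConv LinearMap.id) := rfl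
  rw [sliceRight_mul, sliceRight_pairInv, this, ← map_mul, LinearMap.antipode_mul_id, map_one,
    sliceRight_one]

/-- `⟨b, h h'⟩ = ∑ ⟨b₁, h'⟩ ⟨b₂, h⟩`. -/
theorem precomp_mul_pair :
    precomp k (Coalgebra.TensorProduct.map (Bialgebra.mulCoalgHom k H) (CoalgHom.id k B)) θ.pair =
      precomp k (Coalgebra.TensorProduct.map (sndHom k H H) (CoalgHom.id k B)) θ.pair *
        precomp k (Coalgebra.TensorProduct.map (fstHom k H H) (CoalgHom.id k B)) θ.pair := by
  apply sliceRight_injective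
  rw [sliceRight_mul]
  apply WithConv.ext
  refine LinearMap.ext fun b => WithConv.ext (TensorProduct.ext' fun x y => ?_)
  have e := θ.map_comul b x y
  rw [← (ℛ k b).eq] at e
  simp only [map_sum, evalAt₂_tmul, evalAt_apply] at e
  refine e.trans ?_
  rw [(ℛ k b).convMul_apply]
  simp only [ofConv_sum, LinearMap.sum_apply]
  refine Finset.sum_congr rfl fun i _ => ?_
  exact (snd_convMul_fst (θ.toHom ((ℛ k b).right i)) (θ.toHom ((ℛ k b).left i)) x y).symm

/-- `⟨b b', h⟩ = ∑ ⟨b, h₁⟩ ⟨b', h₂⟩`. -/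
theorem precomp_pair_mul :
    precomp k (Coalgebra.TensorProduct.map (CoalgHom.id k H) (Bialgebra.mulCoalgHom k B)) θ.pair =
      precomp k (Coalgebra.TensorProduct.map (CoalgHom.id k H) (fstHom k B B)) θ.pair *
        precomp k (Coalgebra.TensorProduct.map (CoalgHom.id k H) (sndHom k B B)) θ.pair := by
  have inj : ∀ f g : WithConv (H ⊗[k] (B ⊗[k] B) →ₗ[k] k), sliceLeft f = sliceLeft g → f = g := by
    intro f g h
    apply WithConv.ext
    refine TensorProduct.ext' fun x y => ?_
    rw [← sliceLeft_apply, h, sliceLeft_apply]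
  apply inj
  rw [sliceLeft_mul]
  apply WithConv.ext
  refine LinearMap.ext fun h => WithConv.ext (TensorProduct.ext' fun b b' => ?_)
  have e : θ.toHom (b * b') h = ∑ i ∈ (ℛ k h).index,
      θ.toHom b ((ℛ k h).left i) * θ.toHom b' ((ℛ k h).right i) := by
    rw [map_mul, (ℛ k h).convMul_apply]
  refine e.trans ?_
  rw [(ℛ k h).convMul_apply]
  simp only [ofConv_sum, LinearMap.sum_apply]
  refine Finset.sum_congr rfl fun i _ => ?_
  exact (fst_convMul_snd (sliceLeft θ.pair ((ℛ k h).left i)) (sliceLeft θ.pair ((ℛ k h).right i))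
    b b').symm

end DualEmbedding

end Pairing

end FRTDouble

namespace FRTDouble

/-! ### The two-cocycle on the tensor product -/

section Double

open WithConv Coalgebra HopfAlgebra

variable {k : Type u} [Field k] {B H : Type u} [Ring B] [HopfAlgebra k B] [Ring H]
  [HopfAlgebra k H] (θ : DualEmbedding k B H)

namespace DualEmbedding

variable (k B H) in
/-- The coalgebra map `(u ⊗ w) ⊗ (u' ⊗ w') ↦ ε(u) ε(w') w ⊗ u'`. -/
noncomputable def middle : (B ⊗[k] H) ⊗[k] (B ⊗[k] H) →ₗc[k] H ⊗[k] B :=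
  Coalgebra.TensorProduct.map (sndHom k B H) (fstHom k B H)

@[simp] theorem middle_tmul (u u' : B) (w w' : H) : middle k B H ((u ⊗ₜ w) ⊗ₜ (u' ⊗ₜ w')) =
    (counit (R := k) u • w) ⊗ₜ (counit (R := k) w' • u') := rfl

theorem ext_six {Y : Type*} [AddCommMonoid Y] [Module k Y]
    {f g : ((B ⊗[k] H) ⊗[k] (B ⊗[k] H)) ⊗[k] (B ⊗[k] H) →ₗ[k] Y}
    (h : ∀ u w u' w' u'' w'', f (((u ⊗ₜ w) ⊗ₜ (u' ⊗ₜ w')) ⊗ₜ (u'' ⊗ₜ w'')) =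
      g (((u ⊗ₜ w) ⊗ₜ (u' ⊗ₜ w')) ⊗ₜ (u'' ⊗ₜ w''))) : f = g := by
  ext u w u' w' u'' w''
  exact h u w u' w' u'' w''

theorem precomp_ext_six {Y : Type*} [AddCommMonoid Y] [Module k Y] [Coalgebra k Y]
    {f g : ((B ⊗[k] H) ⊗[k] (B ⊗[k] H)) ⊗[k] (B ⊗[k] H) →ₗc[k] Y}
    (h : ∀ u w u' w' u'' w'', f (((u ⊗ₜ w) ⊗ₜ (u' ⊗ₜ w')) ⊗ₜ (u'' ⊗ₜ w'')) =
      g (((u ⊗ₜ w) ⊗ₜ (u' ⊗ₜ w')) ⊗ₜ (u'' ⊗ₜ w''))) (a : WithConv (Y →ₗ[k] k)) :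
    precomp (D := ((B ⊗[k] H) ⊗[k] (B ⊗[k] H)) ⊗[k] (B ⊗[k] H)) k f a =
      precomp (D := ((B ⊗[k] H) ⊗[k] (B ⊗[k] H)) ⊗[k] (B ⊗[k] H)) k g a := by
  have : f.toLinearMap = g.toLinearMap := ext_six h
  apply WithConv.ext
  exact congrArg (fun l => a.ofConv ∘ₗ l) this

variable (k B H) in
/-- `((u ⊗ w) ⊗ (u' ⊗ w')) ⊗ (u'' ⊗ w'') ↦ ε(u) ε(w'') (w ⊗ u') ⊗ (w' ⊗ u'')`. -/
noncomputable def twoMiddles :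
    ((B ⊗[k] H) ⊗[k] (B ⊗[k] H)) ⊗[k] (B ⊗[k] H) →ₗc[k] (H ⊗[k] B) ⊗[k] (H ⊗[k] B) :=
  ((Coalgebra.TensorProduct.map
    (Coalgebra.TensorProduct.map (sndHom k B H) (CoalgHom.id k B))
    (Coalgebra.TensorProduct.map (CoalgHom.id k H) (fstHom k B H))).comp
  (Coalgebra.TensorProduct.assoc k k ((B ⊗[k] H) ⊗[k] B) H (B ⊗[k] H) :
    (((B ⊗[k] H) ⊗[k] B) ⊗[k] H) ⊗[k] (B ⊗[k] H) →ₗc[k] _)).comp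
  (Coalgebra.TensorProduct.map
    ((Coalgebra.TensorProduct.assoc k k (B ⊗[k] H) B H).symm :
      (B ⊗[k] H) ⊗[k] (B ⊗[k] H) →ₗc[k] ((B ⊗[k] H) ⊗[k] B) ⊗[k] H) (CoalgHom.id k (B ⊗[k] H)))

@[simp] theorem twoMiddles_tmul (u u' u'' : B) (w w' w'' : H) :
    twoMiddles k B H (((u ⊗ₜ w) ⊗ₜ (u' ⊗ₜ w')) ⊗ₜ (u'' ⊗ₜ w'')) =
      ((counit (R := k) u • w) ⊗ₜ u') ⊗ₜ (w' ⊗ₜ (counit (R := k) w'' • u'')) := rfl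

variable (k B H) in
/-- `((u ⊗ w) ⊗ (u' ⊗ w')) ⊗ (u'' ⊗ w'') ↦ ε(u) ε(u') ε(w') ε(w'') w ⊗ u''`. -/
noncomputable def outerMiddle :
    ((B ⊗[k] H) ⊗[k] (B ⊗[k] H)) ⊗[k] (B ⊗[k] H) →ₗc[k] H ⊗[k] B :=
  (middle k B H).comp (Coalgebra.TensorProduct.map
    (fstHom k (B ⊗[k] H) (B ⊗[k] H)) (CoalgHom.id k (B ⊗[k] H)))

@[simp] theorem outerMiddle_tmul (u u' u'' : B) (w w' w'' : H) :
    outerMiddle k B H (((u ⊗ₜ w) ⊗ₜ (u' ⊗ₜ w')) ⊗ₜ (u'' ⊗ₜ w'')) =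
      middle k B H ((counit (R := k) (u' ⊗ₜ[k] w') • (u ⊗ₜ[k] w)) ⊗ₜ (u'' ⊗ₜ w'')) := rfl

/-- For arguments u ⊗ w, u' ⊗ w', u'' ⊗ w'', the pairing of u'' with ww' splits into the pairing
with w' followed by that with w. -/
theorem cocycle_left :
    precomp k (Coalgebra.TensorProduct.map (Bialgebra.mulCoalgHom k (B ⊗[k] H))
      (CoalgHom.id k (B ⊗[k] H))) (precomp k (middle k B H) θ.pair) =
    precomp k ((sndHom k (H ⊗[k] B) (H ⊗[k] B)).comp (twoMiddles k B H)) θ.pair *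
      precomp k (outerMiddle k B H) θ.pair := by
  let t := Coalgebra.TensorProduct.map (Coalgebra.TensorProduct.map (sndHom k B H) (sndHom k B H))
    (fstHom k B H)
  rw [precomp_precomp]
  refine (precomp_ext_six
    (g := (Coalgebra.TensorProduct.map (Bialgebra.mulCoalgHom k H) (CoalgHom.id k B)).comp t)
    ?_ θ.pair).trans ?_
  · intro u w u' w' u'' w''
    simp [t, smul_smul, mul_comm, TensorProduct.smul_tmul']
  · refine (congrArg (precomp k t) θ.precomp_mul_pair).trans ?_
    rw [map_mul]
    congr 1
    · refine precomp_ext_six (f := (Coalgebra.TensorProduct.map (sndHom k H H)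
        (CoalgHom.id k B)).comp t) ?_ θ.pair
      intro u w u' w' u'' w''
      simp [t, smul_smul, mul_comm, mul_assoc, mul_left_comm, TensorProduct.smul_tmul',
        TensorProduct.tmul_smul]
    · refine precomp_ext_six (f := (Coalgebra.TensorProduct.map (fstHom k H H)
        (CoalgHom.id k B)).comp t) ?_ θ.pair
      intro u w u' w' u'' w''
      simp [t, smul_smul, mul_comm, mul_assoc, mul_left_comm, TensorProduct.smul_tmul', TensorProduct.tmul_smul]

/-- Dually, the pairing of u'u'' with w splits into the pairing of u' followed by that of u''. The
last factor is the same as in `cocycle_left`. -/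
theorem cocycle_right :
    precomp k (assocHom k (B ⊗[k] H)) (precomp k (Coalgebra.TensorProduct.map
      (CoalgHom.id k (B ⊗[k] H)) (Bialgebra.mulCoalgHom k (B ⊗[k] H)))
      (precomp k (middle k B H) θ.pair)) =
    precomp k ((fstHom k (H ⊗[k] B) (H ⊗[k] B)).comp (twoMiddles k B H)) θ.pair *
      precomp k (outerMiddle k B H) θ.pair := by
  let t := (Coalgebra.TensorProduct.map (sndHom k B H)
    (Coalgebra.TensorProduct.map (fstHom k B H) (fstHom k B H))).comp (assocHom k (B ⊗[k] H))
  rw [precomp_precomp, precomp_precomp]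
  refine (precomp_ext_six (f := ((middle k B H).comp (Coalgebra.TensorProduct.map
    (CoalgHom.id k (B ⊗[k] H)) (Bialgebra.mulCoalgHom k (B ⊗[k] H)))).comp (assocHom k (B ⊗[k] H)))
    (g := (Coalgebra.TensorProduct.map (CoalgHom.id k H) (Bialgebra.mulCoalgHom k B)).comp t)
    ?_ θ.pair).trans ?_
  · intro u w u' w' u'' w''
    simp [t, smul_smul, mul_comm, TensorProduct.smul_tmul']
  · refine (congrArg (precomp k t) θ.precomp_pair_mul).trans ?_
    rw [map_mul]
    congr 1
    · refine precomp_ext_six (f := (Coalgebra.TensorProduct.map (CoalgHom.id k H)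
        (fstHom k B B)).comp t) ?_ θ.pair
      intro u w u' w' u'' w''
      simp [t, smul_smul, mul_comm, TensorProduct.smul_tmul', TensorProduct.tmul_smul]
    · refine precomp_ext_six (f := (Coalgebra.TensorProduct.map (CoalgHom.id k H)
        (sndHom k B B)).comp t) ?_ θ.pair
      intro u w u' w' u'' w''
      simp [t, smul_smul, mul_comm, mul_left_comm, TensorProduct.smul_tmul', TensorProduct.tmul_smul]

/-- The two-cocycle `(u ⊗ w, u' ⊗ w') ↦ ε(u) ⟨u', w⟩ ε(w')` on `B ⊗ H`. -/
noncomputable def cocycle : Cocycle k (B ⊗[k] H) where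
  form := precomp k (middle k B H) θ.pair
  inv := precomp k (middle k B H) θ.pairInv
  form_mul_inv := by rw [← map_mul, θ.pair_mul_pairInv, map_one]
  inv_mul_form := by rw [← map_mul, θ.pairInv_mul_pair, map_one]
  form_one_left x := by
    induction x with
    | zero => simp
    | add x y hx hy => rw [TensorProduct.tmul_add, map_add, hx, hy, map_add]
    | tmul u w =>
      rw [Algebra.TensorProduct.one_def]
      simp [θ.map_counit, mul_comm]
  form_one_right x := by
    induction x with
    | zero => simp
    | add x y hx hy => rw [TensorProduct.add_tmul, map_add, hx, hy, map_add]
    | tmul u w =>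
      rw [Algebra.TensorProduct.one_def]
      simp [mul_comm]
  cocycle := by
    refine Eq.trans ?_ (map_mul (precomp k (assocHom k (B ⊗[k] H))) _ _).symm
    rw [cocycle_left, cocycle_right]
    have e1 : precomp k (fstHom k ((B ⊗[k] H) ⊗[k] (B ⊗[k] H)) (B ⊗[k] H))
        (precomp k (middle k B H) θ.pair) =
        precomp k ((fstHom k (H ⊗[k] B) (H ⊗[k] B)).comp (twoMiddles k B H)) θ.pair := by
      refine precomp_ext_six (f := (middle k B H).comp
        (fstHom k ((B ⊗[k] H) ⊗[k] (B ⊗[k] H)) (B ⊗[k] H))) ?_ θ.pair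
      intro u w u' w' u'' w''
      simp [smul_smul, mul_comm, mul_left_comm, TensorProduct.smul_tmul', TensorProduct.tmul_smul]
    have e2 : precomp k (assocHom k (B ⊗[k] H))
        (precomp k (sndHom k (B ⊗[k] H) ((B ⊗[k] H) ⊗[k] (B ⊗[k] H)))
        (precomp k (middle k B H) θ.pair)) =
        precomp k ((sndHom k (H ⊗[k] B) (H ⊗[k] B)).comp (twoMiddles k B H)) θ.pair := by
      refine precomp_ext_six (f := ((middle k B H).comp
        (sndHom k (B ⊗[k] H) ((B ⊗[k] H) ⊗[k] (B ⊗[k] H)))).comp (assocHom k (B ⊗[k] H))) ?_ θ.pair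
      intro u w u' w' u'' w''
      simp [smul_smul, mul_comm, mul_left_comm, TensorProduct.smul_tmul', TensorProduct.tmul_smul]
    rw [e1, e2, ← mul_assoc, ← mul_assoc]
    congr 1
    -- The remaining factors pair w with u' and w' with u''; they involve disjoint variables, hence
    -- commute.
    have := (congrArg (precomp k (twoMiddles k B H))
      (scalar_snd_comm_fst (A := k) (C := H ⊗[k] B) (D := H ⊗[k] B) θ.pair θ.pair)).symm
    rw [map_mul, map_mul] at this
    exact this

end DualEmbedding

end Double

end FRTDouble

namespace FRTDouble

/-! ### The two actions of functionals on a Hopf algebra -/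

section Hit

open WithConv Coalgebra HopfAlgebra

variable {k : Type u} [Field k] {B H : Type u} [Ring B] [HopfAlgebra k B] [Ring H]
  [HopfAlgebra k H] {A : Type*} [Ring A] [Algebra k A]

theorem hitLeft_eq (f : ConvDual k H) (x : H) {ι : Type*} (r : Repr k x ι) :
    hitLeft f x = ∑ i ∈ r.index, f (r.right i) • r.left i := by
  simp [hitLeft, ← r.eq]

theorem hitRight_eq (f : ConvDual k H) (x : H) {ι : Type*} (r : Repr k x ι) :
    hitRight f x = ∑ i ∈ r.index, f (r.left i) • r.right i := by
  simp [hitRight, ← r.eq]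

theorem convMul_scalar_eq_hitLeft (l : WithConv (H →ₗ[k] A)) (g : ConvDual k H) (x : H) :
    (l * scalar k H A g) x = l (hitLeft g x) := by
  rw [convMul_scalar_apply _ _ _ (ℛ k x), hitLeft_eq g x (ℛ k x), map_sum]
  simp

theorem scalar_convMul_eq_hitRight (l : WithConv (H →ₗ[k] A)) (f : ConvDual k H) (x : H) :
    (scalar k H A f * l) x = l (hitRight f x) := by
  rw [scalar_convMul_apply _ _ _ (ℛ k x), hitRight_eq f x (ℛ k x), map_sum]
  simp

/-- The target is the co-opposite of the dual, so the antipode of B becomes the transpose of S⁻¹: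
put x = S(y) in the compatibility with antipodes. -/
theorem DualEmbedding.map_antipode_eq (θ : DualEmbedding k B H)
    (hS : Function.Bijective (antipode k (A := H))) (b : B) :
    θ.toHom (antipode k b) = antipodeInv hS (θ.toHom b) := by
  ext x
  obtain ⟨y, rfl⟩ := hS.2 x
  rw [θ.map_antipode]
  have : (LinearEquiv.ofBijective _ hS).symm (antipode k y) = y :=
    (LinearEquiv.ofBijective _ hS).symm_apply_apply y
  exact congrArg (θ.toHom b) this.symm

end Hit

/-! ### The double crossproduct as a twist: product formula and antipode -/

section Double

open WithConv Coalgebra HopfAlgebra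
open Cocycle (oneTmul tmulOne)

variable {k : Type u} [Field k] {B H : Type u} [Ring B] [HopfAlgebra k B] [Ring H]
  [HopfAlgebra k H] (θ : DualEmbedding k B H)

namespace DualEmbedding

variable (k B H) in
/-- The rebracketing `(u ⊗ w) ⊗ (u' ⊗ w') ↦ u ⊗ ((w ⊗ u') ⊗ w')`. -/
noncomputable def rebracket : (B ⊗[k] H) ⊗[k] (B ⊗[k] H) →ₗc[k] B ⊗[k] ((H ⊗[k] B) ⊗[k] H) :=
  (Coalgebra.TensorProduct.map (CoalgHom.id k B)
    ((Coalgebra.TensorProduct.assoc k k H B H).symm :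
      H ⊗[k] (B ⊗[k] H) →ₗc[k] (H ⊗[k] B) ⊗[k] H)).comp
    (Coalgebra.TensorProduct.assoc k k B H (B ⊗[k] H) :
      (B ⊗[k] H) ⊗[k] (B ⊗[k] H) →ₗc[k] B ⊗[k] (H ⊗[k] (B ⊗[k] H)))

@[simp] theorem rebracket_tmul (u u' : B) (w w' : H) :
    rebracket k B H ((u ⊗ₜ w) ⊗ₜ (u' ⊗ₜ w')) = u ⊗ₜ ((w ⊗ₜ u') ⊗ₜ w') := rfl

section Legs

variable {A : Type*} [Ring A] [Algebra k A]

/-- The map `(u ⊗ w) ⊗ (u' ⊗ w') ↦ f(u) ε(w) ε(u') ε(w')`. -/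
noncomputable def outerLeft (f : WithConv (B →ₗ[k] A)) :
    WithConv ((B ⊗[k] H) ⊗[k] (B ⊗[k] H) →ₗ[k] A) :=
  precomp A (rebracket k B H) (precomp A (fstHom k B ((H ⊗[k] B) ⊗[k] H)) f)

/-- The map `(u ⊗ w) ⊗ (u' ⊗ w') ↦ ε(u) f(w ⊗ u') ε(w')`. -/
noncomputable def inner (f : WithConv (H ⊗[k] B →ₗ[k] A)) :
    WithConv ((B ⊗[k] H) ⊗[k] (B ⊗[k] H) →ₗ[k] A) :=
  precomp A (rebracket k B H) (precomp A (sndHom k B ((H ⊗[k] B) ⊗[k] H))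
    (precomp A (fstHom k (H ⊗[k] B) H) f))

/-- The map `(u ⊗ w) ⊗ (u' ⊗ w') ↦ ε(u) ε(w) ε(u') f(w')`. -/
noncomputable def outerRight (f : WithConv (H →ₗ[k] A)) :
    WithConv ((B ⊗[k] H) ⊗[k] (B ⊗[k] H) →ₗ[k] A) :=
  precomp A (rebracket k B H) (precomp A (sndHom k B ((H ⊗[k] B) ⊗[k] H))
    (precomp A (sndHom k (H ⊗[k] B) H) f))

theorem inner_mul (f g : WithConv (H ⊗[k] B →ₗ[k] A)) : inner (f * g) = inner f * inner g := by
  simp only [inner, map_mul]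

theorem inner_one : inner (1 : WithConv (H ⊗[k] B →ₗ[k] A)) = 1 := by
  simp only [inner, map_one]

/-- After rebracketing, u, w ⊗ u' and w' are three independent variables, so the convolution product
is the product of the values. -/
theorem legs_apply (f : WithConv (B →ₗ[k] A)) (g : WithConv (H ⊗[k] B →ₗ[k] A))
    (h : WithConv (H →ₗ[k] A)) (u u' : B) (w w' : H) :
    (outerLeft f * (inner g * outerRight h) :
      WithConv ((B ⊗[k] H) ⊗[k] (B ⊗[k] H) →ₗ[k] A)) ((u ⊗ₜ w) ⊗ₜ (u' ⊗ₜ w')) =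
      f u * (g (w ⊗ₜ u') * h w') := by
  have e : outerLeft f * (inner g * outerRight h) = precomp A (rebracket k B H)
      (precomp A (fstHom k B ((H ⊗[k] B) ⊗[k] H)) f * precomp A (sndHom k B ((H ⊗[k] B) ⊗[k] H))
        (precomp A (fstHom k (H ⊗[k] B) H) g * precomp A (sndHom k (H ⊗[k] B) H) h)) := by
    simp only [map_mul]
    rfl
  rw [e, precomp_apply, rebracket_tmul, fst_convMul_snd, fst_convMul_snd]

theorem inner_scalar_comm_outerLeft (s : WithConv (H ⊗[k] B →ₗ[k] k)) (f : WithConv (B →ₗ[k] A)) :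
    inner (scalar k _ A s) * outerLeft f = outerLeft f * inner (H := H) (scalar k _ A s) := by
  have := congrArg (precomp A (rebracket k B H)) (scalar_snd_comm_fst
    (precomp k (fstHom k (H ⊗[k] B) H) s) f)
  rw [map_mul, map_mul] at this
  exact this

theorem inner_scalar_comm_outerRight (s : WithConv (H ⊗[k] B →ₗ[k] k))
    (f : WithConv (H →ₗ[k] A)) :
    inner (scalar k _ A s) * outerRight f = outerRight f * inner (B := B) (scalar k _ A s) := by
  have := congrArg (fun l => precomp A (rebracket k B H)
    (precomp A (sndHom k B ((H ⊗[k] B) ⊗[k] H)) l)) (scalar_fst_comm_snd s f)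
  simp only [map_mul] at this
  exact this

theorem inner_scalar (s : WithConv (H ⊗[k] B →ₗ[k] k)) :
    inner (scalar k _ A s) = scalar k _ A (precomp k (middle k B H) s) := by
  apply WithConv.ext
  ext u w u' w'
  change algebraMap k A _ = algebraMap k A _
  simp [smul_smul, mul_comm, TensorProduct.smul_tmul', TensorProduct.tmul_smul]

end Legs

/-- The maps `w ⊗ u ↦ u ⊗ w`, twisted by the pairing. -/
noncomputable def braid : WithConv (H ⊗[k] B →ₗ[k] B ⊗[k] H) :=
  scalar k _ _ θ.pair * (toConv (TensorProduct.comm k H B).toLinearMap * scalar k _ _ θ.pairInv)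

/-- The cocycle involves only the inner factors w and u'. Its scalars commute past the outer legs,
and the twist is confined to the exchange of w and u'. -/
theorem mulConv_eq : θ.cocycle.mulConv = outerLeft (toConv (tmulOne k B H).toLinearMap) *
    (inner θ.braid * outerRight (toConv (oneTmul k B H).toLinearMap)) := by
  have e : toConv (LinearMap.mul' k (B ⊗[k] H)) =
      outerLeft (toConv (tmulOne k B H).toLinearMap) *
      (inner (toConv (TensorProduct.comm k H B).toLinearMap) *
        outerRight (toConv (oneTmul k B H).toLinearMap)) := by
    apply WithConv.ext
    refine TensorProduct.ext (TensorProduct.ext' fun u w => ?_)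
    refine TensorProduct.ext' fun u' w' => ?_
    refine Eq.trans ?_ (legs_apply _ _ _ u u' w w').symm
    change _ = (u ⊗ₜ[k] (1 : H)) * ((u' ⊗ₜ[k] w) * ((1 : B) ⊗ₜ[k] w'))
    simp
  have e1 : scalar k _ (B ⊗[k] H) θ.cocycle.form = inner (scalar k _ _ θ.pair) :=
    (inner_scalar θ.pair).symm
  have e2 : scalar k _ (B ⊗[k] H) θ.cocycle.inv = inner (scalar k _ _ θ.pairInv) :=
    (inner_scalar θ.pairInv).symm
  rw [Cocycle.mulConv, e, e1, e2, braid, inner_mul, inner_mul, ← mul_assoc (inner _),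
    inner_scalar_comm_outerLeft]
  simp only [mul_assoc, ← inner_scalar_comm_outerRight]

/-- Curried in B, a threefold convolution runs along the iterated coproduct of p. The outer legs act
on h, p₃ through θ and p₁ through θ and S⁻¹, and p₂ is left in place. -/
theorem braid_apply (hS : Function.Bijective (antipode k (A := H))) (h : H) (p : B) (m : ℕ)
    (p₁ p₂ p₃ : Fin m → B) (hp : (comul (R := k) (A := B)).lTensor B (comul p) =
      ∑ i, p₃ i ⊗ₜ[k] (p₂ i ⊗ₜ[k] p₁ i)) :
    θ.braid (h ⊗ₜ p) = ∑ i, p₂ i ⊗ₜ[k]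
      hitLeft (antipodeInv hS (θ.toHom (p₁ i))) (hitRight (θ.toHom (p₃ i)) h) := by
  have key : ∀ a b c : WithConv (B →ₗ[k] WithConv (H →ₗ[k] B ⊗[k] H)),
      (a * (b * c)) p = ∑ i, a (p₃ i) * (b (p₂ i) * c (p₁ i)) := by
    intro a b c
    have : (a * (b * c)) p = LinearMap.mul' k _ (TensorProduct.map a.ofConv
      (LinearMap.mul' k _ ∘ₗ TensorProduct.map b.ofConv c.ofConv)
        ((comul (R := k) (A := B)).lTensor B (comul p))) := by
      rw [LinearMap.convMul_apply]
      generalize (comul p : B ⊗[k] B) = t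
      induction t with
      | zero => simp
      | add s t hs ht => simp only [map_add, hs, ht]
      | tmul x y => simp
    rw [this, hp]
    simp
  have : θ.braid (h ⊗ₜ p) = sliceRight θ.braid p h := rfl
  rw [this, braid, sliceRight_mul, sliceRight_mul, key, ofConv_sum, LinearMap.sum_apply]
  refine Finset.sum_congr rfl fun i _ => ?_
  have e1 : sliceRight (scalar k _ (B ⊗[k] H) θ.pair) (p₃ i) =
    scalar k H (B ⊗[k] H) (θ.toHom (p₃ i)) := rfl
  have e3 : sliceRight (scalar k _ (B ⊗[k] H) θ.pairInv) (p₁ i) =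
    scalar k H (B ⊗[k] H) (θ.toHom (antipode k (p₁ i))) := rfl
  have e2 : sliceRight (toConv (TensorProduct.comm k H B).toLinearMap) (p₂ i) =
    toConv (TensorProduct.mk k B H (p₂ i)) := rfl
  rw [e1, e2, e3, scalar_convMul_eq_hitRight, convMul_scalar_eq_hitLeft, θ.map_antipode_eq hS]
  rfl

theorem mulHom_eq (hS : Function.Bijective (antipode k (A := H))) (p p' : B) (h h' : H) (m : ℕ)
    (p₁ p₂ p₃ : Fin m → B) (hp : (comul (R := k) (A := B)).lTensor B (comul p') =
      ∑ i, p₃ i ⊗ₜ[k] (p₂ i ⊗ₜ[k] p₁ i)) :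
    θ.cocycle.mulHom ((p ⊗ₜ h) ⊗ₜ (p' ⊗ₜ h')) = ∑ i, (p * p₂ i) ⊗ₜ[k]
      (hitLeft (antipodeInv hS (θ.toHom (p₁ i))) (hitRight (θ.toHom (p₃ i)) h) * h') := by
  rw [Cocycle.mulHom_apply, mulConv_eq, legs_apply, θ.braid_apply hS h p' m p₁ p₂ p₃ hp]
  change (p ⊗ₜ[k] (1 : H)) * (_ * ((1 : B) ⊗ₜ[k] h')) = _
  simp [Finset.mul_sum, Finset.sum_mul]

theorem mulHom_comp {D : Type*} [AddCommMonoid D] [Module k D] [Coalgebra k D]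
    (h : D →ₗc[k] (B ⊗[k] H) ⊗[k] (B ⊗[k] H))
    (hh : precomp k h (precomp k (middle k B H) θ.pair) = 1) (x : D) :
    θ.cocycle.mulHom (h x) = LinearMap.mul' k _ (h x) :=
  congrArg (fun f => f.ofConv x) (θ.cocycle.precomp_mulConv h hh)

/-- The embedding of `B` in the double. -/
noncomputable def inclLeft : B →ₐ[k] Twist θ.cocycle :=
  AlgHom.ofLinearMap ((Twist.of θ.cocycle).toLinearMap ∘ₗ (tmulOne k B H).toLinearMap) rfl
    (fun x y => by
      refine Eq.trans ?_ (congrArg (Twist.of θ.cocycle) (θ.mulHom_comp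
        (Coalgebra.TensorProduct.map (tmulOne k B H) (tmulOne k B H)) ?_ (x ⊗ₜ y)).symm)
      · change Twist.of θ.cocycle ((x * y) ⊗ₜ[k] (1 : H)) =
          Twist.of θ.cocycle ((x ⊗ₜ[k] (1 : H)) * (y ⊗ₜ[k] (1 : H)))
        simp
      · apply WithConv.ext
        ext u v
        simp [θ.map_counit, mul_comm])

/-- The embedding of `H` in the double. -/
noncomputable def inclRight : H →ₐ[k] Twist θ.cocycle :=
  AlgHom.ofLinearMap ((Twist.of θ.cocycle).toLinearMap ∘ₗ (oneTmul k B H).toLinearMap) rfl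
    (fun x y => by
      refine Eq.trans ?_ (congrArg (Twist.of θ.cocycle) (θ.mulHom_comp
        (Coalgebra.TensorProduct.map (oneTmul k B H) (oneTmul k B H)) ?_ (x ⊗ₜ y)).symm)
      · change Twist.of θ.cocycle ((1 : B) ⊗ₜ[k] (x * y)) =
          Twist.of θ.cocycle (((1 : B) ⊗ₜ[k] x) * ((1 : B) ⊗ₜ[k] y))
        simp
      · apply WithConv.ext
        ext u v
        simp [mul_comm])

/-- The inner factors of (u ⊗ 1)(1 ⊗ w) are both 1, so the cocycle is trivial there. -/
theorem inclLeft_mul_inclRight (u : B) (w : H) :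
    θ.inclLeft u * θ.inclRight w = Twist.of θ.cocycle (u ⊗ₜ w) := by
  refine (congrArg (Twist.of θ.cocycle) (θ.mulHom_comp
    (Coalgebra.TensorProduct.map (tmulOne k B H) (oneTmul k B H)) ?_ (u ⊗ₜ w))).trans ?_
  · apply WithConv.ext
    ext u v
    simp
  · change Twist.of θ.cocycle ((u ⊗ₜ[k] (1 : H)) * ((1 : B) ⊗ₜ[k] w)) = _
    simp

theorem isUnit_toConv_of_algHom {A : Type*} [Ring A] [Algebra k A] (f : H →ₐ[k] A) :
    IsUnit (toConv f.toLinearMap) := by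
  have : toConv f.toLinearMap = postcomp H f (toConv LinearMap.id) := rfl
  rw [this]
  exact (isUnit_iff_exists.2 ⟨toConv (antipode k), LinearMap.id_mul_antipode,
    LinearMap.antipode_mul_id⟩).map _

/-- The identity is the convolution product of the two embeddings, each pulled back from its tensor
factor. An algebra map out of a Hopf algebra is convolution invertible by composition with the
antipode, so both factors are units. -/
theorem isUnit_toConv_id_twist :
    IsUnit (toConv (LinearMap.id : Twist θ.cocycle →ₗ[k] Twist θ.cocycle)) := by
  have e : toConv (Twist.of θ.cocycle).toLinearMap =
      precomp _ (fstHom k B H) (toConv θ.inclLeft.toLinearMap) *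
        precomp _ (sndHom k B H) (toConv θ.inclRight.toLinearMap) := by
    apply WithConv.ext
    refine TensorProduct.ext' fun u w => ?_
    have h := fst_convMul_snd (toConv θ.inclLeft.toLinearMap) (toConv θ.inclRight.toLinearMap) u w
    refine Eq.trans ?_ h.symm
    exact (θ.inclLeft_mul_inclRight u w).symm
  have : toConv (LinearMap.id : Twist θ.cocycle →ₗ[k] Twist θ.cocycle) =
    precomp (Twist θ.cocycle)
      ((Twist.ofCoalg θ.cocycle).symm : Twist θ.cocycle →ₗc[k] B ⊗[k] H)
      (toConv (Twist.of θ.cocycle).toLinearMap) := by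
    apply WithConv.ext
    ext x
    rfl
  rw [this, e, map_mul]
  exact (((isUnit_toConv_of_algHom θ.inclLeft).map _).map _).mul
    (((isUnit_toConv_of_algHom θ.inclRight).map _).map _)

noncomputable instance : HopfAlgebra k (Twist θ.cocycle) :=
  .ofConvInverse (isUnit_iff_exists.1 θ.isUnit_toConv_id_twist).choose.ofConv
    (isUnit_iff_exists.1 θ.isUnit_toConv_id_twist).choose_spec.2
    (isUnit_iff_exists.1 θ.isUnit_toConv_id_twist).choose_spec.1

/-- The double crossproduct as a twist of the tensor product. -/
noncomputable def doubleCross (hS : Function.Bijective (antipode k (A := H))) :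
    DoubleCross hS θ (Twist θ.cocycle) where
  bowtie := Twist.ofCoalg θ.cocycle
  one := rfl
  mul p p' h h' m p₁ p₂ p₃ hp := by
    refine (congrArg (Twist.of θ.cocycle) (θ.mulHom_eq hS p p' h h' m p₁ p₂ p₃ hp)).trans ?_
    exact map_sum (Twist.of θ.cocycle) _ _

end DualEmbedding

end Double

end FRTDouble

namespace FRTDouble

/-! ### The multiplication map from the double crossproduct -/

section Double

open WithConv Coalgebra HopfAlgebra

variable {k : Type u} [Field k] {B H : Type u} [Ring B] [HopfAlgebra k B] [Ring H]
  [HopfAlgebra k H] (θ : DualEmbedding k B H) {U : Type u} [Ring U] [HopfAlgebra k U]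
  (iB : B →ₐc[k] U) (iH : H →ₐc[k] U)

namespace DualEmbedding

/-- The product `u ⊗ w ↦ u w` in `U` as a coalgebra map. -/
noncomputable def mulMap : B ⊗[k] H →ₗc[k] U :=
  (Bialgebra.mulCoalgHom k U).comp (Coalgebra.TensorProduct.map (iB : B →ₗc[k] U) (iH : H →ₗc[k] U))

@[simp] theorem mulMap_tmul (u : B) (w : H) : mulMap iB iH (u ⊗ₜ w) = iB u * iH w := rfl

theorem toConv_mulMap : toConv (mulMap iB iH).toLinearMap =
    precomp U (fstHom k B H) (toConv (iB : B →ₗ[k] U)) *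
      precomp U (sndHom k B H) (toConv (iH : H →ₗ[k] U)) := by
  apply WithConv.ext
  refine TensorProduct.ext' fun u w => ?_
  exact (fst_convMul_snd (toConv (iB : B →ₗ[k] U)) (toConv (iH : H →ₗ[k] U)) u w).symm

theorem outerRight_one : outerRight (B := B) (1 : WithConv (H →ₗ[k] U)) = 1 := by
  simp only [outerRight, map_one]

theorem outerLeft_one : outerLeft (H := H) (1 : WithConv (B →ₗ[k] U)) = 1 := by
  simp only [outerLeft, map_one]

/-- The map id ⊗ ε is multiplicative for the untwisted product, so on the twisted product only
conjugation by the cocycle is added. -/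
theorem precomp_mulHom_fst :
    precomp U θ.cocycle.mulHom (precomp U (fstHom k B H) (toConv (iB : B →ₗ[k] U))) =
      inner (scalar k _ U θ.pair) * (outerLeft (toConv (iB : B →ₗ[k] U)) *
        inner (precomp U (sndHom k H B) (toConv (iB : B →ₗ[k] U)))) *
        inner (scalar k _ U θ.pairInv) := by
  let f : B ⊗[k] H →ₐ[k] U := (iB : B →ₐ[k] U).comp
    ((Algebra.TensorProduct.rid k k B).toAlgHom.comp
      (Algebra.TensorProduct.map (AlgHom.id k B) (Bialgebra.counitAlgHom k H)))
  have e : precomp U θ.cocycle.mulHom (precomp U (fstHom k B H) (toConv (iB : B →ₗ[k] U))) =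
      postcomp _ f θ.cocycle.mulConv := rfl
  have e' : postcomp _ f (toConv (LinearMap.mul' k (B ⊗[k] H))) =
      outerLeft (toConv (iB : B →ₗ[k] U)) *
        inner (precomp U (sndHom k H B) (toConv (iB : B →ₗ[k] U))) := by
    rw [← mul_one (inner _), ← outerRight_one]
    apply WithConv.ext
    refine TensorProduct.ext (TensorProduct.ext' fun u w => ?_)
    refine TensorProduct.ext' fun u' w' => ?_
    refine Eq.trans ?_ (legs_apply _ _ _ u u' w w').symm
    simp [f, Algebra.algebraMap_eq_smul_one, smul_smul, mul_comm]
  rw [e, Cocycle.mulConv, map_mul, map_mul, Cocycle.postcomp_scalar, Cocycle.postcomp_scalar, e',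
    inner_scalar, inner_scalar]
  rfl

theorem precomp_mulHom_snd :
    precomp U θ.cocycle.mulHom (precomp U (sndHom k B H) (toConv (iH : H →ₗ[k] U))) =
      inner (scalar k _ U θ.pair) * (inner (precomp U (fstHom k H B) (toConv (iH : H →ₗ[k] U))) *
        outerRight (toConv (iH : H →ₗ[k] U))) *
        inner (scalar k _ U θ.pairInv) := by
  let f : B ⊗[k] H →ₐ[k] U := (iH : H →ₐ[k] U).comp
    ((Algebra.TensorProduct.lid k H).toAlgHom.comp
      (Algebra.TensorProduct.map (Bialgebra.counitAlgHom k B) (AlgHom.id k H)))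
  have e : precomp U θ.cocycle.mulHom (precomp U (sndHom k B H) (toConv (iH : H →ₗ[k] U))) =
      postcomp _ f θ.cocycle.mulConv := rfl
  have e' : postcomp _ f (toConv (LinearMap.mul' k (B ⊗[k] H))) =
      inner (precomp U (fstHom k H B) (toConv (iH : H →ₗ[k] U))) *
        outerRight (toConv (iH : H →ₗ[k] U)) := by
    rw [← one_mul (inner _ * _), ← outerLeft_one]
    apply WithConv.ext
    refine TensorProduct.ext (TensorProduct.ext' fun u w => ?_)
    refine TensorProduct.ext' fun u' w' => ?_
    refine Eq.trans ?_ (legs_apply _ _ _ u u' w w').symm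
    simp [f, Algebra.algebraMap_eq_smul_one, smul_smul, mul_comm]
  rw [e, Cocycle.mulConv, map_mul, map_mul, Cocycle.postcomp_scalar, Cocycle.postcomp_scalar, e',
    inner_scalar, inner_scalar]
  rfl

variable {iB iH} in
-- The hypothesis is the cross relation ∑⟨u₁, w₁⟩ u₂ w₂ = ∑ w₁ u₁ ⟨u₂, w₂⟩ in U. The image of a
-- twisted product is a word of the form γ(u u')γ⁻¹ γ(w w')γ⁻¹; the inner cocycles cancel, and the
-- relation carries the outer γ past u' w, turning it into w u', until it meets γ⁻¹.
theorem mulMap_mul (h : scalar k _ U θ.pair * (precomp U (sndHom k H B) (toConv (iB : B →ₗ[k] U)) *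
      precomp U (fstHom k H B) (toConv (iH : H →ₗ[k] U))) =
    precomp U (fstHom k H B) (toConv (iH : H →ₗ[k] U)) *
      precomp U (sndHom k H B) (toConv (iB : B →ₗ[k] U)) * scalar k _ U θ.pair) (x y : B ⊗[k] H) :
    mulMap iB iH (θ.cocycle.mulHom (x ⊗ₜ y)) = mulMap iB iH x * mulMap iB iH y := by
  have h1 := congrArg (inner (B := B) (H := H)) h
  have h2 := inner_scalar_comm_outerLeft θ.pair (toConv (iB : B →ₗ[k] U))
  have h3 := inner_scalar_comm_outerRight θ.pair (toConv (iH : H →ₗ[k] U))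
  have h4 := congrArg (fun s => inner (scalar k _ U s)) θ.pairInv_mul_pair
  have h5 := congrArg (fun s => inner (scalar k _ U s)) θ.pair_mul_pairInv
  simp only [inner_mul, map_mul, map_one, inner_one] at h1 h4 h5
  have key : precomp U θ.cocycle.mulHom (toConv (mulMap iB iH).toLinearMap) =
      outerLeft (toConv (iB : B →ₗ[k] U)) * (inner
        (precomp U (fstHom k H B) (toConv (iH : H →ₗ[k] U)) *
          precomp U (sndHom k H B) (toConv (iB : B →ₗ[k] U))) *
        outerRight (toConv (iH : H →ₗ[k] U))) := by
    rw [toConv_mulMap, map_mul, precomp_mulHom_fst, precomp_mulHom_snd, inner_mul]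
    generalize inner (scalar k _ U θ.pair) = g at *
    generalize inner (scalar k _ U θ.pairInv) = g' at *
    generalize outerLeft (H := H) (toConv (iB : B →ₗ[k] U)) = p at *
    generalize outerRight (B := B) (toConv (iH : H →ₗ[k] U)) = q at *
    generalize inner (precomp U (fstHom k H B) (toConv (iH : H →ₗ[k] U))) = s at *
    generalize inner (precomp U (sndHom k H B) (toConv (iB : B →ₗ[k] U))) = t at *
    calc _ = (g * p) * t * (g' * g) * s * q * g' := by simp only [mul_assoc]
      _ = p * (g * (t * s)) * q * g' := by rw [h4, h2, mul_one]; simp only [mul_assoc]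
      _ = p * s * t * (g * q) * g' := by rw [h1]; simp only [mul_assoc]
      _ = p * s * t * q * (g * g') := by rw [h3]; simp only [mul_assoc]
      _ = _ := by rw [h5, mul_one]; simp only [mul_assoc]
  have key' : (mulMap iB iH).toLinearMap ∘ₗ θ.cocycle.mulHom.toLinearMap =
      LinearMap.mul' k U ∘ₗ TensorProduct.map (mulMap iB iH).toLinearMap
        (mulMap iB iH).toLinearMap := by
    refine (congrArg WithConv.ofConv key).trans ?_
    refine TensorProduct.ext (TensorProduct.ext' fun u w => ?_)
    refine TensorProduct.ext' fun u' w' => ?_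
    refine (legs_apply _ _ _ u u' w w').trans ?_
    rw [fst_convMul_snd]
    change iB u * (iH w * iB u' * iH w') = iB u * iH w * (iB u' * iH w')
    simp only [mul_assoc]
  exact congrArg (fun f => f (x ⊗ₜ y)) key'

variable {iB iH} in
/-- The bialgebra map `u ⋈ w ↦ u w` from the double crossproduct. -/
noncomputable def lift (h : scalar k _ U θ.pair *
      (precomp U (sndHom k H B) (toConv (iB : B →ₗ[k] U)) *
        precomp U (fstHom k H B) (toConv (iH : H →ₗ[k] U))) =
    precomp U (fstHom k H B) (toConv (iH : H →ₗ[k] U)) *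
      precomp U (sndHom k H B) (toConv (iB : B →ₗ[k] U)) * scalar k _ U θ.pair) :
    Twist θ.cocycle →ₐc[k] U :=
  { (mulMap iB iH).comp ((Twist.ofCoalg θ.cocycle).symm : Twist θ.cocycle →ₗc[k] B ⊗[k] H) with
    map_one' := by
      change iB 1 * iH 1 = 1
      rw [map_one, map_one, mul_one]
    map_mul' := fun x y => θ.mulMap_mul h ((Twist.of θ.cocycle).symm x) ((Twist.of θ.cocycle).symm y) }

theorem lift_tmul (h) (u : B) (w : H) :
    lift θ (iB := iB) (iH := iH) h (Twist.ofCoalg θ.cocycle (u ⊗ₜ w)) = iB u * iH w := rfl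

theorem lift_surjective (h) (hs : Algebra.adjoin k (Set.range iB ∪ Set.range iH) = ⊤) :
    Function.Surjective (lift θ (iB := iB) (iH := iH) h) := by
  have : (⊤ : Subalgebra k U) ≤ (lift θ h : Twist θ.cocycle →ₐ[k] U).range := by
    rw [← hs, Algebra.adjoin_le_iff]
    rintro _ (⟨u, rfl⟩ | ⟨w, rfl⟩)
    · exact ⟨Twist.ofCoalg θ.cocycle (u ⊗ₜ 1), (lift_tmul θ iB iH h u 1).trans (by simp)⟩
    · exact ⟨Twist.ofCoalg θ.cocycle (1 ⊗ₜ w), (lift_tmul θ iB iH h 1 w).trans (by simp)⟩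
  intro x
  exact this (Algebra.mem_top (x := x))

end DualEmbedding

end Double

end FRTDouble

namespace FRTDouble

/-! ### The functionals given by the form on an FRT bialgebra -/

section FRT

open WithConv Coalgebra

namespace FRT

variable {k : Type u} [Field k] {I : Type v} [Fintype I] [DecidableEq I] {R S : I → I → I → I → k}
  (h : IsCompatible R S)

/-- The functional `⟨a | -⟩`. -/
noncomputable def lam (a : FRT R) : ConvDual k (FRT R) := toConv (pairing h a)

/-- The functional `⟨- | b⟩`. -/
noncomputable def rho (b : FRT R) : ConvDual k (FRT R) := toConv ((pairing h).flip b)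

theorem lam_apply (a b : FRT R) : lam h a b = pairing h a b := rfl

theorem rho_apply (a b : FRT R) : rho h b a = pairing h a b := rfl

theorem lam_eq (a : FRT R) : lam h a = (lamHom h a).unop := rfl

theorem lam_one : lam h 1 = 1 := by rw [lam_eq, map_one]; rfl

theorem lam_mul (a b : FRT R) : lam h (a * b) = lam h b * lam h a := by
  rw [lam_eq, map_mul]; rfl

theorem lam_add (a b : FRT R) : lam h (a + b) = lam h a + lam h b := by
  rw [lam_eq, map_add]; rfl

theorem lam_algebraMap (r : k) : lam h (algebraMap k _ r) = algebraMap k _ r := by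
  rw [lam_eq, AlgHom.commutes]; rfl

theorem lam_T (i j : I) : lam h (T R i j) = entry h i j := by
  simp [lam_eq, lamHom]

/-- On generators the defining representation sends 1 to the identity matrix; both sides are
multiplicative. -/
theorem lam_apply_one (a : FRT R) : lam h a 1 = counit (R := k) a := by
  induction a using FRT.inductionOn with
  | halg r => rw [lam_algebraMap]; simp [Algebra.algebraMap_eq_smul_one]
  | hT i j =>
    rw [lam_T, entry_apply, map_one, counit_T, Matrix.one_apply]
  | hmul x y hx hy =>
    rw [lam_mul, LinearMap.convMul_apply]
    simp [Algebra.TensorProduct.one_def, hx, hy, mul_comm]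
  | hadd x y hx hy => rw [lam_add, map_add, ← hx, ← hy]; rfl

/-- `⟨a | x y⟩ = ∑ ⟨a₁ | x⟩ ⟨a₂ | y⟩`. -/
theorem rho_mul (x y : FRT R) : rho h (x * y) = rho h x * rho h y := by
  -- Both sides are algebra maps in the left argument of the form, with values in the opposite of
  -- the dual of A ⊗ A. It then suffices to compare them on generators, where the claim is matrix
  -- multiplication.
  let f₀ : FRT R →ₐ[k] (ConvDual k (FRT R ⊗[k] FRT R))ᵐᵒᵖ :=
    (AlgHom.op (precomp k (Bialgebra.mulCoalgHom k (FRT R)))).comp (lamHom h)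
  let f₁ : FRT R →ₐ[k] (ConvDual k (FRT R ⊗[k] FRT R))ᵐᵒᵖ :=
    (AlgHom.op (precomp k (fstHom k (FRT R) (FRT R)))).comp (lamHom h)
  let f₂ : FRT R →ₐ[k] (ConvDual k (FRT R ⊗[k] FRT R))ᵐᵒᵖ :=
    (AlgHom.op (precomp k (sndHom k (FRT R) (FRT R)))).comp (lamHom h)
  have hc : ∀ a b, Commute (f₁ a) (f₂ b) := by
    intro a b
    apply MulOpposite.unop_injective
    exact scalar_snd_comm_fst (A := k) (lam h b) (lam h a)
  have ev : ∀ (a b : FRT R), (f₁ a * f₂ b).unop (x ⊗ₜ[k] y) = lam h a x * lam h b y := by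
    intro a b
    exact (snd_convMul_fst (A := k) (lam h a) (lam h b) x y).trans (mul_comm _ _)
  have e : f₀ = (Algebra.TensorProduct.lift f₁ f₂ hc).comp (Bialgebra.comulAlgHom k (FRT R)) := by
    refine hom_ext fun i j => MulOpposite.unop_injective (WithConv.ext ?_)
    refine TensorProduct.ext' fun x y => ?_
    have e1 : (Algebra.TensorProduct.lift f₁ f₂ hc).comp (Bialgebra.comulAlgHom k (FRT R))
        (T R i j) = ∑ c, f₁ (T R i c) * f₂ (T R c j) := by
      rw [AlgHom.comp_apply, Bialgebra.comulAlgHom_apply, comul_T, map_sum]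
      simp only [Algebra.TensorProduct.lift_tmul]
    rw [e1, Finset.unop_sum, ofConv_sum, LinearMap.sum_apply]
    refine (pairing_T_mul h i j x y).trans (Finset.sum_congr rfl fun c _ => ?_)
    exact ((snd_convMul_fst (A := k) (lam h (T R i c)) (lam h (T R c j)) x y).trans
      (mul_comm _ _)).symm
  ext a
  have ea := congrArg (fun f : FRT R →ₐ[k] (ConvDual k (FRT R ⊗[k] FRT R))ᵐᵒᵖ =>
    (f a).unop.ofConv (x ⊗ₜ[k] y)) e
  refine Eq.trans ea ?_
  rw [(ℛ k a).convMul_apply, AlgHom.comp_apply, Bialgebra.comulAlgHom_apply, ← (ℛ k a).eq,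
    map_sum]
  simp only [Algebra.TensorProduct.lift_tmul, Finset.unop_sum, ofConv_sum,
    LinearMap.sum_apply, ev]
  rfl

theorem rho_one : rho h 1 = 1 := by
  ext a
  exact (lam_apply_one h a).trans (by simp)

theorem rho_add (a b : FRT R) : rho h (a + b) = rho h a + rho h b := by
  ext x; simp [rho]

theorem rho_algebraMap (r : k) : rho h (algebraMap k _ r) = algebraMap k _ r := by
  have : rho h (r • 1) = r • rho h 1 := by ext x; simp [rho]
  rw [Algebra.algebraMap_eq_smul_one, Algebra.algebraMap_eq_smul_one, this, rho_one]

/-- `⟨x y | b⟩ = ∑ ⟨y | b₁⟩ ⟨x | b₂⟩` on generators. -/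
theorem rho_T_mul (i j : I) (x y : FRT R) :
    rho h (T R i j) (x * y) = ∑ c, rho h (T R i c) y * rho h (T R c j) x := by
  rw [rho_apply, ← lam_apply, lam_mul, LinearMap.convMul_apply, comul_T]
  simp only [map_sum, TensorProduct.map_tmul, LinearMap.mul'_apply]
  rfl

/-- If the matrices `S` and `S'` are inverse to each other then so are `⟨- | T⟩_S` and
`⟨T | -⟩_{S'}`. -/
theorem sum_rho_mul_lam {S' : I → I → I → I → k} (h' : IsCompatible R S')
    (hS : ∀ i j a b, ∑ c, ∑ d, S i j c d * S' c d a b = if i = a ∧ j = b then 1 else 0)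
    (i j : I) : ∑ c, rho h (T R i c) * lam h' (T R c j) = if i = j then 1 else 0 := by
  -- Induction on the argument, for all indices at once. On xy the functional ρ(T) reverses the
  -- factors and λ(T) keeps them, so the terms in x sit inside those in y and contract first.
  have key : ∀ x : FRT R, ∀ i j, (∑ c, rho h (T R i c) * lam h' (T R c j)) x =
      if i = j then counit (R := k) x else 0 := by
    intro x
    induction x using FRT.inductionOn with
    | halg r =>
      intro i j
      have e : ∀ y : ConvDual k (FRT R), y (algebraMap k _ r) = r * y 1 := by
        intro y; rw [Algebra.algebraMap_eq_smul_one, map_smul, smul_eq_mul]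
      have e' : ∀ c, (rho h (T R i c) * lam h' (T R c j)) 1 =
          (if i = c then 1 else 0) * (if c = j then 1 else 0) := by
        intro c
        rw [LinearMap.convMul_apply, Bialgebra.comul_one, Algebra.TensorProduct.one_def,
          TensorProduct.map_tmul, LinearMap.mul'_apply, lam_apply_one, counit_T, rho_apply,
          ← lam_apply, lam_one]
        simp [counit_T]
      rw [e]
      simp only [ofConv_sum, LinearMap.sum_apply, e']
      simp
    | hT a b =>
      intro i j
      have e' : ∀ c, (rho h (T R i c) * lam h' (T R c j)) (T R a b) =
          ∑ d, S a i c d * S' c d b j := by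
        intro c
        rw [LinearMap.convMul_apply, comul_T]
        simp only [map_sum, TensorProduct.map_tmul, LinearMap.mul'_apply, rho_apply, lam_apply,
          pairing_T_T]
      simp only [ofConv_sum, LinearMap.sum_apply, e', hS, counit_T]
      by_cases h1 : a = b <;> by_cases h2 : i = j <;> simp [h1, h2]
    | hmul x y hx hy =>
      intro i j
      have e : ∀ c, (rho h (T R i c) * lam h' (T R c j)) (x * y) =
          ∑ p ∈ (ℛ k x).index, ∑ q ∈ (ℛ k y).index, ∑ d, ∑ e,
            (rho h (T R i d) ((ℛ k y).left q) * lam h' (T R e j) ((ℛ k y).right q)) *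
            (rho h (T R d c) ((ℛ k x).left p) * lam h' (T R c e) ((ℛ k x).right p)) := by
        intro c
        rw [LinearMap.convMul_apply, Bialgebra.comul_mul, ← (ℛ k x).eq, ← (ℛ k y).eq,
          Finset.sum_mul_sum]
        simp only [map_sum, Algebra.TensorProduct.tmul_mul_tmul, TensorProduct.map_tmul,
          LinearMap.mul'_apply, rho_T_mul]
        refine Finset.sum_congr rfl fun p _ => Finset.sum_congr rfl fun q _ => ?_
        rw [lam_apply, pairing_T_mul, Finset.sum_mul_sum]
        refine Finset.sum_congr rfl fun d _ => Finset.sum_congr rfl fun e _ => ?_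
        simp only [lam_apply]
        ring
      have e2 : ∀ d e, ∑ c, ∑ p ∈ (ℛ k x).index,
          rho h (T R d c) ((ℛ k x).left p) * lam h' (T R c e) ((ℛ k x).right p) =
          if d = e then counit (R := k) x else 0 := by
        intro d e
        rw [← hx d e]
        simp only [ofConv_sum, LinearMap.sum_apply, (ℛ k x).convMul_apply]
      have e3 := hy i j
      simp only [ofConv_sum, LinearMap.sum_apply, (ℛ k y).convMul_apply] at e3
      simp only [ofConv_sum, LinearMap.sum_apply, e]
      calc _ = ∑ q ∈ (ℛ k y).index, ∑ d, ∑ e, (rho h (T R i d) ((ℛ k y).left q) *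
            lam h' (T R e j) ((ℛ k y).right q)) * ∑ c, ∑ p ∈ (ℛ k x).index,
            rho h (T R d c) ((ℛ k x).left p) * lam h' (T R c e) ((ℛ k x).right p) := by
            simp only [Finset.mul_sum]
            rw [Finset.sum_comm_cycle]
            refine Finset.sum_congr rfl fun q _ => ?_
            rw [Finset.sum_comm_cycle]
            refine Finset.sum_congr rfl fun d _ => ?_
            rw [Finset.sum_comm_cycle]
        _ = _ := by
            simp only [e2, mul_ite, mul_zero, Finset.sum_ite_eq, Finset.mem_univ, if_true]
            rw [Finset.sum_comm]
            simp only [← Finset.sum_mul, e3, Bialgebra.counit_mul]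
            split_ifs <;> simp [mul_comm]
    | hadd x y hx hy =>
      intro i j
      rw [map_add, hx, hy, map_add]
      split_ifs <;> simp
  ext x
  rw [key]
  split_ifs <;> simp

end FRT

end FRT

/-! ### Inverses of triangular matrices over a noncommutative algebra -/

section Triangular

variable {k : Type*} [Field k] {A : Type*} [Ring A] [Algebra k A] {I : Type*} [Fintype I]
  [DecidableEq I] {lt : I → I → Prop} {r l : I → I → A} {g : I → A}

/-- Column j of the equation r l = 1 solved for r i j: the recursion for back substitution. -/
theorem mul_diag_eq (hrl : ∀ i j, ∑ c, r i c * l c j = if i = j then 1 else 0)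
    (hg : ∀ j, l j j * g j = 1) (i j : I) :
    r i j = ((if i = j then 1 else 0) - ∑ c ∈ Finset.univ.erase j, r i c * l c j) * g j := by
  rw [← hrl i j, ← Finset.add_sum_erase _ _ (Finset.mem_univ j), add_sub_cancel_right, mul_assoc,
    hg, mul_one]

/-- Back substitution: by triangularity only columns preceding j enter the recursion. -/
theorem triangular_inverse_mem (wf : WellFounded lt) (hl : ∀ c j, c ≠ j → ¬ lt c j → l c j = 0)
    (hrl : ∀ i j, ∑ c, r i c * l c j = if i = j then 1 else 0)
    (hg : ∀ j, l j j * g j = 1) (S : Subalgebra k A) (hlS : ∀ c j, l c j ∈ S)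
    (hgS : ∀ j, g j ∈ S) (i j : I) : r i j ∈ S := by
  induction j using wf.induction with
  | _ j ih =>
    rw [mul_diag_eq hrl hg]
    refine S.mul_mem (S.sub_mem (by split_ifs <;> simp) (S.sum_mem fun c hc => ?_)) (hgS j)
    by_cases h : lt c j
    · exact S.mul_mem (ih c h) (hlS c j)
    · rw [hl c j (Finset.ne_of_mem_erase hc) h, mul_zero]
      exact S.zero_mem

theorem triangular_inverse_eq_zero (wf : WellFounded lt) (ht : ∀ a b c, lt a b → lt b c → lt a c)
    (hl : ∀ c j, c ≠ j → ¬ lt c j → l c j = 0)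
    (hrl : ∀ i j, ∑ c, r i c * l c j = if i = j then 1 else 0)
    (hg : ∀ j, l j j * g j = 1) (i j : I) (hj : lt j i) : r i j = 0 := by
  induction j using wf.induction with
  | _ j ih =>
    rw [mul_diag_eq hrl hg, if_neg (by rintro rfl; exact wf.irrefl.irrefl _ hj),
      Finset.sum_eq_zero, sub_zero, zero_mul]
    intro c hc
    by_cases h : lt c j
    · rw [ih c h (ht _ _ _ h hj), zero_mul]
    · rw [hl c j (Finset.ne_of_mem_erase hc) h, mul_zero]

/-- The inverse is triangular too, so on the diagonal the recursion leaves only the inverse diagonal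
entry. -/
theorem triangular_inverse_diag (wf : WellFounded lt) (ht : ∀ a b c, lt a b → lt b c → lt a c)
    (hl : ∀ c j, c ≠ j → ¬ lt c j → l c j = 0)
    (hrl : ∀ i j, ∑ c, r i c * l c j = if i = j then 1 else 0)
    (hg : ∀ j, l j j * g j = 1) (i : I) : r i i = g i := by
  rw [mul_diag_eq hrl hg, if_pos rfl, Finset.sum_eq_zero, sub_zero, one_mul]
  intro c hc
  by_cases h : lt c i
  · rw [triangular_inverse_eq_zero wf ht hl hrl hg i c h, zero_mul]
  · rw [hl c i (Finset.ne_of_mem_erase hc) h, mul_zero]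

end Triangular

end FRTDouble

namespace FRTDouble

/-! ### Generators of B^l, B^r and U_Q -/

section Multiparameter

open WithConv Coalgebra

namespace Parameters

variable {k : Type u} [Field k] {n : ℕ} (Q : Parameters k n)

theorem Rinv_mul_R (i j a b : Fin n) :
    ∑ c, ∑ d, Q.Rinv i j c d * Q.R c d a b = if i = a ∧ j = b then 1 else 0 := by
  rw [R_eq, Rinv_eq, flipForm_sum]
  have hr := Q.r_ne_zero
  have z1 := Q.kappa_ne_zero i j
  have z2 := Q.kappa_ne_zero j i
  have h1 := Q.kappa_self
  have e : (if i = a ∧ j = b then 1 else 0 : k) = dl i a * dl j b := by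
    by_cases h2 : i = a <;> by_cases h3 : j = b <;> simp [dl, h2, h3]
  rw [e]
  simp only [flipForm]
  rcases tri Q.kappa Q.r Q.kappa_of_gt i j with ⟨g1, n1, k1⟩ | rfl | ⟨g1, n1, k1⟩ <;>
  · simp only [*, lt_irrefl, if_true, if_false]
    field_simp
    try ring

theorem lamPlus_eq (a : Q.A) : Q.lamPlus a = FRT.lam Q.isCompatible_R a := rfl

theorem lamMinus_eq (a : Q.A) : Q.lamMinus a = FRT.lam Q.isCompatible_Rinv a := rfl

theorem lamPlus_T_eq_zero (i j : Fin n) (hij : ¬ j ≤ i) : Q.lamPlus (Q.T i j) = 0 := by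
  ext x
  exact FRT.entry_eq_zero Q.isCompatible_R (· ≥ ·) (fun i => le_refl i)
    (fun i c j h1 h2 => h2.trans h1) (by
      intro i j a b h
      unfold R
      rw [if_neg (by rintro ⟨rfl, -⟩; exact h le_rfl),
        if_neg (by rintro ⟨rfl, rfl, h'⟩; exact h h'.le)]) i j x hij

theorem lamMinus_T_eq_zero (i j : Fin n) (hij : ¬ i ≤ j) : Q.lamMinus (Q.T i j) = 0 := by
  ext x
  exact FRT.entry_eq_zero Q.isCompatible_Rinv (· ≤ ·) (fun i => le_refl i)
    (fun i c j h1 h2 => h1.trans h2) (by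
      intro i j a b h
      unfold Rinv
      rw [if_neg (by rintro ⟨rfl, -⟩; exact h le_rfl),
        if_neg (by rintro ⟨rfl, rfl, h'⟩; exact h h'.le)]) i j x hij

/-- One component of the FRT relation for the entries of λ(T). The coefficient on the left is
nonzero exactly when one of j, b lies below i and the other does not; then an entry between distant
indices is expressed by entries through i. -/
theorem lam_T_relation {S : Fin n → Fin n → Fin n → Fin n → k} (h : FRT.IsCompatible Q.R S)
    (i j b : Fin n) :
    ((if j < i then Q.r - 1 else 0) - (if b < i then Q.r - 1 else 0)) •
      (FRT.lam h (Q.T j b) * FRT.lam h (Q.T i i)) =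
    Q.kappa b i • (FRT.lam h (Q.T j i) * FRT.lam h (Q.T i b)) -
      Q.kappa i j • (FRT.lam h (Q.T i b) * FRT.lam h (Q.T j i)) := by
  ext x
  have e := congrArg (fun f => f.ofConv x) (FRT.entry_relation h i j i b)
  simp only [ofConv_sum, ofConv_smul, LinearMap.sum_apply, LinearMap.smul_apply, smul_eq_mul,
    ← FRT.lam_T] at e
  have e1 : ∀ G : Fin n → Fin n → k, ∑ c, ∑ d, Q.R i j c d * G c d =
      Q.kappa i j * G j i + (if j < i then Q.r - 1 else 0) * G i j := by
    intro G; rw [R_eq, flipForm_sum]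
  have e2 : ∀ G : Fin n → Fin n → k, ∑ c, ∑ d, Q.R c d i b * G c d =
      Q.kappa b i * G b i + (if b < i then Q.r - 1 else 0) * G i b := by
    intro G
    rw [R_eq]
    simp only [flipForm, dl, add_mul, mul_ite, ite_mul, mul_one, mul_zero, zero_mul,
      Finset.sum_add_distrib, Finset.sum_ite_eq', Finset.mem_univ, if_true]
    rw [Finset.sum_comm]
    simp
  rw [e1 fun c d => (FRT.lam h (FRT.T Q.R d b) * FRT.lam h (FRT.T Q.R c i)).ofConv x,
    e2 fun c d => (FRT.lam h (FRT.T Q.R j d) * FRT.lam h (FRT.T Q.R i c)).ofConv x] at e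
  simp only [ofConv_smul, ofConv_sub, LinearMap.smul_apply, LinearMap.sub_apply, smul_eq_mul]
  linear_combination e

/-- The relation is solved for the entry by dividing by the difference of coefficients and
cancelling the diagonal entry with its inverse y. -/
theorem lam_T_mem {S : Fin n → Fin n → Fin n → Fin n → k} (h : FRT.IsCompatible Q.R S)
    (B : Subalgebra k (ConvDual k Q.A)) (i j b : Fin n) {y : ConvDual k Q.A} (hy : y ∈ B)
    (hiy : FRT.lam h (Q.T i i) * y = 1)
    (hβ : (if j < i then Q.r - 1 else 0) ≠ (if b < i then Q.r - 1 else 0))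
    (h1 : FRT.lam h (Q.T j i) ∈ B) (h2 : FRT.lam h (Q.T i b) ∈ B) :
    FRT.lam h (Q.T j b) ∈ B := by
  have e := Q.lam_T_relation h i j b
  rw [← eq_inv_smul_iff₀ (sub_ne_zero.2 hβ)] at e
  rw [← mul_one (FRT.lam h (Q.T j b)), ← hiy, ← mul_assoc, e]
  exact B.mul_mem (B.smul_mem (B.sub_mem (B.smul_mem (B.mul_mem h1 h2) _)
    (B.smul_mem (B.mul_mem h2 h1) _)) _) hy

theorem K_mem_Bl (i : Fin n) : Q.K i ∈ Q.Bl := Algebra.subset_adjoin (.inl (.inl ⟨i, rfl⟩))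

theorem Kinv_mem_Bl (i : Fin n) : Q.Kinv i ∈ Q.Bl := Algebra.subset_adjoin (.inl (.inr ⟨i, rfl⟩))

theorem E_mem_Bl {i j : Fin n} (h : (i : ℕ) + 1 = j) : Q.E i j ∈ Q.Bl :=
  Algebra.subset_adjoin (.inr ⟨i, j, h, rfl⟩)

theorem L_mem_Br (i : Fin n) : Q.L i ∈ Q.Br := Algebra.subset_adjoin (.inl (.inl ⟨i, rfl⟩))

theorem Linv_mem_Br (i : Fin n) : Q.Linv i ∈ Q.Br := Algebra.subset_adjoin (.inl (.inr ⟨i, rfl⟩))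

theorem F_mem_Br {i j : Fin n} (h : (i : ℕ) + 1 = j) : Q.F i j ∈ Q.Br :=
  Algebra.subset_adjoin (.inr ⟨i, j, h, rfl⟩)

theorem lamPlus_T_eq_smul_E (i j : Fin n) : Q.lamPlus (Q.T j i) = (Q.r - 1) • Q.E i j := by
  rw [E, smul_inv_smul₀ (sub_ne_zero.2 Q.r_ne_one)]

theorem lamMinus_T_eq_smul_F (i j : Fin n) : Q.lamMinus (Q.T i j) = (Q.r⁻¹ - 1) • Q.F i j := by
  rw [F, smul_inv_smul₀ (sub_ne_zero.2 fun h => Q.r_ne_one (inv_eq_one.1 h))]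

theorem lamPlus_T_mem (i j : Fin n) : Q.lamPlus (Q.T i j) ∈ Q.Bl := by
  by_cases hij : j ≤ i
  · obtain ⟨d, hd⟩ := Nat.exists_eq_add_of_le (Fin.le_def.1 hij)
    induction d generalizing i j with
    | zero =>
      obtain rfl : i = j := Fin.ext (by omega)
      rw [lamPlus_T_diag]
      exact Q.K_mem_Bl i
    | succ d ih =>
      have hj : (j : ℕ) + 1 < n := by omega
      have hE : Q.lamPlus (Q.T ⟨j + 1, hj⟩ j) ∈ Q.Bl := by
        rw [lamPlus_T_eq_smul_E]
        exact Q.Bl.smul_mem (Q.E_mem_Bl rfl) _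
      rcases Nat.eq_zero_or_pos d with rfl | hd0
      · obtain rfl : i = ⟨j + 1, hj⟩ := Fin.ext (by simp; omega)
        exact hE
      -- The intermediate index is j + 1: i is not below it and j is. Since d > 0, the entry
      -- T_i^{j+1} is covered by induction and lies strictly below the diagonal.
      · refine Q.lam_T_mem Q.isCompatible_R Q.Bl ⟨j + 1, hj⟩ i j (Q.Kinv_mem_Bl ⟨j + 1, hj⟩) ?_ ?_
          (ih i ⟨j + 1, hj⟩ (by rw [Fin.le_def]; simp; omega) (by simp; omega)) hE
        · rw [← lamPlus_eq, lamPlus_T_diag]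
          exact Q.K_mul_Kinv _
        · rw [if_neg (by rw [Fin.lt_def]; simp; omega), if_pos (by rw [Fin.lt_def]; simp)]
          exact (sub_ne_zero.2 Q.r_ne_one).symm
  · rw [Q.lamPlus_T_eq_zero i j hij]
    exact Q.Bl.zero_mem

theorem lamMinus_T_mem (i j : Fin n) : Q.lamMinus (Q.T i j) ∈ Q.Br := by
  by_cases hij : i ≤ j
  · obtain ⟨d, hd⟩ := Nat.exists_eq_add_of_le (Fin.le_def.1 hij)
    induction d generalizing i j with
    | zero =>
      obtain rfl : i = j := Fin.ext (by omega)
      rw [lamMinus_T_diag]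
      exact Q.L_mem_Br i
    | succ d ih =>
      have hi : (i : ℕ) + 1 < n := by omega
      have hF : Q.lamMinus (Q.T i ⟨i + 1, hi⟩) ∈ Q.Br := by
        rw [lamMinus_T_eq_smul_F]
        exact Q.Br.smul_mem (Q.F_mem_Br rfl) _
      rcases Nat.eq_zero_or_pos d with rfl | hd0
      · obtain rfl : j = ⟨i + 1, hi⟩ := Fin.ext (by simp; omega)
        exact hF
      -- Here the intermediate index is i + 1; now it is i that lies below it, and j that does not.
      · refine Q.lam_T_mem Q.isCompatible_Rinv Q.Br ⟨i + 1, hi⟩ i j (Q.Linv_mem_Br ⟨i + 1, hi⟩)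
          ?_ ?_ hF (ih ⟨i + 1, hi⟩ j (by rw [Fin.le_def]; simp; omega) (by simp; omega))
        · rw [← lamMinus_eq, lamMinus_T_diag]
          exact Q.L_mul_Linv _
        · rw [if_pos (by rw [Fin.lt_def]; simp), if_neg (by rw [Fin.lt_def]; simp; omega)]
          exact sub_ne_zero.2 Q.r_ne_one
  · rw [Q.lamMinus_T_eq_zero i j hij]
    exact Q.Br.zero_mem

theorem sum_rhoPlus_mul_lamMinus (i j : Fin n) :
    ∑ c, Q.rhoPlus (Q.T i c) * Q.lamMinus (Q.T c j) = if i = j then 1 else 0 :=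
  FRT.sum_rho_mul_lam Q.isCompatible_R Q.isCompatible_Rinv Q.R_mul_Rinv i j

theorem sum_rhoMinus_mul_lamPlus (i j : Fin n) :
    ∑ c, Q.rhoMinus (Q.T i c) * Q.lamPlus (Q.T c j) = if i = j then 1 else 0 :=
  FRT.sum_rho_mul_lam Q.isCompatible_Rinv Q.isCompatible_R Q.Rinv_mul_R i j

theorem lamMinus_T_eq_zero_of_not_lt (c j : Fin n) (h1 : c ≠ j) (h2 : ¬ c < j) :
    Q.lamMinus (Q.T c j) = 0 :=
  Q.lamMinus_T_eq_zero c j fun h => h2 (lt_of_le_of_ne h h1)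

theorem lamPlus_T_eq_zero_of_not_gt (c j : Fin n) (h1 : c ≠ j) (h2 : ¬ c > j) :
    Q.lamPlus (Q.T c j) = 0 :=
  Q.lamPlus_T_eq_zero c j fun h => h2 (lt_of_le_of_ne h h1.symm)

theorem lamMinus_T_diag_mul_Linv (j : Fin n) : Q.lamMinus (Q.T j j) * Q.Linv j = 1 := by
  rw [lamMinus_T_diag, L_mul_Linv]

theorem lamPlus_T_diag_mul_Kinv (j : Fin n) : Q.lamPlus (Q.T j j) * Q.Kinv j = 1 := by
  rw [lamPlus_T_diag, K_mul_Kinv]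

/-- The matrix ρ⁺(T) is a left inverse of the triangular matrix λ⁻(T), whose diagonal entries L_j
are invertible in B^r. -/
theorem rhoPlus_T_mem (i j : Fin n) : Q.rhoPlus (Q.T i j) ∈ Q.Br :=
  triangular_inverse_mem wellFounded_lt Q.lamMinus_T_eq_zero_of_not_lt Q.sum_rhoPlus_mul_lamMinus
    Q.lamMinus_T_diag_mul_Linv Q.Br Q.lamMinus_T_mem Q.Linv_mem_Br i j

theorem rhoMinus_T_mem (i j : Fin n) : Q.rhoMinus (Q.T i j) ∈ Q.Bl :=
  triangular_inverse_mem wellFounded_gt Q.lamPlus_T_eq_zero_of_not_gt Q.sum_rhoMinus_mul_lamPlus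
    Q.lamPlus_T_diag_mul_Kinv Q.Bl Q.lamPlus_T_mem Q.Kinv_mem_Bl i j

theorem rhoPlus_T_diag (i : Fin n) : Q.rhoPlus (Q.T i i) = Q.Linv i :=
  triangular_inverse_diag wellFounded_lt (fun _ _ _ => lt_trans)
    Q.lamMinus_T_eq_zero_of_not_lt Q.sum_rhoPlus_mul_lamMinus Q.lamMinus_T_diag_mul_Linv i

theorem rhoMinus_T_diag (i : Fin n) : Q.rhoMinus (Q.T i i) = Q.Kinv i :=
  triangular_inverse_diag wellFounded_gt (fun _ _ _ h h' => lt_trans h' h)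
    Q.lamPlus_T_eq_zero_of_not_gt Q.sum_rhoMinus_mul_lamPlus Q.lamPlus_T_diag_mul_Kinv i

theorem lam_mem {S : Fin n → Fin n → Fin n → Fin n → k} (h : FRT.IsCompatible Q.R S)
    (B : Subalgebra k (ConvDual k Q.A)) (hB : ∀ i j, FRT.lam h (Q.T i j) ∈ B) (a : Q.A) :
    FRT.lam h a ∈ B := by
  induction a using FRT.inductionOn with
  | halg r => rw [FRT.lam_algebraMap]; exact B.algebraMap_mem r
  | hT i j => exact hB i j
  | hmul x y hx hy => rw [FRT.lam_mul]; exact B.mul_mem hy hx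
  | hadd x y hx hy => rw [FRT.lam_add]; exact B.add_mem hx hy

theorem rho_mem {S : Fin n → Fin n → Fin n → Fin n → k} (h : FRT.IsCompatible Q.R S)
    (B : Subalgebra k (ConvDual k Q.A)) (hB : ∀ i j, FRT.rho h (Q.T i j) ∈ B) (a : Q.A) :
    FRT.rho h a ∈ B := by
  induction a using FRT.inductionOn with
  | halg r => rw [FRT.rho_algebraMap]; exact B.algebraMap_mem r
  | hT i j => exact hB i j
  | hmul x y hx hy => rw [FRT.rho_mul]; exact B.mul_mem hx hy
  | hadd x y hx hy => rw [FRT.rho_add]; exact B.add_mem hx hy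

theorem lamPlus_mem (a : Q.A) : Q.lamPlus a ∈ Q.Bl := Q.lam_mem _ _ Q.lamPlus_T_mem a

theorem lamMinus_mem (a : Q.A) : Q.lamMinus a ∈ Q.Br := Q.lam_mem _ _ Q.lamMinus_T_mem a

theorem rhoPlus_mem (a : Q.A) : Q.rhoPlus a ∈ Q.Br := Q.rho_mem _ _ Q.rhoPlus_T_mem a

theorem rhoMinus_mem (a : Q.A) : Q.rhoMinus a ∈ Q.Bl := Q.rho_mem _ _ Q.rhoMinus_T_mem a

/-- The elements K_i and E are values of λ⁺ up to scalars; the inverses K_i⁻¹ are the diagonal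
entries of ρ⁻(T). -/
theorem Bl_le_U : Q.Bl ≤ Q.U := by
  rw [Bl, Algebra.adjoin_le_iff]
  rintro _ ((⟨i, rfl⟩ | ⟨i, rfl⟩) | ⟨i, j, -, rfl⟩)
  · rw [← lamPlus_T_diag]
    exact Algebra.subset_adjoin (.inl (.inl ⟨_, rfl⟩))
  · rw [← rhoMinus_T_diag]
    exact Algebra.subset_adjoin (.inr (.inr ⟨_, rfl⟩))
  · exact Q.U.smul_mem (Algebra.subset_adjoin (.inl (.inl ⟨_, rfl⟩))) _

theorem Br_le_U : Q.Br ≤ Q.U := by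
  rw [Br, Algebra.adjoin_le_iff]
  rintro _ ((⟨i, rfl⟩ | ⟨i, rfl⟩) | ⟨i, j, -, rfl⟩)
  · rw [← lamMinus_T_diag]
    exact Algebra.subset_adjoin (.inr (.inl ⟨_, rfl⟩))
  · rw [← rhoPlus_T_diag]
    exact Algebra.subset_adjoin (.inl (.inr ⟨_, rfl⟩))
  · exact Q.U.smul_mem (Algebra.subset_adjoin (.inr (.inl ⟨_, rfl⟩))) _

theorem U_le {B : Subalgebra k (ConvDual k Q.A)} (hl : Q.Bl ≤ B) (hr : Q.Br ≤ B) : Q.U ≤ B := by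
  rw [U, Algebra.adjoin_le_iff]
  rintro _ ((⟨a, rfl⟩ | ⟨a, rfl⟩) | (⟨a, rfl⟩ | ⟨a, rfl⟩))
  · exact hl (Q.lamPlus_mem a)
  · exact hr (Q.rhoPlus_mem a)
  · exact hr (Q.lamMinus_mem a)
  · exact hl (Q.rhoMinus_mem a)

/-- Presents U_Q by characters and skew derivations, so that the existence theorem for Hopf
subalgebras of the dual applies to it. -/
theorem U_eq : Q.U = Algebra.adjoin k
    (((Set.range Q.K ∪ Set.range Q.Kinv) ∪ (Set.range Q.L ∪ Set.range Q.Linv)) ∪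
    ({f | ∃ i j : Fin n, (i : ℕ) + 1 = j ∧ f = Q.E i j} ∪
      {f | ∃ i j : Fin n, (i : ℕ) + 1 = j ∧ f = Q.F i j})) := by
  apply le_antisymm
  · apply U_le
    · exact Algebra.adjoin_mono (Set.union_subset_union Set.subset_union_left Set.subset_union_left)
    · exact Algebra.adjoin_mono
        (Set.union_subset_union Set.subset_union_right Set.subset_union_right)
  · rw [Algebra.adjoin_le_iff]
    rintro f ((hf | hf) | (hf | hf))
    · exact Q.Bl_le_U (Algebra.subset_adjoin (.inl hf))
    · exact Q.Br_le_U (Algebra.subset_adjoin (.inl hf))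
    · exact Q.Bl_le_U (Algebra.subset_adjoin (.inr hf))
    · exact Q.Br_le_U (Algebra.subset_adjoin (.inr hf))

theorem diag_apply_one (t : Fin n → k) : Q.diag t 1 = 1 := map_one (Q.diagHom t)

theorem isPointedDual_Bl : IsPointedDual (Set.range Q.K ∪ Set.range Q.Kinv)
    {f | ∃ i j : Fin n, (i : ℕ) + 1 = j ∧ f = Q.E i j} where
  map_one := by
    rintro _ (⟨i, rfl⟩ | ⟨i, rfl⟩) <;> exact Q.diag_apply_one _
  map_mul := by
    rintro _ (⟨i, rfl⟩ | ⟨i, rfl⟩) <;> exact Q.diag_mul _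
  inv := by
    have h : ∀ i, Q.Kinv i * Q.K i = 1 := fun i => by
      rw [← K_mul_Kinv, K, Kinv, diag_mul_diag, diag_mul_diag, mul_comm]
    rintro _ (⟨i, rfl⟩ | ⟨i, rfl⟩)
    · exact ⟨Q.Kinv i, .inr ⟨i, rfl⟩, Q.K_mul_Kinv i, h i⟩
    · exact ⟨Q.K i, .inl ⟨i, rfl⟩, h i, Q.K_mul_Kinv i⟩
  skew := by
    rintro _ ⟨i, j, h, rfl⟩
    exact ⟨Q.K j, .inl ⟨j, rfl⟩, Q.K i, .inl ⟨i, rfl⟩, Q.E_mul i j h⟩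

theorem isPointedDual_Br : IsPointedDual (Set.range Q.L ∪ Set.range Q.Linv)
    {f | ∃ i j : Fin n, (i : ℕ) + 1 = j ∧ f = Q.F i j} where
  map_one := by
    rintro _ (⟨i, rfl⟩ | ⟨i, rfl⟩) <;> exact Q.diag_apply_one _
  map_mul := by
    rintro _ (⟨i, rfl⟩ | ⟨i, rfl⟩) <;> exact Q.diag_mul _
  inv := by
    have h : ∀ i, Q.Linv i * Q.L i = 1 := fun i => by
      rw [← L_mul_Linv, L, Linv, diag_mul_diag, diag_mul_diag, mul_comm]
    rintro _ (⟨i, rfl⟩ | ⟨i, rfl⟩)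
    · exact ⟨Q.Linv i, .inr ⟨i, rfl⟩, Q.L_mul_Linv i, h i⟩
    · exact ⟨Q.L i, .inl ⟨i, rfl⟩, h i, Q.L_mul_Linv i⟩
  skew := by
    rintro _ ⟨i, j, h, rfl⟩
    exact ⟨Q.L i, .inl ⟨i, rfl⟩, Q.L j, .inl ⟨j, rfl⟩, Q.F_mul i j h⟩

end Parameters

theorem IsPointedDual.union {k : Type u} [Field k] {A : Type v} [Ring A] [Bialgebra k A]
    {G E G' E' : Set (ConvDual k A)} (h : IsPointedDual G E) (h' : IsPointedDual G' E') :
    IsPointedDual (G ∪ G') (E ∪ E') where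
  map_one := by
    rintro g (hg | hg)
    exacts [h.map_one g hg, h'.map_one g hg]
  map_mul := by
    rintro g (hg | hg)
    exacts [h.map_mul g hg, h'.map_mul g hg]
  inv := by
    rintro g (hg | hg)
    · obtain ⟨g', h1, h2⟩ := h.inv g hg
      exact ⟨g', .inl h1, h2⟩
    · obtain ⟨g', h1, h2⟩ := h'.inv g hg
      exact ⟨g', .inr h1, h2⟩
  skew := by
    rintro e (he | he)
    · obtain ⟨a, ha, b, hb, hab⟩ := h.skew e he
      exact ⟨a, .inl ha, b, .inl hb, hab⟩
    · obtain ⟨a, ha, b, hb, hab⟩ := h'.skew e he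
      exact ⟨a, .inr ha, b, .inr hb, hab⟩

theorem IsPointedDual.nonempty_dualHopf {k : Type u} [Field k] {A : Type u} [Ring A] [Bialgebra k A]
    {G E : Set (ConvDual k A)} (h : IsPointedDual G E) (H : Subalgebra k (ConvDual k A))
    (hH : H = Algebra.adjoin k (G ∪ E)) : Nonempty (DualHopf H.val) := by
  subst hH
  exact ⟨h.exists_dualHopf.choose⟩

end Multiparameter

end FRTDouble

namespace FRTDouble

/-! ### Convolution with scalars as an action on the coalgebra -/

section Actions

open WithConv Coalgebra

variable {k : Type*} [Field k] {C : Type*} [AddCommMonoid C] [Module k C] [Coalgebra k C]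
  {A : Type*} [Ring A] [Algebra k A]

theorem convMul_scalar_apply_eq {C : Type*} [Ring C] [Bialgebra k C] (l : WithConv (C →ₗ[k] A))
    (g : WithConv (C →ₗ[k] k)) (x : C) :
    (l * scalar k C A g) x = l ((toConv LinearMap.id * scalar k C C g : WithConv (C →ₗ[k] C)) x) := by
  rw [convMul_scalar_apply _ _ _ (ℛ k x), convMul_scalar_apply _ _ _ (ℛ k x), map_sum]
  simp

theorem scalar_convMul_apply_eq {C : Type*} [Ring C] [Bialgebra k C] (l : WithConv (C →ₗ[k] A))
    (g : WithConv (C →ₗ[k] k)) (x : C) :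
    (scalar k C A g * l) x = l ((scalar k C C g * toConv LinearMap.id : WithConv (C →ₗ[k] C)) x) := by
  rw [scalar_convMul_apply _ _ _ (ℛ k x), scalar_convMul_apply _ _ _ (ℛ k x), map_sum]
  simp

end Actions

/-! ### The braiding identity for the form on A -/

section Braiding

open WithConv Coalgebra

namespace FRT

variable {k : Type u} [Field k] {I : Type v} [Fintype I] [DecidableEq I] {R : I → I → I → I → k}
  (h : IsCompatible R R)

/-- `x ↦ ∑ f(x₂) x₁`. -/
noncomputable def actLeft (f : ConvDual k (FRT R)) : WithConv (FRT R →ₗ[k] FRT R) :=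
  toConv LinearMap.id * scalar k _ _ f

/-- `x ↦ ∑ f(x₁) x₂`. -/
noncomputable def actRight (f : ConvDual k (FRT R)) : WithConv (FRT R →ₗ[k] FRT R) :=
  scalar k _ _ f * toConv LinearMap.id

theorem actLeft_mul (f g : ConvDual k (FRT R)) (x : FRT R) :
    actLeft (f * g) x = actLeft f (actLeft g x) := by
  rw [actLeft, map_mul, ← mul_assoc, convMul_scalar_apply_eq]
  rfl

theorem actRight_mul (f g : ConvDual k (FRT R)) (x : FRT R) :
    actRight (f * g) x = actRight g (actRight f x) := by
  rw [actRight, map_mul, mul_assoc, scalar_convMul_apply_eq]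
  rfl

/-- The actions use the outer legs of the iterated coproduct, so they commute by coassociativity. -/
theorem actLeft_actRight (f g : ConvDual k (FRT R)) (x : FRT R) :
    actLeft f (actRight g x) = actRight g (actLeft f x) := by
  have h1 := scalar_convMul_apply_eq (actLeft f) g x
  have h2 := convMul_scalar_apply_eq (actRight g) f x
  refine h1.symm.trans (Eq.trans ?_ h2)
  rw [actLeft, actRight, mul_assoc]

/-- The algebra homomorphism with entries `x ↦ ∑ x₁ ⟨T_i^j | x₂⟩`. -/
noncomputable def matLeft : FRT R →ₐ[k] Matrix I I (FRT R) :=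
  (matrixEquivTensor I k (FRT R)).symm.toAlgHom.comp
    ((Algebra.TensorProduct.map (AlgHom.id k (FRT R)) (rep h)).comp
      (Bialgebra.comulAlgHom k (FRT R)))

/-- The algebra homomorphism with entries `x ↦ ∑ ⟨T_i^j | x₁⟩ x₂`. -/
noncomputable def matRight : FRT R →ₐ[k] Matrix I I (FRT R) :=
  (matrixEquivTensor I k (FRT R)).symm.toAlgHom.comp
    (((Algebra.TensorProduct.map (AlgHom.id k (FRT R)) (rep h)).comp
      (Algebra.TensorProduct.comm k (FRT R) (FRT R)).toAlgHom).comp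
      (Bialgebra.comulAlgHom k (FRT R)))

theorem matLeft_apply (x : FRT R) (i j : I) : matLeft h x i j = actLeft (lam h (T R i j)) x := by
  rw [actLeft, convMul_scalar_apply _ _ _ (ℛ k x)]
  simp only [matLeft, AlgHom.comp_apply, Bialgebra.comulAlgHom_apply]
  rw [← (ℛ k x).eq]
  simp [Matrix.sum_apply, Algebra.smul_def, lam_T, entry_apply, Algebra.commutes]

theorem matRight_apply (x : FRT R) (i j : I) :
    matRight h x i j = actRight (lam h (T R i j)) x := by
  rw [actRight, scalar_convMul_apply _ _ _ (ℛ k x)]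
  simp only [matRight, AlgHom.comp_apply, Bialgebra.comulAlgHom_apply]
  rw [← (ℛ k x).eq]
  simp [Matrix.sum_apply, Algebra.smul_def, lam_T, entry_apply, Algebra.commutes]

/-- Both matrix maps are algebra homomorphisms in x, so the intertwining passes to products of x; on
generators it is the defining relation of A. -/
theorem T_mul_matLeft (x : FRT R) :
    Matrix.of (T R) * matLeft h x = matRight h x * Matrix.of (T R) := by
  induction x using FRT.inductionOn with
  | halg r => rw [AlgHom.commutes, AlgHom.commutes, Algebra.commutes]
  | hT a b =>
    ext i j
    have e1 : ∀ c, matLeft h (T R a b) c j = ∑ d, R c d b j • T R a d := by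
      intro c
      simp only [matLeft, AlgHom.comp_apply, Bialgebra.comulAlgHom_apply, comul_T, map_sum]
      simp [Matrix.sum_apply, Algebra.smul_def, rep_T, Algebra.commutes]
    have e2 : ∀ c, matRight h (T R a b) i c = ∑ d, R i a d c • T R d b := by
      intro c
      simp only [matRight, AlgHom.comp_apply, Bialgebra.comulAlgHom_apply, comul_T, map_sum]
      simp [Matrix.sum_apply, Algebra.smul_def, rep_T, Algebra.commutes]
    simp only [Matrix.mul_apply, e1, e2, Finset.mul_sum, Finset.sum_mul, Matrix.of_apply,
      mul_smul_comm, smul_mul_assoc]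
    rw [← rtt, Finset.sum_comm]
  | hmul x y hx hy => rw [map_mul, map_mul, ← mul_assoc, hx, mul_assoc, hy, mul_assoc]
  | hadd x y hx hy => rw [map_add, map_add, mul_add, add_mul, hx, hy]

theorem lam_smul (r : k) (a : FRT R) : lam h (r • a) = r • lam h a := by
  ext x; simp [lam]

/-- `a ⊗ b ↦ ∑ a x₁ ⟨b | x₂⟩`. -/
noncomputable def braidLeft (x : FRT R) : FRT R ⊗[k] FRT R →ₗ[k] FRT R :=
  TensorProduct.lift (LinearMap.mk₂ k (fun a b => a * actLeft (lam h b) x)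
    (fun a a' b => add_mul _ _ _) (fun r a b => smul_mul_assoc _ _ _)
    (fun a b b' => by simp [lam_add, actLeft, mul_add])
    (fun r a b => by simp [lam_smul, actLeft, Algebra.mul_smul_comm]))

/-- `a ⊗ b ↦ ∑ ⟨a | x₁⟩ x₂ b`. -/
noncomputable def braidRight (x : FRT R) : FRT R ⊗[k] FRT R →ₗ[k] FRT R :=
  TensorProduct.lift (LinearMap.mk₂ k (fun a b => actRight (lam h a) x * b)
    (fun a b b' => by simp [lam_add, actRight, add_mul])
    (fun r a b => by simp [lam_smul, actRight])
    (fun a a' b => mul_add _ _ _) (fun r a b => mul_smul_comm _ _ _))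

@[simp] theorem braidLeft_tmul (x a b : FRT R) :
    braidLeft h x (a ⊗ₜ b) = a * actLeft (lam h b) x := rfl

@[simp] theorem braidRight_tmul (x a b : FRT R) :
    braidRight h x (a ⊗ₜ b) = actRight (lam h a) x * b := rfl

/-- The form is a braiding: `∑ a₁ x₁ ⟨a₂ | x₂⟩ = ∑ ⟨a₁ | x₁⟩ x₂ a₂`. -/
theorem braidLeft_comul (a x : FRT R) :
    braidLeft h x (comul a) = braidRight h x (comul a) := by
  induction a using FRT.inductionOn generalizing x with
  | halg r =>
    rw [Bialgebra.comul_algebraMap, Algebra.TensorProduct.algebraMap_apply]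
    rw [braidLeft_tmul, braidRight_tmul, lam_one, lam_algebraMap]
    simp [actLeft, actRight, Algebra.algebraMap_eq_smul_one]
  | hT i j =>
    have := congrFun (congrFun (T_mul_matLeft h x) i) j
    simp only [Matrix.mul_apply, matLeft_apply, matRight_apply, Matrix.of_apply] at this
    simpa only [comul_T, map_sum, braidLeft_tmul, braidRight_tmul] using this
  | hmul a b ha hb =>
    rw [Bialgebra.comul_mul, ← (ℛ k a).eq, ← (ℛ k b).eq, Finset.sum_mul_sum]
    simp only [← (ℛ k a).eq, map_sum, braidLeft_tmul, braidRight_tmul] at ha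
    simp only [← (ℛ k b).eq, map_sum, braidLeft_tmul, braidRight_tmul] at hb
    simp only [map_sum, Algebra.TensorProduct.tmul_mul_tmul, braidLeft_tmul, braidRight_tmul,
      lam_mul, actLeft_mul, actRight_mul]
    -- First b is carried across x, already acted on by a; since the actions commute, a can be
    -- carried across afterwards.
    have e1 : ∀ i, ∑ j ∈ (ℛ k b).index, (ℛ k a).left i * (ℛ k b).left j *
        actLeft (lam h ((ℛ k b).right j)) (actLeft (lam h ((ℛ k a).right i)) x) =
        ∑ j ∈ (ℛ k b).index, (ℛ k a).left i *
          actLeft (lam h ((ℛ k a).right i)) (actRight (lam h ((ℛ k b).left j)) x) *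
          (ℛ k b).right j := by
      intro i
      simp only [mul_assoc, ← Finset.mul_sum]
      rw [hb]
      simp only [actLeft_actRight]
    rw [Finset.sum_congr rfl fun i _ => e1 i, Finset.sum_comm]
    simp only [← Finset.sum_mul, ha]
    rw [Finset.sum_comm]
    simp only [Finset.sum_mul, mul_assoc]
  | hadd a b ha hb => rw [map_add, map_add, map_add, ha, hb]

end FRT

end Braiding

/-! ### Coefficient functionals are determined on a subalgebra up to inverses -/

section Density

open WithConv Coalgebra HopfAlgebra

variable {k : Type u} [Field k] {H : Type v} [Ring H] [Bialgebra k H]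

/-- A finite-dimensional subalgebra contains the inverses of its invertible elements. -/
theorem mem_of_mul_eq_one {D : Type*} [Ring D] [Algebra k D] [Module.Finite k D]
    (S : Subalgebra k D) {x y : D} (hx : x ∈ S) (h : y * x = 1) : y ∈ S := by
  let l : S →ₗ[k] S := LinearMap.mulLeft k ⟨x, hx⟩
  have inj : Function.Injective l := by
    intro a b hab
    have : x * (a : D) = x * b := congrArg Subtype.val hab
    apply Subtype.ext
    rw [← one_mul (a : D), ← h, mul_assoc, this, ← mul_assoc, h, one_mul]
  obtain ⟨z, hz⟩ := LinearMap.injective_iff_surjective.1 inj 1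
  have : x * (z : D) = 1 := congrArg Subtype.val hz
  have hzy : (z : D) = y := by rw [← one_mul (z : D), ← h, mul_assoc, this, mul_one]
  exact hzy ▸ z.2

/-- A coefficient functional is determined by its restriction to a subalgebra which generates the
algebra together with inverses of some of its elements. -/
theorem eq_zero_of_coefficients (S : Subalgebra k H) (G : Set H)
    (hG : ∀ g ∈ G, ∃ g' ∈ S, g * g' = 1)
    (hS : Algebra.adjoin k ((S : Set H) ∪ G) = ⊤) {f : ConvDual k H} (hf : f ∈ coefficients k H)
    (h0 : ∀ s ∈ S, f s = 0) : f = 0 := by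
  obtain ⟨D, _, _, _, ρ, φ, hφ⟩ := hf
  -- In the finite-dimensional representation the image of S already contains the images of the
  -- adjoined inverses, so S and the whole algebra have the same image.
  have hle : (⊤ : Subalgebra k H) ≤ (S.map ρ).comap ρ := by
    rw [← hS, Algebra.adjoin_le_iff]
    rintro x (hx | hx)
    · exact ⟨x, hx, rfl⟩
    · obtain ⟨g, hg, h1⟩ := hG x hx
      exact mem_of_mul_eq_one (S.map ρ) ⟨g, hg, rfl⟩ (by rw [← map_mul, h1, map_one])
  ext x
  obtain ⟨s, hs, hsx⟩ := hle (Algebra.mem_top (x := x))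
  exact (hφ x).trans ((congrArg φ hsx.symm).trans ((hφ s).symm.trans (h0 s hs)))

theorem coefficients_mulLeft {f : ConvDual k H} (hf : f ∈ coefficients k H) (y : H) :
    toConv (f.ofConv ∘ₗ LinearMap.mulLeft k y) ∈ coefficients k H := by
  obtain ⟨D, _, _, _, ρ, φ, hφ⟩ := hf
  exact ⟨D, _, _, inferInstance, ρ, φ ∘ₗ LinearMap.mulLeft k (ρ y), fun x => by simp [hφ]⟩

theorem coefficients_mulRight {f : ConvDual k H} (hf : f ∈ coefficients k H) (y : H) :
    toConv (f.ofConv ∘ₗ LinearMap.mulRight k y) ∈ coefficients k H := by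
  obtain ⟨D, _, _, _, ρ, φ, hφ⟩ := hf
  exact ⟨D, _, _, inferInstance, ρ, φ ∘ₗ LinearMap.mulRight k (ρ y), fun x => by simp [hφ]⟩

/-- The antipode is anti-multiplicative, so composed with it a representation takes values in the
opposite algebra. -/
theorem coefficients_antipode {H : Type v} [Ring H] [HopfAlgebra k H] {f : ConvDual k H}
    (hf : f ∈ coefficients k H) : toConv (f.ofConv ∘ₗ antipode k) ∈ coefficients k H := by
  obtain ⟨D, _, _, _, ρ, φ, hφ⟩ := hf
  let ρ' : H →ₐ[k] Dᵐᵒᵖ := AlgHom.ofLinearMap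
    ((MulOpposite.opLinearEquiv k (M := D)).toLinearMap ∘ₗ ρ.toLinearMap ∘ₗ antipode k) (by simp)
    (fun x y => by simp [antipode_mul_antidistrib])
  exact ⟨Dᵐᵒᵖ, _, _, inferInstance, ρ',
    φ ∘ₗ (MulOpposite.opLinearEquiv k (M := D)).symm.toLinearMap, fun x => hφ _⟩

end Density

end FRTDouble

namespace FRTDouble

/-! ### Hopf algebras embedded in the dual of A -/

section Dual

open WithConv Coalgebra HopfAlgebra

variable {k : Type u} [Field k] {A : Type v} [Ring A] [Bialgebra k A] {H : Type w} [Ring H]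
  [HopfAlgebra k H]

/-- The Hopf algebra `H` is embedded in `A^*` compatibly with the structures dual to those of `A`. -/
structure IsDual (j : H →ₐ[k] ConvDual k A) : Prop where
  injective : Function.Injective j
  comul : ∀ f x y, evalAt₂ j x y (comul f) = j f (x * y)
  counit : ∀ f, counit (R := k) f = j f 1

theorem DualHopf.isDual {H : Type w} [Ring H] [Algebra k H] {j : H →ₐ[k] ConvDual k A}
    (s : DualHopf j) : letI := s.hopfAlgebra; IsDual (H := H) j :=
  letI := s.hopfAlgebra
  ⟨s.injective, s.evalAt₂_comul, fun _ => rfl⟩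

namespace IsDual

variable {j : H →ₐ[k] ConvDual k A} (hj : IsDual j)

/-- Evaluation `A → H^*`. -/
noncomputable def ev : A →ₐ[k] ConvDual k H :=
  AlgHom.ofLinearMap
    { toFun := fun x => toConv (evalAt j x)
      map_add' := fun x y => by ext w; simp [evalAt_apply]
      map_smul' := fun r x => by ext w; simp [evalAt_apply] }
    (by ext w; simp [evalAt_apply, hj.counit])
    (fun x y => by ext w; exact (hj.comul w x y).symm)

@[simp] theorem ev_apply (x : A) (w : H) : hj.ev x w = j w x := rfl

theorem evalAt₂_map {C B : Type*} [AddCommMonoid C] [Module k C] [Ring B] [Algebra k B]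
    {j' : B →ₐ[k] ConvDual k A} (l : C →ₗ[k] B) (x y : A) (t : C ⊗[k] C) :
    evalAt₂ j' x y (TensorProduct.map l l t) =
      LinearMap.mul' k k (TensorProduct.map (evalAt j' x ∘ₗ l) (evalAt j' y ∘ₗ l) t) := by
  rw [evalAt₂, LinearMap.comp_apply, ← LinearMap.comp_apply (TensorProduct.map _ _),
    ← TensorProduct.map_comp]

/-- An inclusion of subalgebras of `A^*` is a homomorphism of the dual bialgebras. -/
theorem exists_bialgHom {B : Type*} [Ring B] [HopfAlgebra k B] {j' : B →ₐ[k] ConvDual k A}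
    (hj : IsDual j) (hj' : IsDual j') (h : ∀ b, j' b ∈ j.range) :
    ∃ i : B →ₐc[k] H, ∀ b, j (i b) = j' b := by
  let i : B →ₐ[k] H := (AlgEquiv.ofInjective j hj.injective).symm.toAlgHom.comp
    (j'.codRestrict j.range h)
  have hi : ∀ b, j (i b) = j' b := fun b =>
    congrArg Subtype.val ((AlgEquiv.ofInjective j hj.injective).apply_symm_apply ⟨j' b, h b⟩)
  have hi' : ∀ x, evalAt j x ∘ₗ i.toLinearMap = evalAt j' x := fun x => by
    ext b
    exact congrArg (fun f => f.ofConv x) (hi b)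
  refine ⟨BialgHom.ofAlgHom i ?_ ?_, hi⟩
  · ext b
    exact (hj.counit (i b)).trans ((congrArg (fun f => f.ofConv 1) (hi b)).trans
      (hj'.counit b).symm)
  · ext b
    refine tensor_ext₂ j hj.injective fun x y => ?_
    refine (evalAt₂_map i.toLinearMap x y _).trans ?_
    rw [hi', hi']
    refine (hj'.comul b x y).trans ?_
    rw [← hi]
    exact (hj.comul (i b) x y).symm

end IsDual

end Dual

/-! ### Extending functionals from λ⁺(A) to B^l -/

section LeftDual

open WithConv Coalgebra HopfAlgebra

namespace Parameters

variable {k : Type u} [Field k] {n : ℕ} (Q : Parameters k n) {H : Type u} [Ring H]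
  [HopfAlgebra k H] {j : H →ₐ[k] ConvDual k Q.A}

/-- `λ⁺` as a coalgebra map to `B^l`. -/
theorem exists_lamPlus (hj : IsDual j) (hl : ∀ a, Q.lamPlus a ∈ j.range) :
    ∃ l : Q.A →ₗc[k] H, ∀ a, j (l a) = Q.lamPlus a := by
  choose l hl using hl
  replace hl : ∀ a, j (l a) = Q.lamPlus a := hl
  let l' : Q.A →ₗ[k] H :=
    { toFun := l
      map_add' := fun x y => hj.injective (by
        rw [map_add, hl, hl, hl, lamPlus_eq, FRT.lam_add]; rfl)
      map_smul' := fun r x => hj.injective (by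
        rw [RingHom.id_apply, map_smul, hl, hl, lamPlus_eq, FRT.lam_smul]; rfl) }
  have hl' : ∀ x, evalAt j x ∘ₗ l' = (Q.rhoPlus x).ofConv := fun x => by
    ext a
    exact congrArg (fun f => f.ofConv x) (hl a)
  refine ⟨{ l' with counit_comp := ?_, map_comp_comul := ?_ }, hl⟩
  · ext a
    refine (hj.counit (l a)).trans ((congrArg (fun f => f.ofConv 1) (hl a)).trans ?_)
    exact FRT.lam_apply_one _ a
  · ext a
    -- Tested at x and y, compatibility of λ⁺ with coproducts is multiplicativity of ρ⁺.
    refine tensor_ext₂ j hj.injective fun x y => ?_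
    refine (IsDual.evalAt₂_map l' x y _).trans ?_
    rw [hl', hl']
    refine Eq.trans ?_ (hj.comul (l a) x y).symm
    rw [hl]
    exact congrArg (fun f => f.ofConv a) (FRT.rho_mul Q.isCompatible_R x y).symm

variable {l : Q.A →ₗc[k] H}

theorem map_lamPlus_mul (hj : IsDual j) (hl : ∀ a, j (l a) = Q.lamPlus a) (a b : Q.A) :
    l (a * b) = l b * l a := by
  apply hj.injective
  rw [hl, map_mul j, hl, hl, lamPlus_eq, FRT.lam_mul]
  rfl

theorem map_lamPlus_algebraMap (hj : IsDual j) (hl : ∀ a, j (l a) = Q.lamPlus a) (r : k) :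
    l (algebraMap k _ r) = algebraMap k _ r := by
  apply hj.injective
  rw [hl, AlgHom.commutes, lamPlus_eq, FRT.lam_algebraMap]

/-- A coefficient functional on `B^l` is determined by its values on `λ⁺(A)`. -/
theorem eq_zero_of_lamPlus (hj : IsDual j) (hr : j.range = Q.Bl)
    (hl : ∀ a, j (l a) = Q.lamPlus a) {f : ConvDual k H} (hf : f ∈ coefficients k H)
    (h0 : ∀ a, f (l a) = 0) : f = 0 := by
  -- The image of λ⁺ is a subalgebra since λ⁺ reverses products. It contains K_i and the multiples
  -- of E, so only the inverses of the K_i are missing.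
  let S : Subalgebra k H :=
    { carrier := Set.range l
      mul_mem' := by
        rintro _ _ ⟨a, rfl⟩ ⟨b, rfl⟩
        exact ⟨b * a, Q.map_lamPlus_mul hj hl b a⟩
      add_mem' := by
        rintro _ _ ⟨a, rfl⟩ ⟨b, rfl⟩
        exact ⟨a + b, map_add _ _ _⟩
      algebraMap_mem' := fun r => ⟨_, Q.map_lamPlus_algebraMap hj hl r⟩ }
  refine eq_zero_of_coefficients S {g | ∃ i, j g = Q.Kinv i} ?_ ?_ hf ?_
  · rintro g ⟨i, hg⟩
    refine ⟨l (Q.T i i), ⟨_, rfl⟩, hj.injective ?_⟩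
    rw [map_mul, hg, hl, lamPlus_T_diag, map_one, K, Kinv, diag_mul_diag, mul_comm,
      ← diag_mul_diag]
    exact Q.K_mul_Kinv i
  · have : Q.Bl ≤ (Algebra.adjoin k ((S : Set H) ∪ {g | ∃ i, j g = Q.Kinv i})).map j := by
      rw [Bl, Algebra.adjoin_le_iff]
      rintro _ ((⟨i, rfl⟩ | ⟨i, rfl⟩) | ⟨i, i', hi, rfl⟩)
      · exact ⟨l (Q.T i i), Algebra.subset_adjoin (.inl ⟨_, rfl⟩),
          (hl _).trans (Q.lamPlus_T_diag i)⟩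
      · obtain ⟨g, hg⟩ : Q.Kinv i ∈ j.range := hr ▸ Q.Kinv_mem_Bl i
        exact ⟨g, Algebra.subset_adjoin (.inr ⟨i, hg⟩), hg⟩
      · refine Subalgebra.smul_mem _ ?_ _
        exact ⟨l (Q.T i' i), Algebra.subset_adjoin (.inl ⟨_, rfl⟩), hl _⟩
    rw [eq_top_iff]
    rintro w -
    obtain ⟨w', hw', e⟩ := this (hr ▸ ⟨w, rfl⟩ : j w ∈ Q.Bl)
    rwa [← hj.injective e]
  · rintro _ ⟨a, rfl⟩
    exact h0 a

/-- Since the coproduct of T is matrix multiplication, evaluation at the entries of T is a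
representation of H by n × n matrices. -/
theorem ev_mem_coefficients (hj : IsDual j) (x : Q.A) : hj.ev x ∈ coefficients k H := by
  induction x using FRT.inductionOn with
  | halg r => rw [AlgHom.commutes]; exact Subalgebra.algebraMap_mem _ r
  | hT a b =>
    let ρ : H →ₐ[k] Matrix (Fin n) (Fin n) k := AlgHom.ofLinearMap
      { toFun := fun w => Matrix.of fun a b => j w (Q.T a b)
        map_add' := fun w w' => by ext; simp
        map_smul' := fun r w => by ext; simp }
      (by
        ext a b
        have := FRT.counit_T Q.R a b
        simp [Matrix.one_apply, this])
      (fun w w' => by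
        ext a b
        have := FRT.comul_T Q.R a b
        simp [Matrix.mul_apply, this])
    exact ⟨_, inferInstance, inferInstance, inferInstance, ρ, Matrix.entryLinearMap k k a b,
      fun w => rfl⟩
  | hmul x y hx hy => rw [map_mul]; exact Subalgebra.mul_mem _ hx hy
  | hadd x y hx hy => rw [map_add]; exact Subalgebra.add_mem _ hx hy

/-- The evaluation of `S(w)` at `x`. -/
noncomputable def evAntipode (hj : IsDual j) (x : Q.A) : ConvDual k H :=
  toConv ((hj.ev x).ofConv ∘ₗ antipode k)

/-- This is the antipode axiom S(w₁) w₂ = ε(w) evaluated at the entries of T. -/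
theorem sum_evAntipode_mul_ev (hj : IsDual j) (a b : Fin n) :
    ∑ c, Q.evAntipode hj (Q.T a c) * hj.ev (Q.T c b) = if a = b then 1 else 0 := by
  ext w
  have e : ∀ t : H ⊗[k] H, ∑ c, LinearMap.mul' k k (TensorProduct.map
      (Q.evAntipode hj (Q.T a c)).ofConv (hj.ev (Q.T c b)).ofConv t) =
      j (LinearMap.mul' k H ((antipode k).rTensor H t)) (Q.T a b) := by
    intro t
    induction t with
    | zero => simp
    | add s t hs ht => simp only [map_add, Finset.sum_add_distrib, hs, ht]; rfl
    | tmul x y =>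
      have := FRT.comul_T Q.R a b
      simp only [TensorProduct.map_tmul, LinearMap.mul'_apply, LinearMap.rTensor_tmul, map_mul,
        LinearMap.convMul_apply, this, map_sum]
      rfl
  simp only [ofConv_sum, LinearMap.sum_apply, LinearMap.convMul_apply]
  rw [e, mul_antipode_rTensor_comul_apply, AlgHom.commutes]
  have hT : counit (R := k) (Q.T a b) = if a = b then 1 else 0 := FRT.counit_T Q.R a b
  rw [Algebra.algebraMap_eq_smul_one, ofConv_smul, LinearMap.smul_apply, LinearMap.convOne_apply, hT]
  split_ifs <;> simp

theorem precomp_ev (hj : IsDual j) (hl : ∀ a, j (l a) = Q.lamPlus a) (x : Q.A) :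
    precomp k l (hj.ev x) = Q.rhoPlus x := by
  ext a
  exact congrArg (fun f => f.ofConv x) (hl a)

/-- Along λ⁺, evaluation at T restricts to ρ⁺(T), so evaluation of the antipode at T restricts to a
left inverse of that matrix. But λ⁻(T) is a right inverse, and the two agree. -/
theorem precomp_evAntipode (hj : IsDual j) (hl : ∀ a, j (l a) = Q.lamPlus a) (a b : Fin n) :
    precomp k l (Q.evAntipode hj (Q.T a b)) = Q.lamMinus (Q.T a b) := by
  have h1 : ∀ a b, ∑ c, precomp k l (Q.evAntipode hj (Q.T a c)) * Q.rhoPlus (Q.T c b) =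
      if a = b then 1 else 0 := by
    intro a b
    have := congrArg (precomp k l) (Q.sum_evAntipode_mul_ev hj a b)
    simp only [map_sum, map_mul, Q.precomp_ev hj hl] at this
    rw [this]
    split_ifs <;> simp
  let M : Matrix (Fin n) (Fin n) (ConvDual k Q.A) := Matrix.of fun a b =>
    precomp k l (Q.evAntipode hj (Q.T a b))
  let P : Matrix (Fin n) (Fin n) (ConvDual k Q.A) := Matrix.of fun a b => Q.rhoPlus (Q.T a b)
  let N : Matrix (Fin n) (Fin n) (ConvDual k Q.A) := Matrix.of fun a b => Q.lamMinus (Q.T a b)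
  have hMP : M * P = 1 := by
    ext1 a b
    simpa [Matrix.mul_apply, Matrix.one_apply, M, P] using h1 a b
  have hPN : P * N = 1 := by
    ext1 a b
    simpa [Matrix.mul_apply, Matrix.one_apply, P, N] using Q.sum_rhoPlus_mul_lamMinus a b
  have e : M = N := left_inv_eq_right_inv hMP hPN
  exact congrFun (congrFun e a) b

/-- The functionals on `A` induced by coefficient functionals on `B^l` contain `B^r`. -/
theorem Br_le_map_coefficients (hj : IsDual j) (hl : ∀ a, j (l a) = Q.lamPlus a) :
    Q.Br ≤ (coefficients k H).map (precomp k l) := by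
  rw [Br, Algebra.adjoin_le_iff]
  have h : ∀ a b, Q.lamMinus (Q.T a b) ∈ (coefficients k H).map (precomp k l) := fun a b =>
    ⟨_, coefficients_antipode (Q.ev_mem_coefficients hj (Q.T a b)),
      Q.precomp_evAntipode hj hl a b⟩
  rintro _ ((⟨i, rfl⟩ | ⟨i, rfl⟩) | ⟨i, i', hi, rfl⟩)
  · rw [← lamMinus_T_diag]
    exact h i i
  · rw [← rhoPlus_T_diag]
    exact ⟨_, Q.ev_mem_coefficients hj (Q.T i i), Q.precomp_ev hj hl _⟩
  · exact Subalgebra.smul_mem _ (h i i') _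

variable {B : Type u} [Ring B] [HopfAlgebra k B] {j' : B →ₐ[k] ConvDual k Q.A}

/-- The algebra map `B^r → (B^l)^0` under which `ρ⁺(b)` corresponds to evaluation at `b`. -/
theorem exists_toHom (hj : IsDual j) (hr : j.range = Q.Bl) (hl : ∀ a, j (l a) = Q.lamPlus a)
    (hr' : j'.range = Q.Br) : ∃ t : B →ₐ[k] ConvDual k H, (∀ b, t b ∈ coefficients k H) ∧
      ∀ b a, t b (l a) = j' b a := by
  -- Restriction along λ⁺ is injective on coefficient functionals and its image contains B^r, so it
  -- can be inverted there.
  let Φ : coefficients k H →ₐ[k] ConvDual k Q.A := (precomp k l).comp (coefficients k H).val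
  have inj : Function.Injective Φ := by
    rw [injective_iff_map_eq_zero]
    intro f hf
    exact Subtype.ext (Q.eq_zero_of_lamPlus hj hr hl f.2 fun a =>
      congrArg (fun f => f.ofConv a) hf)
  have mem : ∀ b, j' b ∈ Φ.range := fun b => by
    obtain ⟨f, hf, e⟩ := Q.Br_le_map_coefficients hj hl (hr' ▸ ⟨b, rfl⟩ : j' b ∈ Q.Br)
    exact ⟨⟨f, hf⟩, e⟩
  let t : B →ₐ[k] coefficients k H :=
    (AlgEquiv.ofInjective Φ inj).symm.toAlgHom.comp (j'.codRestrict Φ.range mem)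
  have ht : ∀ b, Φ (t b) = j' b := fun b =>
    congrArg Subtype.val ((AlgEquiv.ofInjective Φ inj).apply_symm_apply ⟨j' b, mem b⟩)
  exact ⟨(coefficients k H).val.comp t, fun b => (t b).2, fun b a =>
    congrArg (fun f => f.ofConv a) (ht b)⟩

variable {t : B →ₐ[k] ConvDual k H}

/-- For x and y in λ⁺(A) this is the dual coproduct of B^r, reversed because λ⁺ reverses products.
Both sides are coefficient functionals in each variable, so it extends to y in λ⁺(A) with x
arbitrary, and then to all y. -/
theorem toHom_mul (hj : IsDual j) (hr : j.range = Q.Bl) (hl : ∀ a, j (l a) = Q.lamPlus a)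
    (hj' : IsDual j') (ht : ∀ b, t b ∈ coefficients k H) (htl : ∀ b a, t b (l a) = j' b a)
    (b : B) (x y : H) : t b (x * y) = evalAt₂ t y x (comul b) := by
  have e : ∀ x y, evalAt₂ t y x (comul b) =
      ∑ i ∈ (ℛ k b).index, t ((ℛ k b).left i) y * t ((ℛ k b).right i) x := by
    intro x y
    conv_lhs => rw [← (ℛ k b).eq]
    simp [evalAt₂_tmul, evalAt_apply]
  have h1 : ∀ a a', t b (l a * l a') = evalAt₂ t (l a') (l a) (comul b) := by
    intro a a'
    rw [← Q.map_lamPlus_mul hj hl, htl, ← hj'.comul, e]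
    conv_lhs => rw [← (ℛ k b).eq]
    simp [evalAt₂_tmul, evalAt_apply, htl]
  have h2 : ∀ x a', t b (x * l a') = evalAt₂ t (l a') x (comul b) := by
    intro x a'
    have := Q.eq_zero_of_lamPlus hj hr hl (Subalgebra.sub_mem _
      (coefficients_mulRight (ht b) (l a')) (Subalgebra.sum_mem _ (t := (ℛ k b).index)
        (f := fun i => t ((ℛ k b).left i) (l a') • t ((ℛ k b).right i)) fun i _ =>
        Subalgebra.smul_mem _ (ht _) _)) (fun a => by simpa [e, sub_eq_zero] using h1 a a')
    have := congrArg (fun f => f.ofConv x) this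
    simpa [e, sub_eq_zero] using this
  have := Q.eq_zero_of_lamPlus hj hr hl (Subalgebra.sub_mem _
    (coefficients_mulLeft (ht b) x) (Subalgebra.sum_mem _ (t := (ℛ k b).index)
      (f := fun i => t ((ℛ k b).right i) x • t ((ℛ k b).left i)) fun i _ =>
      Subalgebra.smul_mem _ (ht _) _)) (fun a => by simpa [e, sub_eq_zero, mul_comm] using h2 x a)
  have := congrArg (fun f => f.ofConv y) this
  simpa [e, sub_eq_zero, mul_comm] using this

end Parameters

end LeftDual

/-! ### Compatibility of the pairing with antipodes -/

section AntipodePairing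

open WithConv Coalgebra HopfAlgebra

variable {k : Type u} [Field k] {B H : Type u} [Ring B] [HopfAlgebra k B] [Ring H]
  [HopfAlgebra k H] {t : B →ₐ[k] ConvDual k H}

/-- The inverse of S is an antipode for the co-opposite coproduct: apply S and use its
anti-multiplicativity. -/
theorem sum_antipode_symm_mul (hS : Function.Bijective (antipode k (A := H))) (x : H) :
    ∑ i ∈ (ℛ k x).index, (LinearEquiv.ofBijective _ hS).symm ((ℛ k x).right i) *
      (ℛ k x).left i = algebraMap k H (counit x) := by
  apply hS.1
  rw [map_sum]
  have e : ∀ y, antipode k ((LinearEquiv.ofBijective _ hS).symm y) = y :=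
    (LinearEquiv.ofBijective _ hS).apply_symm_apply
  simp only [antipode_mul_antidistrib, e]
  rw [sum_antipode_mul_eq_algebraMap_counit, Algebra.algebraMap_eq_smul_one, map_smul,
    antipode_one]

/-- A pairing of Hopf algebras `B` and `H` with the product of `H` dual to the opposite coproduct of
`B` satisfies `⟨S b, S x⟩ = ⟨b, x⟩`. -/
theorem pairing_antipode (hS : Function.Bijective (antipode k (A := H)))
    (h1 : ∀ b, t b 1 = counit (R := k) b)
    (hm : ∀ b x y, t b (x * y) = evalAt₂ t y x (comul b)) (b : B) (x : H) :
    t (antipode k b) (antipode k x) = t b x := by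
  let S' : H →ₗ[k] H := (LinearEquiv.ofBijective _ hS).symm.toLinearMap
  let P : WithConv (B →ₗ[k] ConvDual k H) := toConv t.toLinearMap
  let P' : WithConv (B →ₗ[k] ConvDual k H) := toConv
    { toFun := fun b => toConv ((t b).ofConv ∘ₗ S')
      map_add' := fun b b' => by ext; simp
      map_smul' := fun r b => by ext; simp }
  have hP' : ∀ b x, P' b x = t b (S' x) := fun _ _ => rfl
  -- The pairing, seen as a map from B to the dual of H, has t ∘ S as a left inverse; `e2` shows
  -- that the transpose of S⁻¹ gives a right inverse, so the two coincide.
  have e1 : postcomp B t (toConv (antipode k)) * P = 1 := by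
    have : P = postcomp B t (toConv LinearMap.id) := rfl
    rw [this, ← map_mul, LinearMap.antipode_mul_id, map_one]
  have e2 : P * P' = 1 := by
    ext b x
    rw [(ℛ k b).convMul_apply]
    simp only [ofConv_sum, LinearMap.sum_apply, (ℛ k x).convMul_apply, hP']
    rw [Finset.sum_comm]
    have : ∀ m, ∑ i ∈ (ℛ k b).index, P ((ℛ k b).left i) ((ℛ k x).left m) *
        t ((ℛ k b).right i) (S' ((ℛ k x).right m)) =
        t b (S' ((ℛ k x).right m) * (ℛ k x).left m) := by
      intro m
      rw [hm]
      conv_rhs => rw [← (ℛ k b).eq]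
      simp [evalAt₂_tmul, evalAt_apply, P]
    have hs : ∑ m ∈ (ℛ k x).index, S' ((ℛ k x).right m) * (ℛ k x).left m =
        algebraMap k H (counit x) := sum_antipode_symm_mul hS x
    simp only [this]
    rw [← map_sum, hs, Algebra.algebraMap_eq_smul_one, map_smul, h1]
    simp [Algebra.algebraMap_eq_smul_one, mul_comm]
  have e3 := left_inv_eq_right_inv e1 e2
  have e4 := congrArg (fun f => (f.ofConv b).ofConv (antipode k x)) e3
  refine e4.trans ?_
  have : S' (antipode k x) = x := (LinearEquiv.ofBijective _ hS).symm_apply_apply x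
  exact congrArg (t b) this

end AntipodePairing

end FRTDouble

namespace FRTDouble

/-! ### The cross relation in U_Q and the quotient map -/

section CrossRelation

open WithConv Coalgebra HopfAlgebra

namespace Parameters

variable {k : Type u} [Field k] {n : ℕ} (Q : Parameters k n) {B H U : Type u} [Ring B]
  [HopfAlgebra k B] [Ring H] [HopfAlgebra k H] {j : H →ₐ[k] ConvDual k Q.A}
  {j' : B →ₐ[k] ConvDual k Q.A} {l : Q.A →ₗc[k] H}

/-- The cross relation between `B^r` and `B^l`, evaluated at `x`: the braiding of the form on `A`
extends from `λ⁺(A)` to `B^l`. -/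
theorem sum_pair_mul_ev {t : B →ₐ[k] ConvDual k H} (hj : IsDual j) (hr : j.range = Q.Bl)
    (hl : ∀ a, j (l a) = Q.lamPlus a) (hj' : IsDual j') (ht : ∀ b, t b ∈ coefficients k H)
    (htl : ∀ b a, t b (l a) = j' b a) (u : B) (x : Q.A) :
    ∑ i ∈ (ℛ k u).index, ∑ m ∈ (ℛ k x).index,
        j' ((ℛ k u).right i) ((ℛ k x).left m) • (t ((ℛ k u).left i) * hj.ev ((ℛ k x).right m)) =
      ∑ i ∈ (ℛ k u).index, ∑ m ∈ (ℛ k x).index,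
        j' ((ℛ k u).left i) ((ℛ k x).right m) • (hj.ev ((ℛ k x).left m) * t ((ℛ k u).right i)) := by
  have hu : ∀ a b, j' u (a * b) =
      ∑ i ∈ (ℛ k u).index, j' ((ℛ k u).left i) a * j' ((ℛ k u).right i) b := by
    intro a b
    rw [← hj'.comul]
    conv_lhs => rw [← (ℛ k u).eq]
    simp [evalAt₂_tmul, evalAt_apply]
  have hev : ∀ y a, hj.ev y (l a) = Q.lamPlus a y := fun y a =>
    congrArg (fun f => f.ofConv y) (hl a)
  have hmul : ∀ (f g : ConvDual k H) a, (f * g) (l a) =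
      ∑ p ∈ (ℛ k a).index, f (l ((ℛ k a).left p)) * g (l ((ℛ k a).right p)) := by
    intro f g a
    have : (f * g) (l a) = (precomp k l f * precomp k l g) a :=
      congrArg (fun f => f.ofConv a) (map_mul (precomp k l) f g)
    rw [this, (ℛ k a).convMul_apply]
    rfl
  -- As functions of w both sides are coefficient functionals on B^l, so it suffices to test w =
  -- λ⁺(a).
  rw [← sub_eq_zero]
  refine Q.eq_zero_of_lamPlus hj hr hl (Subalgebra.sub_mem _
    (Subalgebra.sum_mem _ fun i _ => Subalgebra.sum_mem _ fun m _ => Subalgebra.smul_mem _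
      (Subalgebra.mul_mem _ (ht _) (Q.ev_mem_coefficients hj _)) _)
    (Subalgebra.sum_mem _ fun i _ => Subalgebra.sum_mem _ fun m _ => Subalgebra.smul_mem _
      (Subalgebra.mul_mem _ (Q.ev_mem_coefficients hj _) (ht _)) _)) fun a => ?_
  simp only [ofConv_sub, LinearMap.sub_apply, sub_eq_zero, ofConv_sum, LinearMap.sum_apply,
    ofConv_smul, LinearMap.smul_apply, hmul, hev, htl, smul_eq_mul, Finset.mul_sum]
  -- At w = λ⁺(a) the two sides are u applied to the two sides of the braiding identity for a and x;
  -- `h2` treats the other side.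
  have h1 : j' u (FRT.braidLeft Q.isCompatible_R x (comul a)) =
      ∑ p ∈ (ℛ k a).index, ∑ m ∈ (ℛ k x).index, ∑ i ∈ (ℛ k u).index,
        j' ((ℛ k u).right i) ((ℛ k x).left m) *
          (j' ((ℛ k u).left i) ((ℛ k a).left p) *
            Q.lamPlus ((ℛ k a).right p) ((ℛ k x).right m)) := by
    rw [← (ℛ k a).eq]
    simp only [map_sum, FRT.braidLeft_tmul, FRT.actLeft]
    refine Finset.sum_congr rfl fun p _ => ?_
    rw [convMul_scalar_apply _ _ _ (ℛ k x), Finset.mul_sum, map_sum]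
    refine Finset.sum_congr rfl fun m _ => ?_
    rw [Algebra.mul_smul_comm, map_smul]
    refine (congrArg (_ • ·) (hu _ _)).trans ?_
    rw [Finset.smul_sum]
    refine Finset.sum_congr rfl fun i _ => ?_
    rw [smul_eq_mul, lamPlus_eq]
    simp only [LinearMap.id_apply]
    ring
  have h2 : j' u (FRT.braidRight Q.isCompatible_R x (comul a)) =
      ∑ p ∈ (ℛ k a).index, ∑ m ∈ (ℛ k x).index, ∑ i ∈ (ℛ k u).index,
        j' ((ℛ k u).left i) ((ℛ k x).right m) *
          (Q.lamPlus ((ℛ k a).left p) ((ℛ k x).left m) *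
            j' ((ℛ k u).right i) ((ℛ k a).right p)) := by
    rw [← (ℛ k a).eq]
    simp only [map_sum, FRT.braidRight_tmul, FRT.actRight]
    refine Finset.sum_congr rfl fun p _ => ?_
    rw [scalar_convMul_apply _ _ _ (ℛ k x), Finset.sum_mul, map_sum]
    refine Finset.sum_congr rfl fun m _ => ?_
    rw [Algebra.smul_mul_assoc, map_smul]
    refine (congrArg (_ • ·) (hu _ _)).trans ?_
    rw [Finset.smul_sum]
    refine Finset.sum_congr rfl fun i _ => ?_
    rw [smul_eq_mul, lamPlus_eq]
    simp only [LinearMap.id_apply]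
    ring
  have reorder : ∀ {ι κ τ : Type u} (I : Finset ι) (K : Finset κ) (T : Finset τ)
      (f : ι → κ → τ → k),
      ∑ i ∈ I, ∑ m ∈ K, ∑ p ∈ T, f i m p = ∑ p ∈ T, ∑ m ∈ K, ∑ i ∈ I, f i m p := by
    intro ι κ τ I K T f
    rw [Finset.sum_comm]
    simp only [fun m => Finset.sum_comm (s := I) (t := T) (f := fun i p => f i m p)]
    exact Finset.sum_comm
  exact (reorder _ _ _ _).trans (h1.symm.trans ((congrArg (j' u)
    (FRT.braidLeft_comul Q.isCompatible_R a x)).trans (h2.trans (reorder _ _ _ _).symm)))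

variable [Ring U] [HopfAlgebra k U] {jU : U →ₐ[k] ConvDual k Q.A} {iB : B →ₐc[k] U}
  {iH : H →ₐc[k] U}

/-- Elements of U are functionals on A, so the relation may be evaluated at each x; expanding the
convolution products over the coproducts of u, w and x gives `sum_pair_mul_ev`. -/
theorem cross_relation (θ : DualEmbedding k B H) (hj : IsDual j) (hr : j.range = Q.Bl)
    (hl : ∀ a, j (l a) = Q.lamPlus a) (hj' : IsDual j') (hU : Function.Injective jU)
    (ht : ∀ b, θ.toHom b ∈ coefficients k H) (htl : ∀ b a, θ.toHom b (l a) = j' b a)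
    (hB : ∀ b, jU (iB b) = j' b) (hH : ∀ w, jU (iH w) = j w) :
    scalar k _ U θ.pair * (precomp U (sndHom k H B) (toConv (iB : B →ₗ[k] U)) *
        precomp U (fstHom k H B) (toConv (iH : H →ₗ[k] U))) =
      precomp U (fstHom k H B) (toConv (iH : H →ₗ[k] U)) *
        precomp U (sndHom k H B) (toConv (iB : B →ₗ[k] U)) * scalar k _ U θ.pair := by
  apply WithConv.ext
  refine TensorProduct.ext' fun w u => hU ?_
  ext x
  refine Eq.trans ?_ ((congrArg (fun f => f.ofConv w)
    (Q.sum_pair_mul_ev hj hr hl hj' ht htl u x)).trans ?_)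
  · refine (congrArg (fun z => jU z x) (scalar_convMul_apply _ _ _
      (reprTmul (ℛ k w) (ℛ k u)))).trans ?_
    simp only [reprTmul, Finset.sum_product, snd_convMul_fst, map_sum, map_smul, map_mul,
      ofConv_sum, LinearMap.sum_apply, ofConv_smul, LinearMap.smul_apply, smul_eq_mul]
    rw [Finset.sum_comm]
    refine Finset.sum_congr rfl fun i _ => ?_
    have e : ∀ b w', (jU (iB b) * jU (iH w')) x =
        ∑ m ∈ (ℛ k x).index, j' b ((ℛ k x).left m) * j w' ((ℛ k x).right m) := by
      intro b w'
      rw [hB, hH, (ℛ k x).convMul_apply]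
    have e' : ∀ b y, (θ.toHom b * hj.ev y) w = ∑ p ∈ (ℛ k w).index,
        θ.toHom b ((ℛ k w).left p) * j ((ℛ k w).right p) y := fun b y =>
      (ℛ k w).convMul_apply _ _
    simp only [e', Finset.mul_sum]
    rw [Finset.sum_comm]
    refine Finset.sum_congr rfl fun p _ => ?_
    refine (congrArg (_ * ·) (e _ _)).trans ?_
    rw [Finset.mul_sum]
    refine Finset.sum_congr rfl fun m _ => ?_
    rw [DualEmbedding.pair_tmul]
    ring
  · refine Eq.symm ((congrArg (fun z => jU z x) (convMul_scalar_apply _ _ _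
      (reprTmul (ℛ k w) (ℛ k u)))).trans ?_)
    simp only [reprTmul, Finset.sum_product, fst_convMul_snd, map_sum, map_smul, map_mul,
      ofConv_sum, LinearMap.sum_apply, ofConv_smul, LinearMap.smul_apply, smul_eq_mul]
    rw [Finset.sum_comm]
    refine Finset.sum_congr rfl fun i _ => ?_
    have e : ∀ b w', (jU (iH w') * jU (iB b)) x =
        ∑ m ∈ (ℛ k x).index, j w' ((ℛ k x).left m) * j' b ((ℛ k x).right m) := by
      intro b w'
      rw [hB, hH, (ℛ k x).convMul_apply]
    have e' : ∀ b y, (hj.ev y * θ.toHom b) w = ∑ p ∈ (ℛ k w).index,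
        j ((ℛ k w).left p) y * θ.toHom b ((ℛ k w).right p) := fun b y =>
      (ℛ k w).convMul_apply _ _
    simp only [e', Finset.mul_sum]
    rw [Finset.sum_comm]
    refine Finset.sum_congr rfl fun p _ => ?_
    refine (congrArg (_ * ·) (e _ _)).trans ?_
    rw [Finset.mul_sum]
    refine Finset.sum_congr rfl fun m _ => ?_
    rw [DualEmbedding.pair_tmul]
    ring

/-- The embedding of `B^r` in `(B^l)^{0 cop}`. -/
theorem exists_dualEmbedding (hS : Function.Bijective (antipode k (A := H))) (hj : IsDual j)
    (hr : j.range = Q.Bl) (hl : ∀ a, j (l a) = Q.lamPlus a) (hj' : IsDual j')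
    (hr' : j'.range = Q.Br) : ∃ θ : DualEmbedding k B H,
      (∀ b, θ.toHom b ∈ coefficients k H) ∧ ∀ b a, θ.toHom b (l a) = j' b a := by
  obtain ⟨t, ht, htl⟩ := Q.exists_toHom hj hr hl hr'
  have hm := Q.toHom_mul hj hr hl hj' ht htl
  have h1 : ∀ b, t b 1 = counit (R := k) b := by
    intro b
    have e := Q.map_lamPlus_algebraMap hj hl 1
    rw [map_one (algebraMap k H), map_one (algebraMap k Q.A)] at e
    rw [← e, htl, hj'.counit]
  refine ⟨⟨t, ?_, fun b => (mem_coefficients.1 (ht b)).isFinite, hm, h1,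
    pairing_antipode hS h1 hm⟩, ht, htl⟩
  -- The restriction of θ(b) along λ⁺ is b itself as a functional on A, so nothing is lost.
  intro b b' h
  apply hj'.injective
  ext a
  have e : t b (l a) = t b' (l a) := by rw [h]
  rwa [htl, htl] at e

/-- The double crossproduct of `B^l` and `B^r` exists and maps onto `U_Q`. -/
theorem exists_doubleCross (hS : Function.Bijective (antipode k (A := H))) (hj : IsDual j)
    (hr : j.range = Q.Bl) (hj' : IsDual j') (hr' : j'.range = Q.Br) (hjU : IsDual jU)
    (hrU : jU.range = Q.U) : ∃ θ : DualEmbedding k B H,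
      (∀ a b v w, j' v = Q.rhoPlus b → j w = Q.lamPlus a → θ.toHom v w = Q.form a b) ∧
      ∃ (P : Type u) (_ : Ring P) (_ : HopfAlgebra k P) (D : DoubleCross hS θ P)
        (φ : P →ₐc[k] U), Function.Surjective φ ∧
        (∀ x, φ (antipode k x) = antipode k (φ x)) ∧
        ∀ u w, jU (φ (D.bowtie (u ⊗ₜ w))) = j' u * j w := by
  obtain ⟨l, hl⟩ := Q.exists_lamPlus hj fun a => hr ▸ Q.lamPlus_mem a
  obtain ⟨θ, ht, htl⟩ := Q.exists_dualEmbedding hS hj hr hl hj' hr'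
  obtain ⟨iB, hB⟩ := hjU.exists_bialgHom hj' fun b => hrU ▸ Q.Br_le_U (hr' ▸ ⟨b, rfl⟩)
  obtain ⟨iH, hH⟩ := hjU.exists_bialgHom hj fun b => hrU ▸ Q.Bl_le_U (hr ▸ ⟨b, rfl⟩)
  have hc := Q.cross_relation θ hj hr hl hj' hjU.injective ht htl hB hH
  refine ⟨θ, ?_, Twist θ.cocycle, inferInstance, inferInstance, θ.doubleCross hS, θ.lift hc,
    θ.lift_surjective iB iH hc ?_, map_antipode_of_bialgHom _, ?_⟩
  · intro a b v w hv hw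
    have : w = l a := hj.injective (hw.trans (hl a).symm)
    rw [this, htl, hv]
    rfl
  · have : Q.U ≤ (Algebra.adjoin k (Set.range iB ∪ Set.range iH)).map jU := by
      refine Q.U_le ?_ ?_
      · rw [← hr]
        rintro _ ⟨w, rfl⟩
        exact ⟨iH w, Algebra.subset_adjoin (.inr ⟨w, rfl⟩), hH w⟩
      · rw [← hr']
        rintro _ ⟨b, rfl⟩
        exact ⟨iB b, Algebra.subset_adjoin (.inl ⟨b, rfl⟩), hB b⟩
    rw [eq_top_iff]
    rintro z -
    obtain ⟨z', hz', e⟩ := this (hrU ▸ ⟨z, rfl⟩ : jU z ∈ Q.U)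
    rwa [← hjU.injective e]
  · intro u w
    refine (congrArg jU (DualEmbedding.lift_tmul θ iB iH hc u w)).trans ?_
    rw [map_mul, hB, hH]

/-- Matches the semiring instances over which `DualHopf.hopfAlgebra` is built; an algebra over a
field is a ring, with negation given by the scalar -1. -/
theorem exists_doubleCross_of_dualHopf {B H U : Type u} [Semiring B] [Algebra k B] [Semiring H]
    [Algebra k H] [Semiring U] [Algebra k U] {j : H →ₐ[k] ConvDual k Q.A} {j' : B →ₐ[k] ConvDual k Q.A}
    {jU : U →ₐ[k] ConvDual k Q.A} (sU : DualHopf jU) (sl : DualHopf j) (sr : DualHopf j')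
    (hS : letI := sl.hopfAlgebra; Function.Bijective (antipode k (A := H)))
    (hr : j.range = Q.Bl) (hr' : j'.range = Q.Br) (hrU : jU.range = Q.U) :
    letI := sU.hopfAlgebra
    letI := sl.hopfAlgebra
    letI := sr.hopfAlgebra
    ∃ θ : DualEmbedding k B H,
      (∀ a b v w, j' v = Q.rhoPlus b → j w = Q.lamPlus a → θ.toHom v w = Q.form a b) ∧
      ∃ (P : Type u) (_ : Ring P) (_ : HopfAlgebra k P) (D : DoubleCross hS θ P)
        (φ : P →ₐc[k] U), Function.Surjective φ ∧
        (∀ x, φ (antipode k x) = antipode k (φ x)) ∧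
        ∀ u w, jU (φ (D.bowtie (u ⊗ₜ w))) = j' u * j w :=
  letI : Ring B := Algebra.semiringToRing k
  letI : Ring H := Algebra.semiringToRing k
  letI : Ring U := Algebra.semiringToRing k
  letI := sU.hopfAlgebra
  letI := sl.hopfAlgebra
  letI := sr.hopfAlgebra
  Q.exists_doubleCross hS sl.isDual hr sr.isDual hr' sU.isDual hrU

end Parameters

end CrossRelation

end FRTDouble

theorem theorem3p2 {k : Type u} [Field k] [IsAlgClosed k] [CharZero k] (n : ℕ)
    (Q : FRTDouble.Parameters k n) :
    ∃ (sU : FRTDouble.DualHopf Q.U.val) (sl : FRTDouble.DualHopf Q.Bl.val)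
      (sr : FRTDouble.DualHopf Q.Br.val),
      letI := sU.hopfAlgebra
      letI := sl.hopfAlgebra
      letI := sr.hopfAlgebra
      ∃ (hS : Function.Bijective (HopfAlgebra.antipode k (A := Q.Bl)))
        (θ : FRTDouble.DualEmbedding k Q.Br Q.Bl),
        (∀ a b : Q.A, ∃ (hv : Q.rhoPlus b ∈ Q.Br) (hw : Q.lamPlus a ∈ Q.Bl),
          θ.toHom ⟨Q.rhoPlus b, hv⟩ ⟨Q.lamPlus a, hw⟩ = Q.form a b) ∧
        ∃ (P : Type u) (_ : Ring P) (_ : HopfAlgebra k P) (D : FRTDouble.DoubleCross hS θ P)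
          (φ : P →ₐc[k] Q.U),
          Function.Surjective φ ∧
          (∀ x, φ (HopfAlgebra.antipode k x) = HopfAlgebra.antipode k (φ x)) ∧
          ∀ (u : Q.Br) (w : Q.Bl),
            (φ (D.bowtie (u ⊗ₜ w)) : FRTDouble.ConvDual k Q.A) = u * w := by
  -- For U_Q the generating set is the union of those of B^l and B^r.
  obtain ⟨sU⟩ := (Q.isPointedDual_Bl.union Q.isPointedDual_Br).nonempty_dualHopf Q.U Q.U_eq
  obtain ⟨sl, hS⟩ : ∃ t : FRTDouble.DualHopf Q.Bl.val, letI := t.hopfAlgebra;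
      Function.Bijective (HopfAlgebra.antipode k (A := Q.Bl)) :=
    Q.isPointedDual_Bl.exists_dualHopf
  obtain ⟨sr⟩ := Q.isPointedDual_Br.nonempty_dualHopf Q.Br rfl
  obtain ⟨θ, hθ, h⟩ := Q.exists_doubleCross_of_dualHopf (B := Q.Br) (H := Q.Bl) (U := Q.U)
    (j := Q.Bl.val) (j' := Q.Br.val) (jU := Q.U.val) sU sl sr hS (Subalgebra.range_val _)
    (Subalgebra.range_val _) (Subalgebra.range_val _)
  refine ⟨sU, sl, sr, hS, θ, fun a b => ⟨Q.rhoPlus_mem b, Q.lamPlus_mem a, ?_⟩, h⟩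
  exact hθ a b _ _ rfl rfl
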